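/- For finite sets $S,S'$ let $\mathrm{HamDist}(S,S')=|S\setminus S'|+|S'\setminus S|$, and for a list $S_1,\dots,S_r$ of finite sets (repetitions allowed) let $\mathrm{Div}(S_1,\dots,S_r)=\sum_{1\le i<j\le r}\mathrm{HamDist}(S_i,S_j)$. For a subset minimization problem $\Pi$, an instance of Diverse $\Pi$ is a tuple $(I,k,r,t)$ with $I$ an instance of $\Pi$ and $k,r,t\in\mathbb N$ (written in binary); the question is whether there are solutions $S_1,\dots,S_r$ of $I$ with $|S_i|\le k$ for all $i$ and $\mathrm{Div}(S_1,\dots,S_r)\ge t$. A polynomial kernel for Diverse $\Pi$, parameterized by $k+r$, is a polynomial-time algorithm that maps every instance $(I,k,r,t)$ to an equivalent instance $(I',k',r',t')$ of Diverse $\Pi$ such that $|I'|+k'+r'$ plus the encoding length of $t'$ is at most $s(k+r)$ for a fixed polynomial $s$. Here $|I|$ is the encoding length of $I$, except that for Point Line Cover, as is usual for this problem, $|I|$ is the number of points (their coordinates are not counted). The following diverse problems, parameterized by $k+r$, admit polynomial kernels with the stated bounds on the number of vertices or points of $I'$. (i) Diverse Vertex Cover (solutions: vertex covers of a finite simple graph):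 $\mathcal O(k(k+r))$ vertices. (ii) For every fixed $d$, Diverse $d$-Hitting Set (solutions: vertex sets meeting every hyperedge of a finite hypergraph whose hyperedges have at most $d$ elements): $\mathcal O(k^d+kr)$ vertices, with a constant that may depend on $d$. (iii) Diverse Point Line Cover (instances: finite sets $P$ of points of the plane, with rational coordinates; solutions: finite sets of lines of the plane such that every point of $P$ lies on at least one of them): $\mathcal O(k(k+r))$ points. Moreover, the variant in which a solution may use only lines through two distinct points of $P$ also admits a polynomial kernel, on $\mathcal O(k^2(k+r))$ points. (iv) Diverse Feedback Arc Set in Tournaments (solutions: sets of arcs of a tournament whose removal leaves no directed cycle): $\mathcal O(k(k+r))$ vertices. -/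

import Mathlib

/-! ### A programming language with a step count

Programs are while-programs acting on binary trees.  Every elementary step is charged the size of
the tree it reads, so that values are never larger than the time spent, and running times agree
with those of multi-tape Turing machines up to a polynomial. -/

/-- Binary trees, the data on which programs operate. -/
inductive Data : Type
  | nil : Data
  | cons : Data → Data → Data

/-- The number of nodes (leaves included). -/
def Data.size : Data → ℕ
  | .nil => 1
  | .cons a b => a.size + b.size + 1

/-- Programs transforming one tree into another. -/
inductive Prog : Type
  | id : Prog
  | nil : Prog
  | head : Prog
  | tail : Prog
  | cons : Prog → Prog → Prog
  | seq : Prog → Prog → Prog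
  | cond : Prog → Prog → Prog → Prog
  | loop : Prog → Prog → Prog

/-- `Exec p x y n`: the program `p`, started on `x`, halts with output `y` at total cost `n`.
A test counts as passed when its value is not `nil`; `loop c p` is "while `c` do `p`". -/
inductive Exec : Prog → Data → Data → ℕ → Prop
  | id (x : Data) : Exec .id x x x.size
  | nil (x : Data) : Exec .nil x .nil x.size
  | head_nil : Exec .head .nil .nil 1
  | head_cons (a b : Data) : Exec .head (.cons a b) a (Data.cons a b).size
  | tail_nil : Exec .tail .nil .nil 1
  | tail_cons (a b : Data) : Exec .tail (.cons a b) b (Data.cons a b).size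
  | cons {p q : Prog} {x a b : Data} {m n : ℕ} :
      Exec p x a m → Exec q x b n → Exec (.cons p q) x (.cons a b) (m + n + x.size)
  | seq {p q : Prog} {x y z : Data} {m n : ℕ} :
      Exec p x y m → Exec q y z n → Exec (.seq p q) x z (m + n)
  | cond_true {c p q : Prog} {x v y : Data} {m n : ℕ} :
      Exec c x v m → v ≠ .nil → Exec p x y n → Exec (.cond c p q) x y (m + n + x.size)
  | cond_false {c p q : Prog} {x y : Data} {m n : ℕ} :
      Exec c x .nil m → Exec q x y n → Exec (.cond c p q) x y (m + n + x.size)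
  | loop_stop {c p : Prog} {x : Data} {m : ℕ} :
      Exec c x .nil m → Exec (.loop c p) x x (m + x.size)
  | loop_step {c p : Prog} {x v y z : Data} {m n l : ℕ} :
      Exec c x v m → v ≠ .nil → Exec p x y n → Exec (.loop c p) y z l →
      Exec (.loop c p) x z (m + n + l + x.size)

/-- `f` is computable in polynomial time with respect to the encodings `ea` and `eb`. -/
def PolyTime {α β : Type} (ea : α → Data) (eb : β → Data) (f : α → β) : Prop :=
  ∃ (p : Prog) (T : Polynomial ℕ), ∀ x : α,
    ∃ n : ℕ, n ≤ T.eval (ea x).size ∧ Exec p (ea x) (eb (f x)) n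

/-! ### Encodings (numbers in binary) -/

def encList {α : Type} (e : α → Data) : List α → Data
  | [] => .nil
  | a :: l => .cons (e a) (encList e l)

def encBool : Bool → Data
  | false => .nil
  | true => .cons .nil .nil

/-- Binary encoding, least significant bit first. -/
def encNat (n : ℕ) : Data := encList encBool n.bits

def encInt (z : ℤ) : Data := .cons (encBool (decide (z < 0))) (encNat z.natAbs)

def encRat (q : ℚ) : Data := .cons (encInt q.num) (encNat q.den)

/-- A Boolean matrix, as the list of its rows. -/
def encMatrix {m n : ℕ} (M : Fin m → Fin n → Bool) : Data :=
  encList (encList encBool) (List.ofFn fun i => List.ofFn (M i))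

/-! ### Subset minimization problems and their diverse versions -/

/-- The Hamming distance of two finite sets. -/
noncomputable def hamDist {α : Type} (S S' : Finset α) : ℕ := by
  classical exact (S \ S').card + (S' \ S).card

/-- The diversity of a list of finite sets: the sum of all pairwise Hamming distances. -/
noncomputable def diversity {α : Type} {r : ℕ} (S : Fin r → Finset α) : ℕ :=
  ∑ i : Fin r, ∑ j ∈ Finset.Ioi i, hamDist (S i) (S j)

/-- A subset minimization problem: the solutions of an instance `I` are certain finite sets of
items, and one looks for solutions with at most `k` items. -/
structure SubsetProblem where
  /-- Instances, without the bound `k`. -/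
  Inst : Type
  /-- The encoding with respect to which running times are measured. -/
  enc : Inst → Data
  /-- The items solutions consist of. -/
  Item : Inst → Type
  /-- The solutions, of any cardinality. -/
  IsSolution : (I : Inst) → Finset (Item I) → Prop
  /-- The number of vertices (or points) of an instance. -/
  order : Inst → ℕ
  /-- The size of an instance in kernel size bounds. -/
  size : Inst → ℕ

/-- An instance `(I, k, r, t)` of the diverse version of a subset minimization problem. -/
structure DiverseInst (Q : SubsetProblem) where
  inst : Q.Inst
  k : ℕ
  r : ℕ
  t : ℕ

/-- Are there `r` solutions, each of at most `k` items, whose diversity is at least `t`? -/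
def DiverseInst.IsYes {Q : SubsetProblem} (x : DiverseInst Q) : Prop :=
  ∃ S : Fin x.r → Finset (Q.Item x.inst),
    (∀ i, Q.IsSolution x.inst (S i) ∧ (S i).card ≤ x.k) ∧ x.t ≤ diversity S

def DiverseInst.enc {Q : SubsetProblem} (x : DiverseInst Q) : Data :=
  .cons (Q.enc x.inst) (.cons (encNat x.k) (.cons (encNat x.r) (encNat x.t)))

/-- The size of an instance; `k` and `r`, which make up the parameter, count with their values. -/
def DiverseInst.size {Q : SubsetProblem} (x : DiverseInst Q) : ℕ :=
  Q.size x.inst + x.k + x.r + (encNat x.t).size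

/-- The diverse version of `Q`, parameterized by `k + r`, has a polynomial kernel on
`O(b k r)` vertices (or points). -/
def HasDiverseKernel (Q : SubsetProblem) (b : ℕ → ℕ → ℕ) : Prop :=
  ∃ K : DiverseInst Q → DiverseInst Q,
    PolyTime DiverseInst.enc DiverseInst.enc K ∧
    (∀ x, (K x).IsYes ↔ x.IsYes) ∧
    (∃ s : Polynomial ℕ, ∀ x, (K x).size ≤ s.eval (x.k + x.r)) ∧
    (∃ C : ℕ, ∀ x, Q.order (K x).inst ≤ C * b x.k x.r)

/-! ### Vertex Cover -/

/-- A finite simple graph on the vertices `0, …, n - 1`. -/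
structure GraphInst where
  n : ℕ
  G : SimpleGraph (Fin n)

open Classical in
/-- Encoding by the adjacency matrix. -/
noncomputable def GraphInst.enc (I : GraphInst) : Data :=
  encMatrix fun u v => decide (I.G.Adj u v)

noncomputable def vertexCover : SubsetProblem where
  Inst := GraphInst
  enc := GraphInst.enc
  Item I := Fin I.n
  IsSolution I S := ∀ u v, I.G.Adj u v → u ∈ S ∨ v ∈ S
  order I := I.n
  size I := I.enc.size

/-! ### `d`-Hitting Set -/

/-- A hypergraph on the vertices `0, …, n - 1`, all of whose hyperedges have at most `d`
elements. -/
structure HypergraphInst (d : ℕ) where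
  n : ℕ
  edges : List (Finset (Fin n))
  card_le : ∀ e ∈ edges, e.card ≤ d

/-- Encoding by `n` in unary and the incidence vectors of the hyperedges. -/
def HypergraphInst.enc {d : ℕ} (I : HypergraphInst d) : Data :=
  .cons (encList (fun _ => Data.nil) (List.range I.n))
    (encList (fun e => encList encBool (List.ofFn fun v => decide (v ∈ e))) I.edges)

def hittingSet (d : ℕ) : SubsetProblem where
  Inst := HypergraphInst d
  enc := HypergraphInst.enc
  Item I := Fin I.n
  IsSolution I S := ∀ e ∈ I.edges, ∃ v ∈ e, v ∈ S
  order I := I.n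
  size I := I.enc.size

/-! ### Point Line Cover -/

abbrev Plane : Type := EuclideanSpace ℝ (Fin 2)

/-- The point with the given rational coordinates. -/
noncomputable def ratPoint (p : ℚ × ℚ) : Plane := !₂[(p.1 : ℝ), (p.2 : ℝ)]

/-- A finite set of points, given as a list of rational coordinates. -/
abbrev PointsInst : Type := List (ℚ × ℚ)

def PointsInst.enc (P : PointsInst) : Data :=
  encList (fun p => .cons (encRat p.1) (encRat p.2)) P

/-- `S` consists of lines of the plane, and every point lies on one of them. -/
def IsLineCover (P : PointsInst) (S : Finset (AffineSubspace ℝ Plane)) : Prop :=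
  (∀ l ∈ S, Module.finrank ℝ l.direction = 1) ∧ ∀ p ∈ P, ∃ l ∈ S, ratPoint p ∈ l

/-- Point Line Cover. Sizes are measured by the number of points. -/
noncomputable def pointLineCover : SubsetProblem where
  Inst := PointsInst
  enc := PointsInst.enc
  Item _ := AffineSubspace ℝ Plane
  IsSolution P S := IsLineCover P S
  order P := P.length
  size P := P.length

/-- The lines through two distinct points of `P`. -/
def spannedLines (P : PointsInst) : Set (AffineSubspace ℝ Plane) :=
  {l | ∃ p ∈ P, ∃ q ∈ P, p ≠ q ∧ l = line[ℝ, ratPoint p, ratPoint q]}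

/-- Point Line Cover where a solution may only use lines through two distinct points of `P`. -/
noncomputable def spannedPointLineCover : SubsetProblem where
  Inst := PointsInst
  enc := PointsInst.enc
  Item _ := AffineSubspace ℝ Plane
  IsSolution P S := (∀ l ∈ S, l ∈ spannedLines P) ∧ IsLineCover P S
  order P := P.length
  size P := P.length

/-! ### Feedback Arc Set in Tournaments -/

/-- A tournament on the vertices `0, …, n - 1`. -/
structure TournamentInst where
  n : ℕ
  D : Digraph (Fin n)
  irrefl : ∀ u, ¬ D.Adj u u
  asymm : ∀ u v, D.Adj u v → ¬ D.Adj v u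
  total : ∀ u v, u ≠ v → D.Adj u v ∨ D.Adj v u

open Classical in
/-- Encoding by the adjacency matrix. -/
noncomputable def TournamentInst.enc (I : TournamentInst) : Data :=
  encMatrix fun u v => decide (I.D.Adj u v)

/-- A solution is a set of arcs whose removal leaves no directed cycle. -/
noncomputable def feedbackArcSet : SubsetProblem where
  Inst := TournamentInst
  enc := TournamentInst.enc
  Item I := Fin I.n × Fin I.n
  IsSolution I S := (∀ e ∈ S, I.D.Adj e.1 e.2) ∧
    ∀ v, ¬ Relation.TransGen (fun a b => I.D.Adj a b ∧ (a, b) ∉ S) v v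
  order I := I.n
  size I := I.enc.size

/-!
Each kernel keeps part of the instance together with enough interchangeable spare items. A family
of `r` solutions with at most `k` items each uses at most `k * r` items, so the used items that the
kernel loses can be renamed injectively into spare ones, and injective renamings preserve Hamming
distances.

Hitting sets: a hyperedge is dropped if it has a subset `C` contained in `(k + 1) ^ (d - |C|)` of
the hyperedges kept before it. Every set larger than `C` by one vertex lies in fewer of these by a
factor `k + 1`, so a hitting set of the kept hyperedges with at most `k` vertices meets `C` already.
Vertex covers are the case `d = 2`.

Points and lines: a point is dropped if it is on a line through `N` of the points kept before it,
since such a line belongs to every cover by fewer than `N` lines. If solutions are restricted to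
spanned lines, the spanned lines lost in this way are exchanged for lines joining one point to
the points of such a line.

Tournaments: an arc in more than `k` directed triangles is in every feedback arc set with at most
`k` arcs. Once these arcs are reversed, only vertices on triangles matter, and those are few.
-/

/-! ### Polynomial time functions between encoded types -/

@[gcongr]
theorem eval_nat_mono (T : Polynomial ℕ) {m n : ℕ} (h : m ≤ n) : T.eval m ≤ T.eval n := by
  rw [Polynomial.eval_eq_sum_range, Polynomial.eval_eq_sum_range]
  gcongr

theorem Data.size_pos (x : Data) : 0 < x.size := by cases x <;> simp [Data.size]

theorem Exec.size_le {p : Prog} {x y : Data} {n : ℕ} (h : Exec p x y n) : y.size ≤ n := by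
  induction h with
  | nil x => exact x.size_pos
  | @cons _ _ x => have := x.size_pos; simp only [Data.size]; omega
  | _ => (try simp only [Data.size] at *); omega

/-- Types with a standard encoding by binary trees. -/
class TreeEncoding (α : Type) where
  enc : α → Data

open TreeEncoding (enc)

instance : TreeEncoding Data := ⟨id⟩
instance : TreeEncoding Bool := ⟨encBool⟩
instance : TreeEncoding ℕ := ⟨encNat⟩
instance : TreeEncoding ℤ := ⟨encInt⟩
instance : TreeEncoding ℚ := ⟨encRat⟩
instance : TreeEncoding Unit := ⟨fun _ => .nil⟩
instance {α β : Type} [TreeEncoding α] [TreeEncoding β] : TreeEncoding (α × β) :=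
  ⟨fun x => .cons (enc x.1) (enc x.2)⟩
instance {α : Type} [TreeEncoding α] : TreeEncoding (List α) := ⟨encList enc⟩

theorem enc_pair {α β : Type} [TreeEncoding α] [TreeEncoding β] (a : α) (b : β) :
    enc (a, b) = .cons (enc a) (enc b) := rfl

theorem enc_nil {α : Type} [TreeEncoding α] : enc ([] : List α) = .nil := rfl

theorem enc_cons {α : Type} [TreeEncoding α] (a : α) (l : List α) :
    enc (a :: l) = .cons (enc a) (enc l) := rfl

theorem enc_nat (n : ℕ) : enc n = enc n.bits := rfl

/-- The size of the standard encoding, in terms of which running times are measured. -/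
abbrev encSize {α : Type} [TreeEncoding α] (a : α) : ℕ := (enc a).size

theorem encSize_foldl_le {α σ : Type} [TreeEncoding σ] {step : σ → α → σ} {l : List α}
    {P : ℕ} (h : ∀ s, ∀ a ∈ l, encSize (step s a) ≤ encSize s + P) (s : σ) :
    encSize (l.foldl step s) ≤ encSize s + l.length * P := by
  induction l generalizing s with
  | nil => simp
  | cons a l ih =>
    have hl := ih (fun s b hb => h s b (List.mem_cons_of_mem _ hb)) (step s a)
    have ha := h s a List.mem_cons_self
    simp only [List.foldl_cons, List.length_cons, add_mul]
    omega

section Basic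

variable {α β γ δ σ : Type}
variable [TreeEncoding α] [TreeEncoding β] [TreeEncoding γ] [TreeEncoding δ] [TreeEncoding σ]

theorem encSize_pos (a : α) : 0 < encSize a := Data.size_pos _

@[simp] theorem encSize_pair (a : α) (b : β) : encSize (a, b) = encSize a + encSize b + 1 := rfl

@[simp] theorem encSize_nil : encSize ([] : List α) = 1 := rfl

@[simp] theorem encSize_cons (a : α) (l : List α) :
    encSize (a :: l) = encSize a + encSize l + 1 := rfl

theorem encSize_append (l l' : List α) : encSize (l ++ l') + 1 = encSize l + encSize l' := by
  induction l with
  | nil => simp only [List.nil_append, encSize_nil]; omega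
  | cons a l ih => simp only [List.cons_append, encSize_cons]; omega

theorem encSize_bool_le (b : Bool) : encSize b ≤ 3 := by cases b <;> decide

theorem length_lt_encSize (l : List α) : l.length < encSize l := by
  induction l with
  | nil => simp
  | cons a l ih => simp only [List.length_cons, encSize_cons]; omega

theorem encSize_lt_of_mem {l : List α} {a : α} (h : a ∈ l) : encSize a < encSize l := by
  induction l with
  | nil => simp at h
  | cons b l ih =>
    rw [encSize_cons]
    rcases List.mem_cons.1 h with rfl | h
    · omega
    · have := ih h; omega

theorem encSize_list_le {l : List α} {B : ℕ} (h : ∀ a ∈ l, encSize a ≤ B) :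
    encSize l ≤ l.length * (B + 1) + 1 := by
  induction l with
  | nil => simp
  | cons a l ih =>
    obtain ⟨ha, hl⟩ := List.forall_mem_cons.1 h
    have := ih hl
    simp only [encSize_cons, List.length_cons, add_mul]
    omega

/-- Polynomial time computability with respect to the standard encodings. -/
@[fun_prop]
def PolyTimeFun (f : α → β) : Prop := PolyTime enc enc f

namespace PolyTimeFun

theorem exists_encSize_le {f : α → β} (hf : PolyTimeFun f) :
    ∃ B : Polynomial ℕ, ∀ a, encSize (f a) ≤ B.eval (encSize a) := by
  obtain ⟨p, T, h⟩ := hf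
  refine ⟨T, fun a => ?_⟩
  obtain ⟨n, hn, he⟩ := h a
  exact he.size_le.trans hn

theorem of_enc_eq {f : α → β} {g : α → γ} (hf : PolyTimeFun f)
    (h : ∀ a, enc (g a) = enc (f a)) : PolyTimeFun g := by
  obtain ⟨p, T, hp⟩ := hf
  exact ⟨p, T, fun a => h a ▸ hp a⟩

theorem congr {f g : α → β} (hf : PolyTimeFun f) (h : ∀ a, f a = g a) : PolyTimeFun g :=
  funext h ▸ hf

@[fun_prop]
theorem id : PolyTimeFun (fun a : α => a) :=
  ⟨.id, Polynomial.X, fun _ => ⟨_, by simp, .id _⟩⟩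

@[fun_prop]
theorem comp {g : β → γ} {f : α → β} (hg : PolyTimeFun g) (hf : PolyTimeFun f) :
    PolyTimeFun (fun a => g (f a)) := by
  obtain ⟨p, T, hp⟩ := hf
  obtain ⟨q, U, hq⟩ := hg
  refine ⟨.seq p q, T + U.comp T, fun a => ?_⟩
  obtain ⟨m, hm, h1⟩ := hp a
  obtain ⟨n, hn, h2⟩ := hq (f a)
  refine ⟨m + n, ?_, h1.seq h2⟩
  rw [Polynomial.eval_add, Polynomial.eval_comp]
  exact Nat.add_le_add hm (hn.trans (eval_nat_mono U (h1.size_le.trans hm)))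

theorem of_enc_eq_cons {g : α → γ} {f₁ : α → β} {f₂ : α → δ} (h₁ : PolyTimeFun f₁)
    (h₂ : PolyTimeFun f₂) (h : ∀ a, enc (g a) = .cons (enc (f₁ a)) (enc (f₂ a))) :
    PolyTimeFun g := by
  obtain ⟨p, T, hp⟩ := h₁
  obtain ⟨q, U, hq⟩ := h₂
  refine ⟨.cons p q, T + U + Polynomial.X, fun a => ?_⟩
  obtain ⟨m, hm, h1⟩ := hp a
  obtain ⟨n, hn, h2⟩ := hq a
  refine ⟨_, ?_, h a ▸ h1.cons h2⟩
  simp only [Polynomial.eval_add, Polynomial.eval_X]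
  omega

@[fun_prop]
theorem prodMk {f : α → β} {g : α → γ} (hf : PolyTimeFun f) (hg : PolyTimeFun g) :
    PolyTimeFun (fun a => (f a, g a)) :=
  hf.of_enc_eq_cons hg fun _ => rfl

@[fun_prop]
theorem fst {f : α → β × γ} (hf : PolyTimeFun f) : PolyTimeFun (fun a => (f a).1) :=
  comp (g := Prod.fst) ⟨.head, .X, fun x => ⟨(enc x).size, by simp, .head_cons _ _⟩⟩ hf

@[fun_prop]
theorem snd {f : α → β × γ} (hf : PolyTimeFun f) : PolyTimeFun (fun a => (f a).2) :=
  comp (g := Prod.snd) ⟨.tail, .X, fun x => ⟨(enc x).size, by simp, .tail_cons _ _⟩⟩ hf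

@[fun_prop]
theorem const (b : β) : PolyTimeFun (fun _ : α => b) := by
  suffices h : ∀ d : Data, PolyTimeFun (fun _ : α => d) from (h (enc b)).of_enc_eq fun _ => rfl
  intro d
  induction d with
  | nil => exact ⟨.nil, .X, fun a => ⟨_, by simp, .nil _⟩⟩
  | cons a b iha ihb => exact iha.of_enc_eq_cons ihb fun _ => rfl

theorem cond_of_ne_nil_iff {c : α → Data} {b : α → Bool} {f g : α → β} (hc : PolyTimeFun c)
    (hb : ∀ a, b a = true ↔ c a ≠ .nil) (hf : PolyTimeFun f) (hg : PolyTimeFun g) :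
    PolyTimeFun (fun a => bif b a then f a else g a) := by
  obtain ⟨p, T, hp⟩ := hc
  obtain ⟨q, U, hq⟩ := hf
  obtain ⟨r, V, hr⟩ := hg
  refine ⟨.cond p q r, T + U + V + Polynomial.X, fun a => ?_⟩
  obtain ⟨m, hm, h1⟩ := hp a
  obtain ⟨n, hn, h2⟩ := hq a
  obtain ⟨l, hl, h3⟩ := hr a
  simp only [Polynomial.eval_add, Polynomial.eval_X]
  cases h : b a with
  | true => exact ⟨m + n + (enc a).size, by omega, h1.cond_true ((hb a).1 h) h2⟩
  | false =>
    have h0 : enc (c a) = .nil := not_not.1 fun h' => by simpa [h] using (hb a).2 h'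
    exact ⟨m + l + (enc a).size, by omega, Exec.cond_false (h0 ▸ h1) h3⟩

@[fun_prop]
theorem cond {b : α → Bool} {f g : α → β} (hb : PolyTimeFun b) (hf : PolyTimeFun f)
    (hg : PolyTimeFun g) : PolyTimeFun (fun a => bif b a then f a else g a) := by
  refine cond_of_ne_nil_iff (c := fun a => enc (b a)) (hb.of_enc_eq fun _ => rfl)
    (fun a => ?_) hf hg
  cases b a <;> simp [enc, encBool]

@[fun_prop]
theorem list_cons {f : α → β} {g : α → List β} (hf : PolyTimeFun f) (hg : PolyTimeFun g) :
    PolyTimeFun (fun a => f a :: g a) :=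
  hf.of_enc_eq_cons hg fun _ => rfl

@[fun_prop]
theorem list_tail {f : α → List β} (hf : PolyTimeFun f) : PolyTimeFun (fun a => (f a).tail) := by
  refine comp (g := List.tail) ⟨.tail, .X, fun l => ?_⟩ hf
  cases l with
  | nil => exact ⟨1, by simp [enc_nil, Data.size], .tail_nil⟩
  | cons a l => exact ⟨(enc (a :: l)).size, by simp, .tail_cons _ _⟩

theorem list_headD {f : α → List β} (hf : PolyTimeFun f) (b : β) (hb : enc b = .nil) :
    PolyTimeFun (fun a => (f a).headD b) := by
  refine comp (g := fun l : List β => l.headD b) ⟨.head, .X, fun l => ?_⟩ hf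
  cases l with
  | nil => exact ⟨1, by simp [enc_nil, Data.size], by simpa [enc_nil, hb] using Exec.head_nil⟩
  | cons a l => exact ⟨(enc (a :: l)).size, by simp, .head_cons _ _⟩

@[fun_prop]
theorem list_isEmpty {f : α → List β} (hf : PolyTimeFun f) :
    PolyTimeFun (fun a => (f a).isEmpty) := by
  have h : PolyTimeFun (fun a => bif !(f a).isEmpty then false else true) := by
    refine cond_of_ne_nil_iff (c := fun a => enc (f a)) (hf.of_enc_eq fun _ => rfl) (fun a => ?_)
      (const _) (const _)
    cases f a <;> simp [enc_nil, enc_cons]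
  exact h.congr fun a => by cases (f a).isEmpty <;> rfl

end PolyTimeFun

/-- The body of the loop of `Prog.fold`, acting on `(context, state, remaining list)`; `p` computes
the new state from `(context, state, head of the list)`. -/
def Prog.foldBody (p : Prog) : Prog :=
  .cons .head
    (.cons (.seq (.cons .head (.cons (.seq .tail .head) (.seq (.seq .tail .tail) .head))) p)
      (.seq (.seq .tail .tail) .tail))

/-- The program folding `p` over a list, acting on `(context, state, list)`. -/
def Prog.fold (p : Prog) : Prog := .loop (.seq .tail .tail) p.foldBody

theorem Prog.exec_foldBody {p : Prog} {C S A L S' : Data} {n : ℕ}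
    (h : Exec p (.cons C (.cons S A)) S' n) :
    ∃ m, m ≤ n + 30 * (Data.cons C (.cons S (.cons A L))).size ∧
      Exec p.foldBody (.cons C (.cons S (.cons A L))) (.cons C (.cons S' L)) m := by
  have hA : Exec (.seq (.seq .tail .tail) .head) (.cons C (.cons S (.cons A L))) A _ :=
    .seq (.seq (.tail_cons _ _) (.tail_cons _ _)) (.head_cons _ _)
  have hL : Exec (.seq (.seq .tail .tail) .tail) (.cons C (.cons S (.cons A L))) L _ :=
    .seq (.seq (.tail_cons _ _) (.tail_cons _ _)) (.tail_cons _ _)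
  have hS : Exec (.seq .tail .head) (.cons C (.cons S (.cons A L))) S _ :=
    .seq (.tail_cons _ _) (.head_cons _ _)
  refine ⟨_, ?_, .cons (.head_cons _ _) (.cons (.seq (.cons (.head_cons _ _) (.cons hS hA)) h) hL)⟩
  simp only [Data.size]
  omega

theorem Prog.exec_fold {p : Prog} {step : σ → α → σ} {C : Data} {B M : ℕ} (l : List α) (s : σ)
    (hp : ∀ s, encSize s ≤ B → ∀ a ∈ l,
      ∃ n ≤ M, Exec p (.cons C (.cons (enc s) (enc a))) (enc (step s a)) n)
    (hB : ∀ l', l' <+: l → encSize (l'.foldl step s) ≤ B) :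
    ∃ n, n ≤ (l.length + 1) * (M + 40 * (C.size + B + encSize l + 2)) ∧
      Exec p.fold (.cons C (.cons (enc s) (enc l)))
        (.cons C (.cons (enc (l.foldl step s)) .nil)) n := by
  induction l generalizing s with
  | nil =>
    refine ⟨_, ?_, Exec.loop_stop (.seq (.tail_cons _ _) (.tail_cons _ _))⟩
    have hs := hB [] ⟨_, rfl⟩
    simp only [List.foldl_nil, Data.size, enc_nil, encSize, List.length_nil] at hs ⊢
    omega
  | cons a l ih =>
    have hs : encSize s ≤ B := hB [] ⟨_, rfl⟩
    obtain ⟨m, hm, h1⟩ := hp s hs a List.mem_cons_self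
    obtain ⟨n, hn, h2⟩ := Prog.exec_foldBody (L := enc l) h1
    obtain ⟨k, hk, h3⟩ := ih (step s a) (fun s hs b hb => hp s hs b (List.mem_cons_of_mem _ hb))
      (fun l' hl' => hB (a :: l') (hl'.elim fun t ht => ⟨t, by rw [List.cons_append, ht]⟩))
    refine ⟨_, ?_, .loop_step (.seq (.tail_cons _ _) (.tail_cons _ _)) (by simp [enc_cons]) h2 h3⟩
    have hl : encSize (a :: l) = encSize a + encSize l + 1 := rfl
    have hk' : k ≤ (l.length + 1) * (M + 40 * (C.size + B + encSize (a :: l) + 2)) :=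
      hk.trans (by gcongr; omega)
    rw [List.length_cons, add_mul (l.length + 1), one_mul]
    simp only [Data.size, enc_cons, encSize] at hn hs hl hk' ⊢
    omega

namespace PolyTimeFun

theorem foldl_with_context {l : γ → List α} {s : γ → σ} {step : γ → σ → α → σ}
    (hl : PolyTimeFun l) (hs : PolyTimeFun s)
    (hstep : PolyTimeFun (fun x : γ × σ × α => step x.1 x.2.1 x.2.2)) {B : Polynomial ℕ}
    (hB : ∀ c l', l' <+: l c → encSize (l'.foldl (step c) (s c)) ≤ B.eval (encSize c)) :
    PolyTimeFun (fun c => (c, (l c).foldl (step c) (s c), ([] : List α))) := by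
  obtain ⟨L, hL⟩ := hl.exists_encSize_le
  obtain ⟨p, T, hp⟩ := hstep
  have hinit : PolyTimeFun (fun c => (c, s c, l c)) := by fun_prop
  obtain ⟨q, U, hq⟩ := hinit
  refine ⟨.seq q p.fold,
    U + L * (T.comp (Polynomial.X + B + L + 2) + 40 * (Polynomial.X + B + L + 2)), fun c => ?_⟩
  have hstep_cost : ∀ s, encSize s ≤ B.eval (encSize c) → ∀ a ∈ l c,
      ∃ n ≤ T.eval (encSize c + B.eval (encSize c) + L.eval (encSize c) + 2),
        Exec p (.cons (enc c) (.cons (enc s) (enc a))) (enc (step c s a)) n := by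
    intro s hs a ha
    obtain ⟨n, hn, h⟩ := hp (c, s, a)
    refine ⟨n, hn.trans (eval_nat_mono T ?_), h⟩
    have := (encSize_lt_of_mem ha).le.trans (hL c)
    simp only [enc_pair, Data.size, encSize] at hs this ⊢
    omega
  obtain ⟨m, hm, h1⟩ := hq c
  obtain ⟨n, hn, h2⟩ := Prog.exec_fold (l c) (s c) hstep_cost (hB c)
  refine ⟨_, ?_, h1.seq h2⟩
  simp only [Polynomial.eval_add, Polynomial.eval_mul, Polynomial.eval_comp, Polynomial.eval_X,
    Polynomial.eval_ofNat]
  refine Nat.add_le_add hm (hn.trans (Nat.mul_le_mul ?_ ?_))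
  · exact (length_lt_encSize (l c)).trans_le (hL c)
  · have := hL c
    gcongr

theorem foldl {l : γ → List α} {s : γ → σ} {step : γ → σ → α → σ} (hl : PolyTimeFun l)
    (hs : PolyTimeFun s) (hstep : PolyTimeFun (fun x : γ × σ × α => step x.1 x.2.1 x.2.2))
    {B : Polynomial ℕ}
    (hB : ∀ c l', l' <+: l c → encSize (l'.foldl (step c) (s c)) ≤ B.eval (encSize c)) :
    PolyTimeFun (fun c => (l c).foldl (step c) (s c)) :=
  (foldl_with_context hl hs hstep hB).snd.fst

theorem foldl_of_encSize_le_add {l : γ → List α} {s : γ → σ} {step : γ → σ → α → σ}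
    (hl : PolyTimeFun l) (hs : PolyTimeFun s)
    (hstep : PolyTimeFun (fun x : γ × σ × α => step x.1 x.2.1 x.2.2)) {P : Polynomial ℕ}
    (hP : ∀ c s, ∀ a ∈ l c, encSize (step c s a) ≤ encSize s + P.eval (encSize c)) :
    PolyTimeFun (fun c => (l c).foldl (step c) (s c)) := by
  obtain ⟨L, hL⟩ := hl.exists_encSize_le
  obtain ⟨S, hS⟩ := hs.exists_encSize_le
  refine hl.foldl hs hstep (B := S + L * P) fun c l' hl' => ?_
  refine (encSize_foldl_le (fun s a ha => hP c s a (hl'.subset ha)) (s c)).trans ?_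
  rw [Polynomial.eval_add, Polynomial.eval_mul]
  have hlen : l'.length ≤ L.eval (encSize c) :=
    hl'.length_le.trans ((length_lt_encSize _).le.trans (hL c))
  exact Nat.add_le_add (hS c) (Nat.mul_le_mul_right _ hlen)

end PolyTimeFun

end Basic

section Lists

variable {α β γ : Type} [TreeEncoding α] [TreeEncoding β] [TreeEncoding γ]

namespace PolyTimeFun

@[fun_prop]
theorem not {f : γ → Bool} (hf : PolyTimeFun f) : PolyTimeFun (fun c => !f c) :=
  (show PolyTimeFun (fun c => bif f c then false else true) by fun_prop).congr fun c => by
    cases f c <;> rfl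

@[fun_prop]
theorem and {f g : γ → Bool} (hf : PolyTimeFun f) (hg : PolyTimeFun g) :
    PolyTimeFun (fun c => f c && g c) :=
  (show PolyTimeFun (fun c => bif f c then g c else false) by fun_prop).congr fun c => by
    cases f c <;> rfl

@[fun_prop]
theorem or {f g : γ → Bool} (hf : PolyTimeFun f) (hg : PolyTimeFun g) :
    PolyTimeFun (fun c => f c || g c) :=
  (show PolyTimeFun (fun c => bif f c then true else g c) by fun_prop).congr fun c => by
    cases f c <;> rfl

@[fun_prop]
theorem xor {f g : γ → Bool} (hf : PolyTimeFun f) (hg : PolyTimeFun g) :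
    PolyTimeFun (fun c => f c ^^ g c) :=
  (show PolyTimeFun (fun c => bif f c then !g c else g c) by fun_prop).congr fun c => by
    cases f c <;> cases g c <;> rfl

theorem exists_encSize_le_of_mem {l : γ → List α} {f : γ → α → β} (hl : PolyTimeFun l)
    (hf : PolyTimeFun (fun x : γ × α => f x.1 x.2)) :
    ∃ P : Polynomial ℕ, ∀ c, ∀ a ∈ l c, encSize (f c a) ≤ P.eval (encSize c) := by
  obtain ⟨B, hB⟩ := hl.exists_encSize_le
  obtain ⟨F, hF⟩ := hf.exists_encSize_le
  refine ⟨F.comp (Polynomial.X + B + 1), fun c a ha => (hF (c, a)).trans ?_⟩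
  have := (encSize_lt_of_mem ha).trans_le (hB c)
  rw [Polynomial.eval_comp]
  gcongr
  simp only [encSize_pair, Polynomial.eval_add, Polynomial.eval_X, Polynomial.eval_one]
  omega

@[fun_prop]
theorem list_any {l : γ → List α} {p : γ → α → Bool} (hl : PolyTimeFun l)
    (hp : PolyTimeFun (fun x : γ × α => p x.1 x.2)) : PolyTimeFun (fun c => (l c).any (p c)) := by
  have hstep : PolyTimeFun (fun x : γ × Bool × α => x.2.1 || p x.1 x.2.2) := by
    have := hp.comp (f := fun x : γ × Bool × α => (x.1, x.2.2)) (by fun_prop)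
    fun_prop
  have hfold : PolyTimeFun (fun c => (l c).foldl (fun b a => b || p c a) false) :=
    hl.foldl (const _) (step := fun c b a => b || p c a) hstep (B := 3)
      fun _ _ _ => (encSize_bool_le _).trans (by simp)
  refine hfold.congr fun c => ?_
  generalize l c = l
  suffices h : ∀ b, l.foldl (fun b a => b || p c a) b = (b || l.any (p c)) by simp [h]
  induction l with
  | nil => simp
  | cons a l ih => intro b; simp [ih, Bool.or_assoc]

@[fun_prop]
theorem list_all {l : γ → List α} {p : γ → α → Bool} (hl : PolyTimeFun l)
    (hp : PolyTimeFun (fun x : γ × α => p x.1 x.2)) : PolyTimeFun (fun c => (l c).all (p c)) :=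
  (show PolyTimeFun (fun c => !(l c).any fun a => !p c a) by fun_prop).congr fun _ =>
    List.all_eq_not_any_not.symm

theorem list_foldl_cons {l l' : γ → List α} (hl : PolyTimeFun l) (hl' : PolyTimeFun l') :
    PolyTimeFun (fun c => (l c).foldl (fun acc a => a :: acc) (l' c)) := by
  obtain ⟨B, hB⟩ := hl.exists_encSize_le
  refine hl.foldl_of_encSize_le_add hl' (by fun_prop) (P := B) fun c s a ha => ?_
  have := (encSize_lt_of_mem ha).trans_le (hB c)
  rw [encSize_cons]
  omega

@[fun_prop]
theorem list_reverse {l : γ → List α} (hl : PolyTimeFun l) :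
    PolyTimeFun (fun c => (l c).reverse) :=
  (hl.list_foldl_cons (const [])).congr fun c => by simp

@[fun_prop]
theorem list_append {l l' : γ → List α} (hl : PolyTimeFun l) (hl' : PolyTimeFun l') :
    PolyTimeFun (fun c => l c ++ l' c) :=
  (hl.list_reverse.list_foldl_cons hl').congr fun c => by simp

@[fun_prop]
theorem list_flatMap {l : γ → List α} {f : γ → α → List β} (hl : PolyTimeFun l)
    (hf : PolyTimeFun (fun x : γ × α => f x.1 x.2)) :
    PolyTimeFun (fun c => (l c).flatMap (f c)) := by
  have hstep : PolyTimeFun (fun x : γ × List β × α => x.2.1 ++ f x.1 x.2.2) := by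
    have := hf.comp (f := fun x : γ × List β × α => (x.1, x.2.2)) (by fun_prop)
    fun_prop
  obtain ⟨B, hB⟩ := hl.exists_encSize_le_of_mem hf
  have hfold : PolyTimeFun (fun c => (l c).foldl (fun acc a => acc ++ f c a) []) := by
    refine hl.foldl_of_encSize_le_add (const _) (step := fun c acc a => acc ++ f c a) hstep
      (P := B) fun c s a ha => ?_
    have := hB c a ha
    have := encSize_append s (f c a)
    omega
  exact hfold.congr fun c => List.flatMap_eq_foldl.symm

@[fun_prop]
theorem list_map {l : γ → List α} {f : γ → α → β} (hl : PolyTimeFun l)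
    (hf : PolyTimeFun (fun x : γ × α => f x.1 x.2)) : PolyTimeFun (fun c => (l c).map (f c)) :=
  (show PolyTimeFun (fun c => (l c).flatMap fun a => [f c a]) by fun_prop).congr fun _ =>
    List.map_eq_flatMap.symm

@[fun_prop]
theorem list_filter {l : γ → List α} {p : γ → α → Bool} (hl : PolyTimeFun l)
    (hp : PolyTimeFun (fun x : γ × α => p x.1 x.2)) :
    PolyTimeFun (fun c => (l c).filter (p c)) := by
  refine (show PolyTimeFun (fun c => (l c).flatMap fun a => bif p c a then [a] else []) by
    fun_prop).congr fun c => ?_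
  generalize l c = l
  induction l with
  | nil => rfl
  | cons a l ih => cases h : p c a <;> simp [h, ih]

end PolyTimeFun

end Lists

/-! ### Binary arithmetic -/

theorem encSize_nat_le (n : ℕ) : encSize n ≤ 4 * n.size + 1 := by
  have h := encSize_list_le (l := n.bits) (B := 3) fun b _ => encSize_bool_le b
  rw [← Nat.size_eq_bits_len, mul_comm]
  exact h

theorem size_lt_encSize_nat (n : ℕ) : n.size < encSize n := by
  rw [← Nat.size_eq_bits_len, encSize, enc_nat]
  exact length_lt_encSize _

theorem encSize_nat_le_self (n : ℕ) : encSize n ≤ 4 * n + 1 := by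
  have := encSize_nat_le n
  have : n.size ≤ n := Nat.size_le.2 n.lt_two_pow_self
  omega

theorem bits_bit (b : Bool) (n : ℕ) :
    (Nat.bit b n).bits = bif !b && n.bits.isEmpty then [] else b :: n.bits := by
  rcases Nat.eq_zero_or_pos n with rfl | hn
  · cases b <;> simp
  · have hbits : n.bits ≠ [] := by
      rw [ne_eq, ← List.length_eq_zero_iff, Nat.size_eq_bits_len, Nat.size_eq_zero]
      exact hn.ne'
    rw [Nat.bits_append_bit _ _ fun h => absurd h hn.ne', List.isEmpty_eq_false_iff.2 hbits,
      Bool.and_false, cond_false]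

theorem encSize_bit_le (b : Bool) (n : ℕ) : encSize (Nat.bit b n) ≤ encSize n + 4 := by
  have := encSize_bool_le b
  change encSize (Nat.bit b n).bits ≤ encSize n.bits + 4
  rw [bits_bit]
  cases !b && n.bits.isEmpty
  · simp only [cond_false, encSize_cons]; omega
  · simp only [cond_true, encSize_nil]; omega

theorem encSize_div2_le (n : ℕ) : encSize n.div2 ≤ encSize n := by
  change encSize n.div2.bits ≤ encSize n.bits
  rw [Nat.div2_bits_eq_tail]
  cases n.bits with
  | nil => exact le_rfl
  | cons b l => simp only [List.tail_cons, encSize_cons]; omega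

/-- The number whose binary digits, most significant first, are those of `n` followed by `l`. -/
def appendBits (n : ℕ) (l : List Bool) : ℕ := l.foldl (fun n b => Nat.bit b n) n

/-- One step of binary addition, on (remaining summands, carry, digits of the sum). -/
def addStep (s : ℕ × ℕ × Bool × List Bool) : ℕ × ℕ × Bool × List Bool :=
  (s.1.div2, s.2.1.div2, (s.1.bodd && s.2.1.bodd) || (s.2.2.1 && (s.1.bodd ^^ s.2.1.bodd)),
    (s.1.bodd ^^ s.2.1.bodd ^^ s.2.2.1) :: s.2.2.2)

theorem addStep_sum (x y : ℕ) (b : Bool) (l : List Bool) :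
    (addStep (x, y, b, l)).1 + (addStep (x, y, b, l)).2.1 +
      (addStep (x, y, b, l)).2.2.1.toNat = (x + y + b.toNat) / 2 ∧
    Nat.bit (x.bodd ^^ y.bodd ^^ b) ((x + y + b.toNat) / 2) = x + y + b.toNat := by
  have hx := Nat.bodd_add_div2 x
  have hy := Nat.bodd_add_div2 y
  rw [addStep, Nat.bit_val]
  cases b <;> cases hx' : x.bodd <;> cases hy' : y.bodd <;> simp [hx', hy'] at hx hy ⊢ <;> omega

theorem appendBits_foldl_addStep {δ : Type} (l : List δ) (x y : ℕ) (b : Bool) (out : List Bool)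
    (h : x + y + b.toNat < 2 ^ l.length) :
    appendBits 0 (l.foldl (fun s _ => addStep s) (x, y, b, out)).2.2.2 =
      appendBits (x + y + b.toNat) out := by
  induction l generalizing x y b out with
  | nil =>
    rw [List.length_nil, pow_zero, Nat.lt_one_iff] at h
    rw [h, List.foldl_nil]
  | cons d l ih =>
    obtain ⟨hsum, hbit⟩ := addStep_sum x y b out
    rw [List.length_cons, pow_succ] at h
    refine (ih _ _ _ _ (hsum.trans_lt (by omega))).trans ?_
    rw [hsum]
    conv_rhs => rw [← hbit]
    rfl

theorem foldl_double_add_le (b : ℕ) (l : List Bool) :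
    l.foldl (fun a d => a + a + bif d then b else 0) 0 + b ≤ 2 ^ l.length * b := by
  induction l using List.reverseRecOn with
  | nil => simp
  | append_singleton l d ih =>
    rw [List.foldl_append, List.length_append, List.length_singleton, pow_succ]
    cases d <;> simp only [List.foldl_cons, List.foldl_nil, cond_true, cond_false] <;> nlinarith

theorem encSize_foldl_double_add_le (b : ℕ) (l : List Bool) :
    encSize (l.foldl (fun a d => a + a + bif d then b else 0) 0) ≤
      4 * (l.length + b.size) + 1 := by
  refine (encSize_nat_le _).trans ?_
  gcongr
  rw [Nat.size_le, pow_add]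
  have hfold := foldl_double_add_le b l
  have hb := Nat.lt_size_self b
  nlinarith [Nat.one_le_two_pow (n := l.length)]

theorem foldl_double_add_eq_mul (a b : ℕ) :
    a.bits.reverse.foldl (fun a d => a + a + bif d then b else 0) 0 = a * b := by
  rw [List.foldl_reverse]
  induction a using Nat.binaryRec' with
  | zero => simp
  | bit d n h ih =>
    rw [Nat.bits_append_bit _ _ h, List.foldr_cons, ih, Nat.bit_val]
    cases d <;> simp only [Bool.toNat_true, Bool.toNat_false, cond_true, cond_false] <;> ring

/-- One step of binary comparison, on (remaining numbers, comparison of the digits read). -/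
def leStep (s : ℕ × ℕ × Bool) : ℕ × ℕ × Bool :=
  (s.1.div2, s.2.1.div2, bif s.1.bodd ^^ s.2.1.bodd then s.2.1.bodd else s.2.2)

theorem foldl_leStep {δ : Type} (l : List δ) (x y : ℕ) (b : Bool)
    (hx : x < 2 ^ l.length) (hy : y < 2 ^ l.length) :
    (l.foldl (fun s _ => leStep s) (x, y, b)).2.2 = decide (x < y ∨ x = y ∧ b) := by
  induction l generalizing x y b with
  | nil =>
    rw [List.length_nil, pow_zero, Nat.lt_one_iff] at hx hy
    simp [hx, hy]
  | cons d l ih =>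
    rw [List.length_cons, pow_succ] at hx hy
    have hx2 : x.div2 < 2 ^ l.length := by rw [Nat.div2_val]; omega
    have hy2 : y.div2 < 2 ^ l.length := by rw [Nat.div2_val]; omega
    have hx' := Nat.bodd_add_div2 x
    have hy' := Nat.bodd_add_div2 y
    rw [List.foldl_cons, leStep, ih _ _ _ hx2 hy2, decide_eq_decide]
    generalize x.div2 = x₁ at *
    generalize y.div2 = y₁ at *
    cases b <;> cases hx₀ : x.bodd <;> cases hy₀ : y.bodd <;>
      simp only [hx₀, hy₀, Bool.toNat_true, Bool.toNat_false, Bool.xor_self, Bool.xor_false,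
        Bool.xor_true, Bool.not_false, cond_true, cond_false, and_true, and_false, eq_self,
        or_false, Bool.false_eq_true] at hx' hy' ⊢ <;> omega

namespace PolyTimeFun

variable {γ : Type} [TreeEncoding γ]

@[fun_prop]
theorem nat_bits {f : γ → ℕ} (hf : PolyTimeFun f) : PolyTimeFun (fun c => (f c).bits) :=
  hf.of_enc_eq fun _ => rfl

@[fun_prop]
theorem nat_div2 {f : γ → ℕ} (hf : PolyTimeFun f) : PolyTimeFun (fun c => (f c).div2) :=
  hf.nat_bits.list_tail.of_enc_eq fun c => by rw [enc_nat, Nat.div2_bits_eq_tail]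

@[fun_prop]
theorem nat_bodd {f : γ → ℕ} (hf : PolyTimeFun f) : PolyTimeFun (fun c => (f c).bodd) :=
  (list_headD hf.nat_bits false rfl).congr fun c => by
    rw [Nat.bodd_eq_bits_head]; cases (f c).bits <;> rfl

@[fun_prop]
theorem nat_bit {b : γ → Bool} {f : γ → ℕ} (hb : PolyTimeFun b) (hf : PolyTimeFun f) :
    PolyTimeFun (fun c => Nat.bit (b c) (f c)) :=
  (show PolyTimeFun (fun c => bif !b c && (f c).bits.isEmpty then [] else b c :: (f c).bits) by
    fun_prop).of_enc_eq fun c => by rw [enc_nat, bits_bit]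

@[fun_prop]
theorem nat_appendBits {f : γ → ℕ} {l : γ → List Bool} (hf : PolyTimeFun f)
    (hl : PolyTimeFun l) : PolyTimeFun (fun c => appendBits (f c) (l c)) :=
  hl.foldl_of_encSize_le_add hf (step := fun _ n b => Nat.bit b n) (by fun_prop) (P := 4)
    fun _ s a _ => (encSize_bit_le a s).trans (by simp)

@[fun_prop]
theorem comp_addStep {f : γ → ℕ × ℕ × Bool × List Bool} (hf : PolyTimeFun f) :
    PolyTimeFun (fun c => addStep (f c)) := by
  unfold addStep; fun_prop

theorem list_foldl_addStep {α : Type} [TreeEncoding α] {l : γ → List α}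
    {f : γ → ℕ × ℕ × Bool × List Bool} (hl : PolyTimeFun l) (hf : PolyTimeFun f) :
    PolyTimeFun (fun c => (l c).foldl (fun s _ => addStep s) (f c)) := by
  refine hl.foldl_of_encSize_le_add (step := fun _ s _ => addStep s) hf (by fun_prop)
    (P := 10) ?_
  rintro c ⟨x, y, b, l⟩ a -
  have hx := encSize_div2_le x
  have hy := encSize_div2_le y
  have hdigit := encSize_bool_le (x.bodd ^^ y.bodd ^^ b)
  have hcarry := encSize_bool_le ((x.bodd && y.bodd) || (b && (x.bodd ^^ y.bodd)))
  have hb := encSize_pos b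
  simp only [addStep, encSize_pair, encSize_cons, Polynomial.eval_ofNat]
  omega

@[fun_prop]
theorem nat_add {f g : γ → ℕ} (hf : PolyTimeFun f) (hg : PolyTimeFun g) :
    PolyTimeFun (fun c => f c + g c) := by
  have hdigits := list_foldl_addStep (l := fun c => (f c).bits ++ (g c).bits ++ [true])
    (f := fun c => (f c, g c, false, [])) (by fun_prop) (by fun_prop)
  refine ((const 0).nat_appendBits hdigits.snd.snd.snd).congr fun c => ?_
  refine (appendBits_foldl_addStep _ _ _ _ _ ?_).trans rfl
  have hf := Nat.lt_size_self (f c)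
  have hg := Nat.lt_size_self (g c)
  simp only [List.length_append, Nat.size_eq_bits_len, List.length_singleton, pow_succ,
    pow_add, Bool.toNat_false]
  nlinarith [Nat.one_le_two_pow (n := (f c).size), Nat.one_le_two_pow (n := (g c).size)]

@[fun_prop]
theorem nat_mul {f g : γ → ℕ} (hf : PolyTimeFun f) (hg : PolyTimeFun g) :
    PolyTimeFun (fun c => f c * g c) := by
  obtain ⟨F, hF⟩ := hf.exists_encSize_le
  obtain ⟨G, hG⟩ := hg.exists_encSize_le
  have hfold : PolyTimeFun (fun c => (f c).bits.reverse.foldl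
      (fun a d => a + a + bif d then g c else 0) 0) := by
    refine foldl (step := fun c a d => a + a + bif d then g c else 0) (by fun_prop)
      (by fun_prop) (by fun_prop) (B := 4 * (F + G) + 1) fun c l' hl' => ?_
    refine (encSize_foldl_double_add_le _ _).trans ?_
    have hlen := hl'.length_le
    rw [List.length_reverse, Nat.size_eq_bits_len] at hlen
    have hf := (size_lt_encSize_nat (f c)).trans_le (hF c)
    have hg := (size_lt_encSize_nat (g c)).trans_le (hG c)
    simp only [Polynomial.eval_add, Polynomial.eval_mul, Polynomial.eval_ofNat,
      Polynomial.eval_one]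
    omega
  exact hfold.congr fun c => foldl_double_add_eq_mul _ _

@[fun_prop]
theorem nat_pow {f : γ → ℕ} (hf : PolyTimeFun f) (j : ℕ) : PolyTimeFun (fun c => f c ^ j) := by
  induction j with
  | zero => exact (const 1).congr fun c => (pow_zero (f c)).symm
  | succ j ih => exact (ih.nat_mul hf).congr fun c => (pow_succ (f c) j).symm

@[fun_prop]
theorem comp_leStep {f : γ → ℕ × ℕ × Bool} (hf : PolyTimeFun f) :
    PolyTimeFun (fun c => leStep (f c)) := by
  unfold leStep; fun_prop

theorem list_foldl_leStep {α : Type} [TreeEncoding α] {l : γ → List α} {f : γ → ℕ × ℕ × Bool}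
    (hl : PolyTimeFun l) (hf : PolyTimeFun f) :
    PolyTimeFun (fun c => (l c).foldl (fun s _ => leStep s) (f c)) := by
  refine hl.foldl_of_encSize_le_add (step := fun _ s _ => leStep s) hf (by fun_prop)
    (P := 10) ?_
  rintro c ⟨x, y, b⟩ a -
  have hx := encSize_div2_le x
  have hy := encSize_div2_le y
  have hb := encSize_bool_le (bif x.bodd ^^ y.bodd then y.bodd else b)
  simp only [leStep, encSize_pair, Polynomial.eval_ofNat]
  omega

@[fun_prop]
theorem nat_le {f g : γ → ℕ} (hf : PolyTimeFun f) (hg : PolyTimeFun g) :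
    PolyTimeFun (fun c => decide (f c ≤ g c)) := by
  have h := list_foldl_leStep (l := fun c => (f c).bits ++ (g c).bits)
    (f := fun c => (f c, g c, true)) (by fun_prop) (by fun_prop)
  refine h.snd.snd.congr fun c => ?_
  rw [foldl_leStep, decide_eq_decide, le_iff_lt_or_eq, and_iff_left rfl]
  · rw [List.length_append, Nat.size_eq_bits_len, pow_add]
    exact (Nat.lt_size_self _).trans_le (Nat.le_mul_of_pos_right _ (by positivity))
  · rw [List.length_append, Nat.size_eq_bits_len, Nat.size_eq_bits_len, pow_add]
    exact (Nat.lt_size_self _).trans_le (Nat.le_mul_of_pos_left _ (by positivity))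

@[fun_prop]
theorem nat_lt {f g : γ → ℕ} (hf : PolyTimeFun f) (hg : PolyTimeFun g) :
    PolyTimeFun (fun c => decide (f c < g c)) :=
  (show PolyTimeFun (fun c => decide (f c + 1 ≤ g c)) by fun_prop).congr fun _ => rfl

end PolyTimeFun
/-- Types on which equality can be tested in polynomial time. -/
class PolyTimeDecidableEq (α : Type) [TreeEncoding α] [DecidableEq α] : Prop where
  polyTimeFun_eq : PolyTimeFun (fun x : α × α => decide (x.1 = x.2))

section Equality

variable {α β γ : Type} [TreeEncoding α] [TreeEncoding β] [TreeEncoding γ]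
variable [DecidableEq α] [DecidableEq β]

@[fun_prop]
theorem PolyTimeFun.eq [PolyTimeDecidableEq α] {f g : γ → α} (hf : PolyTimeFun f)
    (hg : PolyTimeFun g) : PolyTimeFun (fun c => decide (f c = g c)) :=
  PolyTimeDecidableEq.polyTimeFun_eq.comp (hf.prodMk hg)

theorem PolyTimeDecidableEq.of_injective [PolyTimeDecidableEq β] {f : α → β}
    (hf : PolyTimeFun f) (hi : Function.Injective f) : PolyTimeDecidableEq α where
  polyTimeFun_eq := (show PolyTimeFun (fun x : α × α => decide (f x.1 = f x.2)) by
    fun_prop).congr fun _ => decide_eq_decide.2 hi.eq_iff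

instance : PolyTimeDecidableEq ℕ where
  polyTimeFun_eq := (show PolyTimeFun (fun x : ℕ × ℕ => decide (x.1 ≤ x.2) && decide (x.2 ≤ x.1)) by
    fun_prop).congr fun x => by
      rw [← Bool.decide_and, decide_eq_decide, le_antisymm_iff]

instance [PolyTimeDecidableEq α] [PolyTimeDecidableEq β] : PolyTimeDecidableEq (α × β) where
  polyTimeFun_eq := (show PolyTimeFun (fun x : (α × β) × α × β =>
    decide (x.1.1 = x.2.1) && decide (x.1.2 = x.2.2)) by fun_prop).congr fun x => by
      rw [← Bool.decide_and, decide_eq_decide, Prod.ext_iff]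

end Equality

namespace PolyTimeFun

variable {γ : Type} [TreeEncoding γ]

@[fun_prop]
theorem int_decide_neg {f : γ → ℤ} (hf : PolyTimeFun f) :
    PolyTimeFun (fun c => decide (f c < 0)) :=
  PolyTimeFun.fst (f := fun c => (decide (f c < 0), (f c).natAbs)) (hf.of_enc_eq fun _ => rfl)

@[fun_prop]
theorem int_natAbs {f : γ → ℤ} (hf : PolyTimeFun f) : PolyTimeFun (fun c => (f c).natAbs) :=
  PolyTimeFun.snd (f := fun c => (decide (f c < 0), (f c).natAbs)) (hf.of_enc_eq fun _ => rfl)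

@[fun_prop]
theorem int_toNat {f : γ → ℤ} (hf : PolyTimeFun f) : PolyTimeFun (fun c => (f c).toNat) :=
  (show PolyTimeFun (fun c => bif decide (f c < 0) then 0 else (f c).natAbs) by
    fun_prop).congr fun c => by
      rw [Bool.cond_decide]; split_ifs <;> omega

@[fun_prop]
theorem int_neg_toNat {f : γ → ℤ} (hf : PolyTimeFun f) : PolyTimeFun (fun c => (-f c).toNat) :=
  (show PolyTimeFun (fun c => bif decide (f c < 0) then (f c).natAbs else 0) by
    fun_prop).congr fun c => by
      rw [Bool.cond_decide]; split_ifs <;> omega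

@[fun_prop]
theorem rat_num {f : γ → ℚ} (hf : PolyTimeFun f) : PolyTimeFun (fun c => (f c).num) :=
  PolyTimeFun.fst (f := fun c => ((f c).num, (f c).den)) (hf.of_enc_eq fun _ => rfl)

@[fun_prop]
theorem rat_den {f : γ → ℚ} (hf : PolyTimeFun f) : PolyTimeFun (fun c => (f c).den) :=
  PolyTimeFun.snd (f := fun c => ((f c).num, (f c).den)) (hf.of_enc_eq fun _ => rfl)

end PolyTimeFun

instance : PolyTimeDecidableEq ℤ :=
  .of_injective (f := fun z : ℤ => (z.toNat, (-z).toNat)) (by fun_prop) fun x y h => by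
    simp only [Prod.mk.injEq] at h; omega

instance : PolyTimeDecidableEq ℚ :=
  .of_injective (f := fun q : ℚ => (q.num, q.den)) (by fun_prop) fun x y h =>
    Rat.ext (congrArg Prod.fst h) (congrArg Prod.snd h)

theorem foldl_append_length_eq_range {α : Type} (l : List α) :
    l.foldl (fun acc _ => acc ++ [acc.length]) [] = List.range l.length := by
  induction l using List.reverseRecOn with
  | nil => rfl
  | append_singleton l d ih => simp [ih, List.range_succ]

theorem foldl_append_cond_eq_take {α : Type} (l : List α) (n : ℕ) :
    l.foldl (fun acc a => acc ++ bif decide (acc.length < n) then [a] else []) [] = l.take n := by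
  induction l using List.reverseRecOn with
  | nil => simp
  | append_singleton l a ih =>
    rw [List.foldl_append, List.foldl_cons, List.foldl_nil, ih, List.take_append, List.length_take,
      Bool.cond_decide]
    congr 1
    split_ifs with h
    · rw [List.take_of_length_le]
      rw [List.length_singleton]
      omega
    · rw [show n - l.length = 0 by omega, List.take_zero]

section ListsAndNumbers

variable {α γ : Type} [TreeEncoding α] [TreeEncoding γ]

namespace PolyTimeFun

@[fun_prop]
theorem list_length {l : γ → List α} (hl : PolyTimeFun l) :
    PolyTimeFun (fun c => (l c).length) := by
  obtain ⟨L, hL⟩ := hl.exists_encSize_le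
  have hlength : ∀ l' : List α, l'.foldl (fun n _ => n + 1) 0 = l'.length := by simp
  have h : PolyTimeFun (fun c => (l c).foldl (fun n _ => n + 1) 0) := by
    refine hl.foldl (step := fun _ n _ => n + 1) (by fun_prop) (by fun_prop)
      (B := 4 * L + 1) fun c l' hl' => ?_
    rw [hlength]
    refine (encSize_nat_le_self _).trans ?_
    have := hl'.length_le
    have := (length_lt_encSize (l c)).trans_le (hL c)
    simp only [Polynomial.eval_add, Polynomial.eval_mul, Polynomial.eval_ofNat,
      Polynomial.eval_one]
    omega
  exact h.congr fun c => hlength _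

@[fun_prop]
theorem list_mem [DecidableEq α] [PolyTimeDecidableEq α] {l : γ → List α} {f : γ → α}
    (hl : PolyTimeFun l) (hf : PolyTimeFun f) : PolyTimeFun (fun c => decide (f c ∈ l c)) :=
  (show PolyTimeFun (fun c => (l c).any fun a => decide (a = f c)) by fun_prop).congr fun c => by
    rw [Bool.eq_iff_iff]; simp

@[fun_prop]
theorem list_range_length {l : γ → List α} (hl : PolyTimeFun l) :
    PolyTimeFun (fun c => List.range (l c).length) := by
  obtain ⟨L, hL⟩ := hl.exists_encSize_le
  have h : PolyTimeFun (fun c => (l c).foldl (fun acc _ => acc ++ [acc.length]) []) := by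
    refine hl.foldl (step := fun _ acc _ => acc ++ [acc.length]) (by fun_prop) (by fun_prop)
      (B := L * (4 * L + 2) + 1) fun c l' hl' => ?_
    have hlen := hl'.length_le
    have hL' := (length_lt_encSize (l c)).trans_le (hL c)
    rw [foldl_append_length_eq_range]
    refine (encSize_list_le (B := 4 * L.eval (encSize c) + 1) fun a ha => ?_).trans ?_
    · have := List.mem_range.1 ha
      exact (encSize_nat_le_self _).trans (by omega)
    · simp only [Polynomial.eval_add, Polynomial.eval_mul, Polynomial.eval_ofNat,
        Polynomial.eval_one, List.length_range]
      exact Nat.add_le_add_right (Nat.mul_le_mul (by omega) (by omega)) 1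
  exact h.congr fun c => foldl_append_length_eq_range _

@[fun_prop]
theorem list_take {l : γ → List α} {f : γ → ℕ} (hl : PolyTimeFun l) (hf : PolyTimeFun f) :
    PolyTimeFun (fun c => (l c).take (f c)) := by
  obtain ⟨L, hL⟩ := hl.exists_encSize_le
  have h : PolyTimeFun (fun c => (l c).foldl
      (fun acc a => acc ++ bif decide (acc.length < f c) then [a] else []) []) := by
    refine hl.foldl_of_encSize_le_add (s := fun _ => [])
      (step := fun c acc a => acc ++ bif decide (acc.length < f c) then [a] else [])
      (by fun_prop) (by fun_prop) (P := L + 1) fun c s a ha => ?_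
    have ha' := (encSize_lt_of_mem ha).trans_le (hL c)
    have happ := encSize_append s (bif decide (s.length < f c) then [a] else [])
    rw [Polynomial.eval_add, Polynomial.eval_one]
    cases h : decide (s.length < f c) <;>
      simp only [h, cond_true, cond_false, encSize_cons, encSize_nil] at happ ⊢ <;> omega
  exact h.congr fun c => foldl_append_cond_eq_take _ _

@[fun_prop]
theorem list_getD {l : γ → List α} {f : γ → ℕ} {d : γ → α} (hl : PolyTimeFun l)
    (hf : PolyTimeFun f) (hd : PolyTimeFun d) :
    PolyTimeFun (fun c => (l c).getD (f c) (d c)) := by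
  obtain ⟨L, hL⟩ := hl.exists_encSize_le
  have hlast : PolyTimeFun (fun c => ((l c).take (f c + 1)).foldl (fun _ a => a) (d c)) := by
    refine foldl_of_encSize_le_add (step := fun _ _ a => a) (by fun_prop) hd (by fun_prop)
      (P := L) fun c s a ha => ?_
    have := (encSize_lt_of_mem (List.mem_of_mem_take ha)).trans_le (hL c)
    omega
  refine (show PolyTimeFun (fun c => bif decide (f c < (l c).length) then
    ((l c).take (f c + 1)).foldl (fun _ a => a) (d c) else d c) by fun_prop).congr fun c => ?_
  by_cases h : f c < (l c).length
  · rw [List.take_succ_eq_append_getElem h, List.foldl_append]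
    simp [h]
  · simp [h]

end PolyTimeFun

end ListsAndNumbers

/-! ### Diverse families -/

section DiverseFamily

variable {α β : Type} {k r t : ℕ}

/-- There are `r` sets of at most `k` items each, all of them solutions in the sense of `IsSol`,
whose diversity is at least `t`; this is `DiverseInst.IsYes` for an arbitrary notion of
solution. -/
def HasDiverseFamily (IsSol : Finset α → Prop) (k r t : ℕ) : Prop :=
  ∃ S : Fin r → Finset α, (∀ i, IsSol (S i) ∧ (S i).card ≤ k) ∧ t ≤ diversity S

theorem hamDist_eq_card_add_card [DecidableEq α] (S S' : Finset α) :
    hamDist S S' = (S \ S').card + (S' \ S).card := by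
  unfold hamDist
  congr!

theorem hamDist_image [DecidableEq β] {τ : α → β} {S S' U : Finset α} (hS : S ⊆ U) (hS' : S' ⊆ U)
    (hτ : Set.InjOn τ U) : hamDist (S.image τ) (S'.image τ) = hamDist S S' := by
  classical
  have card_sdiff {A B : Finset α} (hA : A ⊆ U) (hB : B ⊆ U) :
      (A.image τ \ B.image τ).card = (A \ B).card := by
    rw [Finset.card_sdiff, Finset.card_sdiff, ← Finset.image_inter_of_injOn _ _
      (hτ.mono (mod_cast Finset.union_subset hB hA)), Finset.card_image_of_injOn (hτ.mono hA),
      Finset.card_image_of_injOn (hτ.mono (Finset.inter_subset_right.trans hA))]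
  simp only [hamDist_eq_card_add_card, card_sdiff hS hS', card_sdiff hS' hS]

theorem diversity_image [DecidableEq β] {τ : α → β} {S : Fin r → Finset α} {U : Finset α}
    (hS : ∀ i, S i ⊆ U) (hτ : Set.InjOn τ U) :
    diversity (fun i => (S i).image τ) = diversity S :=
  Finset.sum_congr rfl fun i _ => Finset.sum_congr rfl fun j _ => hamDist_image (hS i) (hS j) hτ

theorem diversity_le {S : Fin r → Finset α} (hS : ∀ i, (S i).card ≤ k) :
    diversity S ≤ 2 * k * r * r := by
  classical
  have hamDist_le (i j) : hamDist (S i) (S j) ≤ 2 * k := by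
    rw [hamDist_eq_card_add_card]
    have := Finset.card_le_card (Finset.sdiff_subset (s := S i) (t := S j))
    have := Finset.card_le_card (Finset.sdiff_subset (s := S j) (t := S i))
    have := hS i
    have := hS j
    omega
  calc diversity S ≤ ∑ i : Fin r, ∑ j : Fin r, hamDist (S i) (S j) :=
        Finset.sum_le_sum fun i _ => Finset.sum_le_sum_of_subset (Finset.subset_univ _)
    _ ≤ ∑ i : Fin r, ∑ j : Fin r, 2 * k :=
        Finset.sum_le_sum fun i _ => Finset.sum_le_sum fun j _ => hamDist_le i j
    _ = 2 * k * r * r := by simp; ring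

theorem HasDiverseFamily.le {IsSol : Finset α → Prop} (h : HasDiverseFamily IsSol k r t) :
    t ≤ 2 * k * r * r := by
  obtain ⟨S, hS, ht⟩ := h
  exact ht.trans (diversity_le fun i => (hS i).2)

theorem HasDiverseFamily.exists_card_le {IsSol : Finset α → Prop}
    (h : HasDiverseFamily IsSol k r t) (hr : r ≠ 0) : ∃ S, IsSol S ∧ S.card ≤ k := by
  obtain ⟨S, hS, -⟩ := h
  exact ⟨S ⟨0, Nat.pos_of_ne_zero hr⟩, hS _⟩

/-- Hamming distances survive an injective renaming of the at most `k * r` items that occur in the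
family, so it is enough to rename solutions into solutions. -/
theorem HasDiverseFamily.transfer [DecidableEq β] {P : Finset α → Prop} {Q : Finset β → Prop}
    (hPQ : ∀ U : Finset α, U.card ≤ k * r → ∃ τ : α → β, Set.InjOn τ U ∧
      ∀ S ⊆ U, P S → S.card ≤ k → Q (S.image τ))
    (h : HasDiverseFamily P k r t) : HasDiverseFamily Q k r t := by
  classical
  obtain ⟨S, hS, ht⟩ := h
  have hSU i : S i ⊆ Finset.univ.biUnion S := Finset.subset_biUnion_of_mem S (Finset.mem_univ i)
  have hU : (Finset.univ.biUnion S).card ≤ k * r := calc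
    _ ≤ Finset.card (Finset.univ (α := Fin r)) * k :=
      Finset.card_biUnion_le_card_mul _ _ _ fun i _ => (hS i).2
    _ = k * r := by rw [Finset.card_univ, Fintype.card_fin, mul_comm]
  obtain ⟨τ, hτ, hQ⟩ := hPQ _ hU
  exact ⟨fun i => (S i).image τ, fun i => ⟨hQ _ (hSU i) (hS i).1 (hS i).2,
    Finset.card_image_le.trans (hS i).2⟩, ht.trans (diversity_image hSU hτ).ge⟩

theorem hasDiverseFamily_congr {P Q : Finset α → Prop} (h : ∀ S, S.card ≤ k → (P S ↔ Q S)) :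
    HasDiverseFamily P k r t ↔ HasDiverseFamily Q k r t :=
  exists_congr fun _ => and_congr_left fun _ => forall_congr' fun _ =>
    and_congr_left fun hS => h _ hS

theorem exists_injective_of_card_le {A : Finset α} {C : A → Finset β}
    (hC : ∀ a, A.card ≤ (C a).card) : ∃ g : A → β, Function.Injective g ∧ ∀ a, g a ∈ C a := by
  classical
  refine (Finset.all_card_le_biUnion_card_iff_exists_injective C).1 fun s => ?_
  obtain rfl | ⟨a, ha⟩ := s.eq_empty_or_nonempty
  · simp
  · calc s.card ≤ A.card := by simpa using Finset.card_le_univ s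
      _ ≤ (C a).card := hC a
      _ ≤ (s.biUnion C).card := Finset.card_le_card (Finset.subset_biUnion_of_mem C ha)

/-- The elements outside `keep` choose among those of their candidates that `f` does not take. -/
theorem exists_injOn_extension {U : Finset α} {keep : α → Prop} {f : α → β}
    {C : α → Finset β} (hf : Set.InjOn f {a | keep a})
    (hC : ∀ a ∈ U, ¬ keep a → U.card ≤ (C a).card) :
    ∃ τ : α → β, Set.InjOn τ U ∧ (∀ a, keep a → τ a = f a) ∧
      ∀ a ∈ U, ¬ keep a → τ a ∈ C a := by
  classical
  let kept := U.filter keep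
  let lost := U.filter (¬ keep ·)
  have hcard (a : lost) : lost.card ≤ (C a \ kept.image f).card := by
    have hU : kept.card + lost.card = U.card := Finset.card_filter_add_card_filter_not _
    have hfree : (C a).card - (kept.image f).card ≤ (C a \ kept.image f).card :=
      Finset.le_card_sdiff _ _
    have himage : (kept.image f).card ≤ kept.card := Finset.card_image_le
    have := hC a (Finset.mem_filter.1 a.2).1 (Finset.mem_filter.1 a.2).2
    omega
  obtain ⟨g, hg, hgC⟩ := exists_injective_of_card_le hcard
  have hgf {a : lost} {b : α} (hbU : b ∈ U) (hb : keep b) : g a ≠ f b := fun h =>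
    (Finset.mem_sdiff.1 (hgC a)).2
      (h ▸ Finset.mem_image_of_mem f (Finset.mem_filter.2 ⟨hbU, hb⟩))
  let τ (a : α) : β := if h : a ∈ lost then g ⟨a, h⟩ else f a
  have hτ_keep {a : α} (ha : keep a) : τ a = f a :=
    dif_neg fun h : a ∈ lost => (Finset.mem_filter.1 h).2 ha
  have hτ_lost {a : α} (haU : a ∈ U) (ha : ¬ keep a) :
      ∃ h : a ∈ lost, τ a = g ⟨a, h⟩ := ⟨Finset.mem_filter.2 ⟨haU, ha⟩, dif_pos _⟩
  refine ⟨τ, fun a ha b hb hab => ?_, fun a => hτ_keep, fun a haU ha => ?_⟩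
  · by_cases hka : keep a <;> by_cases hkb : keep b
    · exact hf hka hkb (by rwa [hτ_keep hka, hτ_keep hkb] at hab)
    · obtain ⟨h, hτb⟩ := hτ_lost hb hkb
      exact absurd (hτb.symm.trans (hab.symm.trans (hτ_keep hka))) (hgf ha hka)
    · obtain ⟨h, hτa⟩ := hτ_lost ha hka
      exact absurd (hτa.symm.trans (hab.trans (hτ_keep hkb))) (hgf hb hkb)
    · obtain ⟨ha', hτa⟩ := hτ_lost ha hka
      obtain ⟨hb', hτb⟩ := hτ_lost hb hkb
      exact congrArg Subtype.val (hg (hτa.symm.trans (hab.trans hτb)))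
  · obtain ⟨h, hτa⟩ := hτ_lost haU ha
    exact hτa ▸ (Finset.mem_sdiff.1 (hgC _)).1

/-- Deleting items leaves the existence of a diverse family unchanged if the items that are lost
can be replaced by `k * r` spare ones. -/
theorem hasDiverseFamily_iff_of_embedding {P : Finset β → Prop} {Q : Finset α → Prop}
    (ι : β ↪ α) (spare : Finset β) (hspare : ¬ Function.Surjective ι → k * r ≤ spare.card)
    (hk : k ≠ 0) (hr : r ≠ 0) (hmap : ∀ T, T.card ≤ k → P T → Q (T.map ι))
    (hrestrict : ∀ S T, S.card ≤ k → Q S → (∀ b, ι b ∈ S → b ∈ T) →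
      (∀ b ∈ T, ι b ∈ S ∨ b ∈ spare) → P T) :
    HasDiverseFamily P k r t ↔ HasDiverseFamily Q k r t := by
  classical
  refine ⟨.transfer fun U _ => ⟨ι, ι.injective.injOn, fun S _ hS hSk => ?_⟩,
    .transfer fun U hU => ?_⟩
  · exact Finset.map_eq_image ι S ▸ hmap S hSk hS
  obtain hα | ⟨⟨a₀⟩⟩ := isEmpty_or_nonempty α
  · refine ⟨isEmptyElim, fun a => isEmptyElim a, fun S _ hS hSk => hrestrict S _ hSk hS
      (fun b => isEmptyElim (ι b)) fun b => isEmptyElim (ι b)⟩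
  have : Nonempty β := by
    by_cases hι : Function.Surjective ι
    · exact ⟨(hι a₀).choose⟩
    · obtain ⟨b, -⟩ := Finset.card_pos.1
        ((Nat.mul_pos (Nat.pos_of_ne_zero hk) (Nat.pos_of_ne_zero hr)).trans_le (hspare hι))
      exact ⟨b⟩
  obtain ⟨τ, hτ, hkeep, hlost⟩ := exists_injOn_extension (U := U) (keep := (· ∈ Set.range ι))
    (C := fun _ => spare) (Set.LeftInvOn.injOn (f₁' := ι) (f := Function.invFun ι)
      fun a ⟨b, hb⟩ => hb ▸ congrArg ι (Function.leftInverse_invFun ι.injective b))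
    (fun a _ ha => hU.trans (hspare fun hι => ha (hι a)))
  have hτι (b) : τ (ι b) = b := by
    rw [hkeep _ ⟨b, rfl⟩, Function.leftInverse_invFun ι.injective]
  refine ⟨τ, hτ, fun S hSU hS hSk => hrestrict S _ hSk hS
    (fun b hb => Finset.mem_image.2 ⟨ι b, hb, hτι b⟩) fun b hb => ?_⟩
  obtain ⟨a, ha, rfl⟩ := Finset.mem_image.1 hb
  by_cases hka : a ∈ Set.range ι
  · obtain ⟨b, rfl⟩ := hka
    exact .inl (by rwa [hτι])
  · exact .inr (hlost a (hSU ha) hka)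

end DiverseFamily

/-! ### A criterion for kernels -/

section KernelCriterion

instance (Q : SubsetProblem) : TreeEncoding Q.Inst := ⟨Q.enc⟩
instance (Q : SubsetProblem) : TreeEncoding (DiverseInst Q) := ⟨DiverseInst.enc⟩

variable {γ : Type} [TreeEncoding γ] {Q : SubsetProblem}

namespace PolyTimeFun

theorem diverseInst_tuple {f : γ → DiverseInst Q} (hf : PolyTimeFun f) :
    PolyTimeFun (fun c => ((f c).inst, (f c).k, (f c).r, (f c).t)) :=
  hf.of_enc_eq fun _ => rfl

@[fun_prop]
theorem diverseInst_inst {f : γ → DiverseInst Q} (hf : PolyTimeFun f) :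
    PolyTimeFun (fun c => (f c).inst) :=
  hf.diverseInst_tuple.fst

@[fun_prop]
theorem diverseInst_k {f : γ → DiverseInst Q} (hf : PolyTimeFun f) :
    PolyTimeFun (fun c => (f c).k) :=
  hf.diverseInst_tuple.snd.fst

@[fun_prop]
theorem diverseInst_r {f : γ → DiverseInst Q} (hf : PolyTimeFun f) :
    PolyTimeFun (fun c => (f c).r) :=
  hf.diverseInst_tuple.snd.snd.fst

@[fun_prop]
theorem diverseInst_t {f : γ → DiverseInst Q} (hf : PolyTimeFun f) :
    PolyTimeFun (fun c => (f c).t) :=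
  hf.diverseInst_tuple.snd.snd.snd

@[fun_prop]
theorem diverseInst_mk {I : γ → Q.Inst} {k r t : γ → ℕ} (hI : PolyTimeFun I)
    (hk : PolyTimeFun k) (hr : PolyTimeFun r) (ht : PolyTimeFun t) :
    PolyTimeFun (fun c => (⟨I c, k c, r c, t c⟩ : DiverseInst Q)) :=
  (show PolyTimeFun (fun c => (I c, k c, r c, t c)) by fun_prop).of_enc_eq fun _ => rfl

end PolyTimeFun

theorem hasDiverseFamily_zero_iff {α : Type} {IsSol : Finset α → Prop} {k t : ℕ} :
    HasDiverseFamily IsSol k 0 t ↔ t = 0 := by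
  refine ⟨fun ⟨S, _, ht⟩ => by simpa [diversity] using ht, ?_⟩
  rintro rfl
  exact ⟨Fin.elim0, fun i => i.elim0, Nat.zero_le _⟩

/-- An instance with the given answer: the empty family has diversity `0`. -/
def trivialInst (I₀ : Q.Inst) (answer : Bool) : DiverseInst Q :=
  ⟨I₀, 0, 0, bif answer then 0 else 1⟩

theorem isYes_trivialInst (I₀ : Q.Inst) (answer : Bool) :
    (trivialInst I₀ answer).IsYes ↔ answer = true := by
  cases answer <;> exact hasDiverseFamily_zero_iff.trans (by simp [trivialInst])

theorem size_trivialInst_le (I₀ : Q.Inst) (answer : Bool) :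
    (trivialInst I₀ answer).size ≤ Q.size I₀ + 5 := by
  have h0 : (encNat 0).size ≤ 4 * 0 + 1 := encSize_nat_le_self 0
  have h1 : (encNat 1).size ≤ 4 * 1 + 1 := encSize_nat_le_self 1
  cases answer <;> simp only [DiverseInst.size, trivialInst, cond_true, cond_false] <;> omega

theorem HasDiverseKernel.of_partial_decision {b : ℕ → ℕ → ℕ} (I₀ : Q.Inst)
    (hI₀ : Q.order I₀ = 0) {undecided answer : DiverseInst Q → Bool}
    {red : DiverseInst Q → DiverseInst Q}
    (hundecided : PolyTimeFun undecided) (hanswer : PolyTimeFun answer) (hred : PolyTimeFun red)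
    (answer_iff : ∀ x, undecided x = false → (answer x = true ↔ x.IsYes))
    (red_iff : ∀ x, undecided x = true → ((red x).IsYes ↔ x.IsYes))
    (hsize : ∃ s : Polynomial ℕ, ∀ x, undecided x = true → (red x).size ≤ s.eval (x.k + x.r))
    (horder : ∃ C : ℕ, ∀ x, undecided x = true → Q.order (red x).inst ≤ C * b x.k x.r) :
    HasDiverseKernel Q b := by
  obtain ⟨s, hs⟩ := hsize
  obtain ⟨C, hC⟩ := horder
  refine ⟨fun x => bif undecided x then red x else trivialInst I₀ (answer x),
    show PolyTimeFun _ by unfold trivialInst; fun_prop, fun x => ?_,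
    ⟨.C (Q.size I₀ + 5) + s, fun x => ?_⟩, ⟨C, fun x => ?_⟩⟩ <;>
  cases hx : undecided x <;> simp only [hx, cond_true, cond_false]
  · exact (isYes_trivialInst I₀ _).trans (answer_iff x hx)
  · exact red_iff x hx
  · exact (size_trivialInst_le I₀ _).trans (by simp)
  · exact (hs x hx).trans (by simp)
  · exact hI₀.trans_le (Nat.zero_le _)
  · exact hC x hx

theorem hasDiverseFamily_iff_of_degenerate {α : Type} {IsSol : Finset α → Prop} {k r t : ℕ}
    {good : Prop} (good_of_isSol : ∀ S, r ≠ 0 → IsSol S → S.card ≤ k → good)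
    (isSol_empty : k = 0 → good → IsSol ∅)
    (h : ¬ ((k ≠ 0 ∧ r ≠ 0) ∧ good ∧ t ≤ 2 * k * r * r)) :
    HasDiverseFamily IsSol k r t ↔ t = 0 ∧ (r = 0 ∨ k = 0 ∧ good) := by
  constructor
  · intro hfam
    by_cases hr : r = 0
    · subst hr
      exact ⟨hasDiverseFamily_zero_iff.1 hfam, .inl rfl⟩
    · obtain ⟨S, hS, hSk⟩ := hfam.exists_card_le hr
      have hg := good_of_isSol S hr hS hSk
      have hk : k = 0 := by_contra fun hk => h ⟨⟨hk, hr⟩, hg, hfam.le⟩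
      exact ⟨by simpa [hk] using hfam.le, .inr ⟨hk, hg⟩⟩
  · rintro ⟨rfl, rfl | ⟨rfl, hg⟩⟩
    · exact hasDiverseFamily_zero_iff.2 rfl
    · exact ⟨fun _ => ∅, fun _ => ⟨isSol_empty rfl hg, Nat.zero_le _⟩, Nat.zero_le _⟩

/-- A reduction `red` that keeps `k`, `r` and `t` and works on the instances that pass a necessary
condition `good` for the existence of small solutions. Diversities are at most `2 * k * r * r`,
which bounds `t`. -/
theorem HasDiverseKernel.of_reduction {b : ℕ → ℕ → ℕ} (I₀ : Q.Inst) (hI₀ : Q.order I₀ = 0)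
    {good : Q.Inst → ℕ → ℕ → Bool} {red : Q.Inst → ℕ → ℕ → Q.Inst}
    (hgood : PolyTimeFun (fun x : Q.Inst × ℕ × ℕ => good x.1 x.2.1 x.2.2))
    (hred : PolyTimeFun (fun x : Q.Inst × ℕ × ℕ => red x.1 x.2.1 x.2.2))
    (good_of_isSolution : ∀ I k r S, r ≠ 0 → Q.IsSolution I S → S.card ≤ k → good I k r = true)
    (isSolution_empty : ∀ I r, good I 0 r = true → Q.IsSolution I ∅)
    (red_iff : ∀ I k r t, k ≠ 0 → r ≠ 0 →
      (HasDiverseFamily (Q.IsSolution (red I k r)) k r t ↔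
        HasDiverseFamily (Q.IsSolution I) k r t))
    (hsize : ∃ s : Polynomial ℕ, ∀ I k r, good I k r = true → Q.size (red I k r) ≤ s.eval (k + r))
    (horder : ∃ C : ℕ, ∀ I k r, k ≠ 0 → r ≠ 0 → good I k r = true →
      Q.order (red I k r) ≤ C * b k r) :
    HasDiverseKernel Q b := by
  have := hgood.comp (f := fun x : DiverseInst Q => (x.inst, x.k, x.r)) (by fun_prop)
  have := hred.comp (f := fun x : DiverseInst Q => (x.inst, x.k, x.r)) (by fun_prop)
  let undecided (x : DiverseInst Q) : Bool := (!decide (x.k = 0) && !decide (x.r = 0)) &&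
    (good x.inst x.k x.r && decide (x.t ≤ 2 * x.k * x.r * x.r))
  have undecided_iff (x) : undecided x = true ↔ (x.k ≠ 0 ∧ x.r ≠ 0) ∧
      good x.inst x.k x.r = true ∧ x.t ≤ 2 * x.k * x.r * x.r := by simp [undecided]
  refine of_partial_decision I₀ hI₀ (undecided := undecided) (answer := fun x =>
      decide (x.t = 0) && (decide (x.r = 0) || (decide (x.k = 0) && good x.inst x.k x.r)))
    (red := fun x => ⟨red x.inst x.k x.r, x.k, x.r, x.t⟩) (by fun_prop) (by fun_prop)
    (by fun_prop) (fun x hx => ?_) (fun x hx => ?_) ?_ ?_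
  · have := hasDiverseFamily_iff_of_degenerate
      (fun S => good_of_isSolution x.inst x.k x.r S)
      (fun hk hg => isSolution_empty x.inst x.r (hk ▸ hg))
      ((undecided_iff x).not.1 (by simp [hx]))
    exact .trans (by simp) this.symm
  · exact red_iff _ _ _ _ ((undecided_iff x).1 hx).1.1 ((undecided_iff x).1 hx).1.2
  · obtain ⟨s, hs⟩ := hsize
    refine ⟨s + .X + (4 * (2 * .X * .X * .X) + 1), fun x hx => ?_⟩
    obtain ⟨-, hg, ht⟩ := (undecided_iff x).1 hx
    simp only [Polynomial.eval_add, Polynomial.eval_mul, Polynomial.eval_ofNat, Polynomial.eval_X,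
      Polynomial.eval_one]
    have ht' : (encNat x.t).size ≤ 4 * x.t + 1 := encSize_nat_le_self x.t
    have hkr : 2 * x.k * x.r * x.r ≤ 2 * (x.k + x.r) * (x.k + x.r) * (x.k + x.r) := by
      gcongr <;> omega
    have hs' := hs x.inst x.k x.r hg
    simp only [DiverseInst.size]
    omega
  · obtain ⟨C, hC⟩ := horder
    refine ⟨C, fun x hx => ?_⟩
    obtain ⟨⟨hk, hr⟩, hg, -⟩ := (undecided_iff x).1 hx
    exact hC _ _ _ hk hr hg

end KernelCriterion

/-! ### Edges that determine the small hitting sets -/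

section SparseEdges

/-- The number of edges in `L` containing `C`. -/
def edgeCount (L : List (List ℕ)) (C : List ℕ) : ℕ :=
  (L.filter fun e => C.all fun v => decide (v ∈ e)).length

/-- Does some extension of `C` by at most `j` further vertices of `e`, leaving a budget of `i`
vertices, lie in at least `(k + 1) ^ i` edges of `L`? -/
def heavy (k : ℕ) (L : List (List ℕ)) (e : List ℕ) : ℕ → List ℕ → Bool
  | 0, C => decide ((k + 1) ^ 0 ≤ edgeCount L C)
  | j + 1, C => decide ((k + 1) ^ (j + 1) ≤ edgeCount L C) ||
      e.any fun v => !decide (v ∈ C) && heavy k L e j (v :: C)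

/-- Greedily selected edges of `E`: an edge is dropped if one of its subsets already lies in too
many selected edges. -/
def reduceEdges (d k : ℕ) (E : List (List ℕ)) : List (List ℕ) :=
  E.foldl (fun L e => bif heavy k L e d [] then L else e :: L) []

/-- Every set `C` of at most `d` vertices lies in at most `(k + 1) ^ (d - |C|)` edges. -/
def Sparse (d k : ℕ) (L : List (List ℕ)) : Prop :=
  ∀ (C : List ℕ) (i : ℕ), C.Nodup → C.length + i = d → edgeCount L C ≤ (k + 1) ^ i

/-- The set `S` meets every edge of `E`. -/
def Hits (E : List (List ℕ)) (S : Finset ℕ) : Prop := ∀ e ∈ E, ∃ v ∈ e, v ∈ S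

namespace PolyTimeFun

variable {γ : Type} [TreeEncoding γ]

@[fun_prop]
theorem comp_edgeCount {L : γ → List (List ℕ)} {C : γ → List ℕ} (hL : PolyTimeFun L)
    (hC : PolyTimeFun C) : PolyTimeFun (fun c => edgeCount (L c) (C c)) := by
  unfold edgeCount; fun_prop

@[fun_prop]
theorem comp_heavy (j : ℕ) {k : γ → ℕ} {L : γ → List (List ℕ)} {e C : γ → List ℕ}
    (hk : PolyTimeFun k) (hL : PolyTimeFun L) (he : PolyTimeFun e) (hC : PolyTimeFun C) :
    PolyTimeFun (fun c => heavy (k c) (L c) (e c) j (C c)) := by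
  suffices h : PolyTimeFun (fun x : ℕ × List (List ℕ) × List ℕ × List ℕ =>
      heavy x.1 x.2.1 x.2.2.1 j x.2.2.2) from
    h.comp (f := fun c => (k c, L c, e c, C c)) (by fun_prop)
  induction j with
  | zero => unfold heavy; fun_prop
  | succ j ih =>
    unfold heavy
    have := ih.comp (f := fun x : (ℕ × List (List ℕ) × List ℕ × List ℕ) × ℕ =>
      (x.1.1, x.1.2.1, x.1.2.2.1, x.2 :: x.1.2.2.2)) (by fun_prop)
    fun_prop

@[fun_prop]
theorem comp_reduceEdges (d : ℕ) {k : γ → ℕ} {E : γ → List (List ℕ)} (hk : PolyTimeFun k)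
    (hE : PolyTimeFun E) : PolyTimeFun (fun c => reduceEdges d (k c) (E c)) := by
  obtain ⟨B, hB⟩ := hE.exists_encSize_le
  unfold reduceEdges
  refine foldl_of_encSize_le_add (s := fun _ => []) (P := B)
    (step := fun c L e => bif heavy (k c) L e d [] then L else e :: L) hE (by fun_prop)
    (by fun_prop) fun c L e he => ?_
  have hEc := hB c
  have hec := encSize_lt_of_mem he
  cases heavy (k c) L e d [] <;> simp only [cond_true, cond_false, encSize_cons] <;> omega

end PolyTimeFun

theorem edgeCount_cons (e : List ℕ) (L : List (List ℕ)) (C : List ℕ) :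
    edgeCount (e :: L) C = edgeCount L C + if C ⊆ e then 1 else 0 := by
  simp only [edgeCount, List.filter_cons, List.all_eq_true, decide_eq_true_eq, List.subset_def]
  split_ifs <;> simp

theorem edgeCount_pos {L : List (List ℕ)} {C : List ℕ} :
    0 < edgeCount L C ↔ ∃ e ∈ L, C ⊆ e := by
  simp [edgeCount, List.length_pos_iff, List.eq_nil_iff_forall_not_mem, List.subset_def]

theorem edgeCount_le_sum_of_hits {L : List (List ℕ)} {S : Finset ℕ} (h : Hits L S) (C : List ℕ) :
    edgeCount L C ≤ ∑ v ∈ S, edgeCount L (v :: C) := by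
  induction L with
  | nil => simp [edgeCount]
  | cons e L ih =>
    have ih := ih fun f hf => h f (List.mem_cons_of_mem _ hf)
    simp only [edgeCount_cons, Finset.sum_add_distrib]
    refine Nat.add_le_add ih ?_
    split_ifs with hC
    · obtain ⟨v, hv, hvS⟩ := h e List.mem_cons_self
      calc 1 = if v :: C ⊆ e then 1 else 0 := (if_pos (List.cons_subset.2 ⟨hv, hC⟩)).symm
        _ ≤ _ := Finset.single_le_sum (f := fun v => if v :: C ⊆ e then 1 else 0)
          (fun _ _ => Nat.zero_le _) hvS
    · exact Nat.zero_le _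

theorem heavy_iff {k : ℕ} {L : List (List ℕ)} {e : List ℕ} {j : ℕ} {C : List ℕ}
    (hC : C.Nodup) (hCe : C ⊆ e) :
    heavy k L e j C = true ↔ ∃ (D : List ℕ) (i : ℕ), (D ++ C).Nodup ∧ D ⊆ e ∧ D.length + i = j ∧
      (k + 1) ^ i ≤ edgeCount L (D ++ C) := by
  induction j generalizing C with
  | zero =>
    rw [heavy, decide_eq_true_eq]
    refine ⟨fun h => ⟨[], 0, hC, List.nil_subset _, rfl, h⟩, ?_⟩
    rintro ⟨D, i, -, -, hDi, h⟩
    obtain ⟨hD, rfl⟩ := Nat.add_eq_zero_iff.1 hDi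
    rwa [List.length_eq_zero_iff.1 hD] at h
  | succ j ih =>
    simp only [heavy, Bool.or_eq_true, decide_eq_true_eq, List.any_eq_true, Bool.and_eq_true,
      Bool.not_eq_true', decide_eq_false_iff_not]
    constructor
    · rintro (h | ⟨v, hv, hvC, h⟩)
      · exact ⟨[], j + 1, hC, List.nil_subset _, Nat.zero_add _, h⟩
      · obtain ⟨D, i, hDn, hDe, hDi, h⟩ :=
          (ih (List.nodup_cons.2 ⟨hvC, hC⟩) (List.cons_subset.2 ⟨hv, hCe⟩)).1 h
        refine ⟨D ++ [v], i, ?_, ?_, ?_, ?_⟩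
        · simpa using hDn
        · simpa [hv] using hDe
        · simp only [List.length_append, List.length_singleton]; omega
        · simpa using h
    · rintro ⟨D, i, hDn, hDe, hDi, h⟩
      cases D using List.reverseRecOn with
      | nil =>
        obtain rfl : i = j + 1 := (Nat.zero_add i).symm.trans hDi
        exact .inl h
      | append_singleton D v =>
        simp only [List.append_assoc, List.singleton_append] at hDn h
        obtain ⟨hDe, hv⟩ := List.append_subset.1 hDe
        have hvC := (List.nodup_append.1 hDn).2.1
        have hv : v ∈ e := hv List.mem_cons_self
        simp only [List.length_append, List.length_singleton] at hDi
        exact .inr ⟨v, hv, (List.nodup_cons.1 hvC).1, (ih hvC (List.cons_subset.2 ⟨hv, hCe⟩)).2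
          ⟨D, i, hDn, hDe, by omega, h⟩⟩

theorem heavy_nil_iff {d k : ℕ} {L : List (List ℕ)} {e : List ℕ} :
    heavy k L e d [] = true ↔ ∃ (C : List ℕ) (i : ℕ), C.Nodup ∧ C ⊆ e ∧ C.length + i = d ∧
      (k + 1) ^ i ≤ edgeCount L C := by
  simp [heavy_iff]

theorem Sparse.cons {d k : ℕ} {L : List (List ℕ)} {e : List ℕ} (hL : Sparse d k L)
    (h : heavy k L e d [] = false) : Sparse d k (e :: L) := by
  intro C i hC hi
  rw [edgeCount_cons]
  split_ifs with hCe
  · by_contra! hlt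
    have := heavy_nil_iff.2 ⟨C, i, hC, hCe, hi, Nat.lt_succ_iff.1 hlt⟩
    simp [h] at this
  · exact hL C i hC hi

theorem Sparse.length_le {d k : ℕ} {L : List (List ℕ)} (hL : Sparse d k L) :
    L.length ≤ (k + 1) ^ d := by
  simpa [edgeCount] using hL [] d List.nodup_nil (Nat.zero_add d)

/-- A small hitting set that misses `C` would have to hit the many edges through `C` in its own
vertices `v`, but the sets `v :: C` lie in few edges. -/
theorem Sparse.exists_mem_of_hits {d k : ℕ} {L : List (List ℕ)} {S : Finset ℕ}
    (hL : Sparse d k L) (hd : ∀ e ∈ L, e.length ≤ d) (hS : S.card ≤ k) (hit : Hits L S)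
    {C : List ℕ} {i : ℕ} (hC : C.Nodup) (hi : C.length + i = d)
    (h : (k + 1) ^ i ≤ edgeCount L C) : ∃ v ∈ C, v ∈ S := by
  by_contra! hCS
  cases i with
  | zero =>
    obtain ⟨e, he, hCe⟩ := edgeCount_pos.1 (Nat.one_pos.trans_le h)
    obtain ⟨v, hv, hvS⟩ := hit e he
    have hperm := (List.subperm_of_subset hC hCe).perm_of_length_le ((hd e he).trans hi.ge)
    exact hCS v (hperm.mem_iff.2 hv) hvS
  | succ i =>
    have hlt : edgeCount L C < (k + 1) ^ (i + 1) := calc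
      edgeCount L C ≤ ∑ v ∈ S, edgeCount L (v :: C) := edgeCount_le_sum_of_hits hit C
      _ ≤ ∑ _v ∈ S, (k + 1) ^ i := Finset.sum_le_sum fun v hv =>
        hL _ _ (List.nodup_cons.2 ⟨fun hvC => hCS v hvC hv, hC⟩)
          (by rw [List.length_cons]; omega)
      _ = S.card * (k + 1) ^ i := by rw [Finset.sum_const, smul_eq_mul]
      _ < (k + 1) * (k + 1) ^ i := by gcongr; omega
      _ = (k + 1) ^ (i + 1) := (pow_succ' _ _).symm
    exact absurd h hlt.not_ge

theorem reduceEdges_concat (d k : ℕ) (E : List (List ℕ)) (e : List ℕ) :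
    reduceEdges d k (E ++ [e]) =
      bif heavy k (reduceEdges d k E) e d [] then reduceEdges d k E else e :: reduceEdges d k E :=
  List.foldl_append

theorem mem_of_mem_reduceEdges {d k : ℕ} {E : List (List ℕ)} {e : List ℕ}
    (h : e ∈ reduceEdges d k E) : e ∈ E := by
  induction E using List.reverseRecOn with
  | nil => exact h
  | append_singleton E f ih =>
    rw [reduceEdges_concat] at h
    cases hf : heavy k (reduceEdges d k E) f d [] <;>
      simp only [hf, cond_true, cond_false, List.mem_cons] at h
    · exact h.elim (by rintro rfl; simp) fun h => List.mem_append_left _ (ih h)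
    · exact List.mem_append_left _ (ih h)

theorem sparse_reduceEdges (d k : ℕ) (E : List (List ℕ)) : Sparse d k (reduceEdges d k E) := by
  induction E using List.reverseRecOn with
  | nil => exact fun C i _ _ => Nat.zero_le _
  | append_singleton E e ih =>
    rw [reduceEdges_concat]
    cases he : heavy k (reduceEdges d k E) e d []
    · exact ih.cons he
    · exact ih

theorem hits_reduceEdges_iff {d k : ℕ} {E : List (List ℕ)} (hd : ∀ e ∈ E, e.length ≤ d)
    {S : Finset ℕ} (hS : S.card ≤ k) : Hits (reduceEdges d k E) S ↔ Hits E S := by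
  refine ⟨fun hit => ?_, fun hit e he => hit e (mem_of_mem_reduceEdges he)⟩
  induction E using List.reverseRecOn with
  | nil => exact hit
  | append_singleton E e ih =>
    have hdE : ∀ f ∈ E, f.length ≤ d := fun f hf => hd f (List.mem_append_left _ hf)
    rw [reduceEdges_concat] at hit
    refine List.forall_mem_append.2 ?_
    rw [List.forall_mem_singleton]
    cases he : heavy k (reduceEdges d k E) e d [] <;> simp only [he, cond_true, cond_false] at hit
    · exact ⟨ih hdE fun f hf => hit f (List.mem_cons_of_mem _ hf), hit e List.mem_cons_self⟩
    · obtain ⟨C, i, hC, hCe, hi, hcount⟩ := heavy_nil_iff.1 he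
      obtain ⟨v, hv, hvS⟩ := (sparse_reduceEdges d k E).exists_mem_of_hits
        (fun f hf => hdE f (mem_of_mem_reduceEdges hf)) hS hit hC hi hcount
      exact ⟨ih hdE hit, v, hCe hv, hvS⟩

end SparseEdges

/-! ### Kept vertices -/

section KeptVertices

/-- The elements of `V` satisfying `p`, followed by up to `m` others. -/
def keepVertices (V : List ℕ) (p : ℕ → Bool) (m : ℕ) : List ℕ :=
  V.filter p ++ (V.filter fun v => !p v).take m

@[fun_prop]
theorem PolyTimeFun.comp_keepVertices {γ : Type} [TreeEncoding γ] {V : γ → List ℕ}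
    {p : γ → ℕ → Bool} {m : γ → ℕ} (hV : PolyTimeFun V)
    (hp : PolyTimeFun (fun x : γ × ℕ => p x.1 x.2)) (hm : PolyTimeFun m) :
    PolyTimeFun (fun c => keepVertices (V c) (p c) (m c)) := by
  unfold keepVertices; fun_prop

variable {V : List ℕ} {p : ℕ → Bool} {m v : ℕ}

theorem mem_keepVertices_of (hv : v ∈ V) (h : p v = true) : v ∈ keepVertices V p m :=
  List.mem_append_left _ (List.mem_filter.2 ⟨hv, h⟩)

theorem mem_of_mem_keepVertices (h : v ∈ keepVertices V p m) : v ∈ V :=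
  (List.mem_append.1 h).elim (fun h => (List.mem_filter.1 h).1)
    fun h => (List.mem_filter.1 (List.mem_of_mem_take h)).1

theorem nodup_keepVertices (h : V.Nodup) : (keepVertices V p m).Nodup := by
  refine List.nodup_append.2 ⟨h.filter _, (h.filter _).sublist (List.take_sublist _ _), ?_⟩
  rintro a ha b hb rfl
  have hpa := (List.mem_filter.1 ha).2
  have hnpa := (List.mem_filter.1 (List.mem_of_mem_take hb)).2
  simp [hpa] at hnpa

theorem length_keepVertices_le : (keepVertices V p m).length ≤ (V.filter p).length + m := by
  simp [keepVertices]

theorem le_length_keepVertices (hv : v ∈ V) (h : v ∉ keepVertices V p m) :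
    m ≤ (keepVertices V p m).length := by
  rw [keepVertices, List.mem_append, not_or, List.mem_filter, not_and] at h
  have hlt : m < (V.filter fun v => !p v).length := by
    by_contra! hle
    rw [List.take_of_length_le hle] at h
    exact h.2 (List.mem_filter.2 ⟨hv, by simpa using h.1 hv⟩)
  rw [keepVertices, List.length_append, List.length_take]
  omega

theorem length_filter_le_card (hV : V.Nodup) {F : Finset ℕ} (h : ∀ v ∈ V, p v = true → v ∈ F) :
    (V.filter p).length ≤ F.card := by
  rw [← List.toFinset_card_of_nodup (hV.filter _)]
  refine Finset.card_le_card fun v hv => ?_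
  obtain ⟨hvV, hpv⟩ := List.mem_filter.1 (List.mem_toFinset.1 hv)
  exact h v hvV hpv

/-- The vertex of the original instance that a vertex of the kernel stands for. -/
def keptEmbedding (n : ℕ) (p : ℕ → Bool) (m : ℕ) :
    Fin (keepVertices (List.range n) p m).length ↪ Fin n where
  toFun i := ⟨(keepVertices (List.range n) p m)[i],
    List.mem_range.1 (mem_of_mem_keepVertices (List.getElem_mem i.2))⟩
  inj' i j h := Fin.ext <|
    (nodup_keepVertices List.nodup_range).getElem_inj_iff.1 (congrArg Fin.val h)

theorem exists_keptEmbedding_eq {n : ℕ} {v : Fin n}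
    (h : (v : ℕ) ∈ keepVertices (List.range n) p m) : ∃ i, keptEmbedding n p m i = v :=
  have ⟨i, hi, hiv⟩ := List.getElem_of_mem h
  ⟨⟨i, hi⟩, Fin.ext hiv⟩

theorem le_length_of_keptEmbedding_not_surjective {n : ℕ}
    (h : ¬ Function.Surjective (keptEmbedding n p m)) :
    m ≤ (keepVertices (List.range n) p m).length := by
  rw [Function.Surjective] at h
  push Not at h
  obtain ⟨v, hv⟩ := h
  exact le_length_keepVertices (List.mem_range.2 v.2) fun hmem =>
    (exists_keptEmbedding_eq hmem).elim hv

end KeptVertices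

/-! ### Kernels for hitting set problems -/

section HittingKernel

/-- The vertices kept for hitting `E` with at most `k` of the vertices `0, …, n - 1`. -/
def hittingVertices (d n k r : ℕ) (E : List (List ℕ)) : List ℕ :=
  keepVertices (List.range n) (fun v => (reduceEdges d k E).any fun e => decide (v ∈ e)) (k * r)

/-- The vertex of the original instance that a vertex of the kernel stands for. -/
abbrev hittingEmbedding (d n k r : ℕ) (E : List (List ℕ)) :
    Fin (hittingVertices d n k r E).length ↪ Fin n :=
  keptEmbedding n (fun v => (reduceEdges d k E).any fun e => decide (v ∈ e)) (k * r)

theorem length_hittingVertices_le {d n k r : ℕ} {E : List (List ℕ)}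
    (hd : ∀ e ∈ E, e.length ≤ d) :
    (hittingVertices d n k r E).length ≤ d * (k + 1) ^ d + k * r := by
  let L := reduceEdges d k E
  refine length_keepVertices_le.trans (Nat.add_le_add_right ?_ _)
  calc _ ≤ L.flatten.toFinset.card :=
        length_filter_le_card List.nodup_range fun v _ hv => by simpa using hv
    _ ≤ L.flatten.length := List.toFinset_card_le _
    _ ≤ L.length * d := by
      rw [List.length_flatten]
      simpa using List.sum_le_card_nsmul (L.map List.length) d
        (by simpa using fun e he => hd e (mem_of_mem_reduceEdges he))
    _ ≤ (k + 1) ^ d * d := Nat.mul_le_mul_right d (sparse_reduceEdges d k E).length_le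
    _ = d * (k + 1) ^ d := mul_comm _ _

theorem exists_hittingEmbedding_eq {d n k r : ℕ} {E : List (List ℕ)} {e : List ℕ}
    (he : e ∈ reduceEdges d k E) {v : Fin n} (hv : (v : ℕ) ∈ e) :
    ∃ i, hittingEmbedding d n k r E i = v :=
  exists_keptEmbedding_eq <| mem_keepVertices_of (List.mem_range.2 v.2)
    (List.any_eq_true.2 ⟨e, he, decide_eq_true hv⟩)

variable {Q : SubsetProblem} {d : ℕ} {edges : Q.Inst → List (List ℕ)}
  {red : Q.Inst → ℕ → ℕ → Q.Inst}

theorem hasDiverseFamily_hits_iff {α β : Type} {n k r t : ℕ} {E : List (List ℕ)}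
    (hd : ∀ e ∈ E, e.length ≤ d) (vertex : α ≃ Fin n)
    (keptVertex : β ≃ Fin (hittingVertices d n k r E).length) (hk : k ≠ 0) (hr : r ≠ 0) :
    HasDiverseFamily (fun T : Finset β => Hits (reduceEdges d k E)
      (T.image fun b => (hittingEmbedding d n k r E (keptVertex b) : ℕ))) k r t ↔
    HasDiverseFamily (fun S : Finset α => Hits E (S.image fun a => (vertex a : ℕ))) k r t := by
  classical
  let ι : β ↪ α := keptVertex.toEmbedding.trans
    ((hittingEmbedding d n k r E).trans vertex.symm.toEmbedding)
  have hι (b) : vertex (ι b) = hittingEmbedding d n k r E (keptVertex b) := by simp [ι]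
  refine hasDiverseFamily_iff_of_embedding ι (Finset.univ.map keptVertex.symm.toEmbedding)
    (fun h => ?_) hk hr (fun T hT hit => ?_) fun S T hS hit hST _ e he => ?_
  · rw [Finset.card_map, Finset.card_univ, Fintype.card_fin]
    exact le_length_of_keptEmbedding_not_surjective fun hsurj => h <|
      vertex.symm.surjective.comp (hsurj.comp keptVertex.surjective)
  · rw [← hits_reduceEdges_iff hd (Finset.card_image_le.trans ((Finset.card_map ι).trans_le hT)),
      Finset.map_eq_image, Finset.image_image]
    simpa only [Function.comp_def, hι] using hit
  · obtain ⟨v, hv, hvS⟩ := (hits_reduceEdges_iff hd (Finset.card_image_le.trans hS)).2 hit e he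
    obtain ⟨a, haS, rfl⟩ := Finset.mem_image.1 hvS
    obtain ⟨i, hi⟩ := exists_hittingEmbedding_eq (r := r) he hv
    have hia : ι (keptVertex.symm i) = a := vertex.injective (by simp [hι, hi])
    exact ⟨_, hv, Finset.mem_image.2 ⟨_, hST _ (hia ▸ haS), by rw [← hι, hia]⟩⟩

/-- Here `edges` describes an instance by hyperedges, and `red` realizes the kept hyperedges on
the kept vertices. -/
theorem HasDiverseKernel.of_hits (I₀ : Q.Inst) (hI₀ : Q.order I₀ = 0)
    (hedges : PolyTimeFun edges)
    (hred : PolyTimeFun (fun x : Q.Inst × ℕ × ℕ => red x.1 x.2.1 x.2.2))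
    (hd : ∀ I, ∀ e ∈ edges I, e.length ≤ d)
    (vertex : ∀ I, Q.Item I ≃ Fin (Q.order I))
    (keptVertex : ∀ I k r,
      Q.Item (red I k r) ≃ Fin (hittingVertices d (Q.order I) k r (edges I)).length)
    (isSolution_iff : ∀ I S, Q.IsSolution I S ↔
      Hits (edges I) (S.image fun a => (vertex I a : ℕ)))
    (isSolution_red_iff : ∀ I k r T, Q.IsSolution (red I k r) T ↔
      Hits (reduceEdges d k (edges I)) (T.image fun b =>
        (hittingEmbedding d (Q.order I) k r (edges I) (keptVertex I k r b) : ℕ)))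
    (hsize : ∃ s : Polynomial ℕ, ∀ I k r, Q.size (red I k r) ≤
      s.eval (Q.order (red I k r) + (reduceEdges d k (edges I)).length)) :
    HasDiverseKernel Q (fun k r => k ^ d + k * r) := by
  have order_le (I k r) : Q.order (red I k r) ≤ d * (k + 1) ^ d + k * r := calc
    _ = (hittingVertices d (Q.order I) k r (edges I)).length :=
      Fin.equiv_iff_eq.1 ⟨(vertex _).symm.trans (keptVertex I k r)⟩
    _ ≤ _ := length_hittingVertices_le (hd I)
  refine .of_reduction I₀ hI₀ (good := fun I k _ => !decide (k = 0) || (edges I).isEmpty)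
    (by fun_prop) hred (fun I k r S _ hS hSk => ?_) (fun I _ h => ?_)
    (fun I k r t hk hr => ?_) ?_ ?_
  · obtain rfl | hk := eq_or_ne k 0
    · obtain rfl := Finset.card_eq_zero.1 (Nat.le_zero.1 hSk)
      have : edges I = [] := List.eq_nil_iff_forall_not_mem.2 fun e he => by
        simpa using (isSolution_iff I ∅).1 hS e he
      simp [this]
    · simp [hk]
  · have : edges I = [] := by simpa using h
    rw [isSolution_iff, this]
    exact fun e he => absurd he List.not_mem_nil
  · calc _ ↔ _ := hasDiverseFamily_congr fun T _ => isSolution_red_iff I k r T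
      _ ↔ _ := hasDiverseFamily_hits_iff (hd I) (vertex I) (keptVertex I k r) hk hr
      _ ↔ _ := hasDiverseFamily_congr fun S _ => (isSolution_iff I S).symm
  · obtain ⟨s, hs⟩ := hsize
    refine ⟨s.comp (.C d * (.X + 1) ^ d + .X * .X + (.X + 1) ^ d), fun I k r _ => ?_⟩
    refine (hs I k r).trans ?_
    rw [Polynomial.eval_comp]
    refine eval_nat_mono s ?_
    simp only [Polynomial.eval_add, Polynomial.eval_mul, Polynomial.eval_C, Polynomial.eval_pow,
      Polynomial.eval_X, Polynomial.eval_one]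
    refine (Nat.add_le_add (order_le I k r) (sparse_reduceEdges d k _).length_le).trans ?_
    gcongr <;> omega
  · refine ⟨d * 2 ^ d + 1, fun I k r hk _ _ => (order_le I k r).trans ?_⟩
    calc d * (k + 1) ^ d + k * r ≤ d * (2 * k) ^ d + k * r := by gcongr; omega
      _ = d * 2 ^ d * k ^ d + 1 * (k * r) := by ring
      _ ≤ d * 2 ^ d * k ^ d + 1 * (k * r) + (k ^ d + d * 2 ^ d * (k * r)) := Nat.le_add_right _ _
      _ = (d * 2 ^ d + 1) * (k ^ d + k * r) := by ring

end HittingKernel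

/-! ### Hitting Set -/

section HittingSet

/-- The positions of `true`. -/
def support (b : List Bool) : List ℕ :=
  (List.range b.length).filter fun v => b.getD v false

@[fun_prop]
theorem PolyTimeFun.comp_support {γ : Type} [TreeEncoding γ] {b : γ → List Bool}
    (hb : PolyTimeFun b) : PolyTimeFun (fun c => support (b c)) := by
  unfold support; fun_prop

theorem mem_support_ofFn {n : ℕ} {p : Fin n → Bool} {v : ℕ} :
    v ∈ support (List.ofFn p) ↔ ∃ h : v < n, p ⟨v, h⟩ = true := by
  simp only [support, List.length_ofFn, List.mem_filter, List.mem_range]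
  constructor <;> rintro ⟨h, h'⟩ <;> exact ⟨h, by simpa [h] using h'⟩

theorem encList_map {α β : Type} (e : β → Data) (f : α → β) (l : List α) :
    encList e (l.map f) = encList (fun a => e (f a)) l := by
  induction l with
  | nil => rfl
  | cons a l ih => simp [encList, ih]

theorem ofFn_getElem_eq_map {α : Type} (W : List ℕ) (g : ℕ → α) :
    List.ofFn (fun i : Fin W.length => g W[i]) = W.map g :=
  List.ext_getElem (by simp) fun i _ _ => by simp

namespace HypergraphInst

variable {d : ℕ}

instance : TreeEncoding (HypergraphInst d) := ⟨HypergraphInst.enc⟩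

/-- The incidence vector of a hyperedge. -/
def incidence {n : ℕ} (e : Finset (Fin n)) : List Bool := List.ofFn fun v => decide (v ∈ e)

theorem mem_support_incidence {n : ℕ} {e : Finset (Fin n)} {v : ℕ} :
    v ∈ support (incidence e) ↔ v ∈ e.map Fin.valEmbedding := by
  simp only [incidence, mem_support_ofFn, decide_eq_true_eq, Finset.mem_map,
    Fin.valEmbedding_apply]
  exact ⟨fun ⟨h, hv⟩ => ⟨_, hv, rfl⟩, fun ⟨a, ha, hav⟩ => hav ▸ ⟨a.2, ha⟩⟩

theorem length_support_incidence {n : ℕ} (e : Finset (Fin n)) :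
    (support (incidence e)).length = e.card := by
  have hnodup : (support (incidence e)).Nodup := List.nodup_range.filter _
  rw [← List.toFinset_card_of_nodup hnodup, ← Finset.card_map Fin.valEmbedding]
  congr 1
  ext v
  rw [List.mem_toFinset, mem_support_incidence]

/-- The number of vertices in unary. -/
def unary (I : HypergraphInst d) : List Unit := List.replicate I.n ()

/-- The incidence vectors of the hyperedges. -/
def rows (I : HypergraphInst d) : List (List Bool) := I.edges.map incidence

theorem enc_unary_rows (I : HypergraphInst d) :
    TreeEncoding.enc (I.unary, I.rows) = TreeEncoding.enc I := by
  have hunary : I.unary = (List.range I.n).map fun _ => () := by simp [unary]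
  have henc_unary : TreeEncoding.enc I.unary = encList (fun _ => Data.nil) (List.range I.n) := by
    rw [hunary]; exact encList_map _ _ _
  have henc_rows : TreeEncoding.enc I.rows =
      encList (fun e => encList encBool (List.ofFn fun v => decide (v ∈ e))) I.edges :=
    encList_map _ _ _
  rw [enc_pair, henc_unary, henc_rows]
  rfl

/-- The hyperedges as lists of vertices. -/
def edgeLists (I : HypergraphInst d) : List (List ℕ) := I.rows.map support

theorem mem_edgeLists {I : HypergraphInst d} {e : List ℕ} :
    e ∈ I.edgeLists ↔ ∃ f ∈ I.edges, support (incidence f) = e := by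
  simp [edgeLists, rows]

theorem length_le_of_mem_edgeLists {I : HypergraphInst d} {e : List ℕ} (h : e ∈ I.edgeLists) :
    e.length ≤ d := by
  obtain ⟨f, hf, rfl⟩ := mem_edgeLists.1 h
  exact (length_support_incidence f).trans_le (I.card_le f hf)

theorem isSolution_iff_hits (I : HypergraphInst d) (S : Finset (Fin I.n)) :
    (hittingSet d).IsSolution I S ↔ Hits I.edgeLists (S.image fun v : Fin I.n => (v : ℕ)) := by
  simp only [hittingSet, Hits, mem_edgeLists, forall_exists_index, and_imp,
    forall_apply_eq_imp_iff₂, mem_support_incidence, Finset.mem_map, Finset.mem_image,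
    Fin.valEmbedding_apply]
  refine forall₂_congr fun e _ => ⟨fun ⟨v, hv, hvS⟩ => ⟨v, ⟨v, hv, rfl⟩, v, hvS, rfl⟩, ?_⟩
  rintro ⟨_, ⟨v, hv, rfl⟩, w, hwS, hwv⟩
  exact ⟨v, hv, Fin.ext hwv ▸ hwS⟩

/-- The vertices of the kernel. -/
abbrev keptVertices (I : HypergraphInst d) (k r : ℕ) : List ℕ :=
  hittingVertices d I.n k r I.edgeLists

/-- The trace of an edge on the vertices of the kernel. -/
def trace (I : HypergraphInst d) (k r : ℕ) (e : List ℕ) :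
    Finset (Fin (I.keptVertices k r).length) :=
  Finset.univ.filter fun i => (I.keptVertices k r)[i] ∈ e

theorem mem_trace {I : HypergraphInst d} {k r : ℕ} {e : List ℕ}
    {i : Fin (I.keptVertices k r).length} :
    i ∈ I.trace k r e ↔ (hittingEmbedding d I.n k r I.edgeLists i : ℕ) ∈ e := by
  simp only [trace, Finset.mem_filter, Finset.mem_univ, true_and]; rfl

theorem card_trace_le (I : HypergraphInst d) (k r : ℕ) (e : List ℕ) :
    (I.trace k r e).card ≤ e.length := calc
  (I.trace k r e).card ≤ e.toFinset.card :=
    Finset.card_le_card_of_injOn (fun i => hittingEmbedding d I.n k r I.edgeLists i)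
      (fun _ hi => List.mem_toFinset.2 (mem_trace.1 hi))
      (Fin.val_injective.comp (hittingEmbedding d I.n k r I.edgeLists).injective).injOn
  _ ≤ e.length := List.toFinset_card_le e

/-- The kernel. -/
def reduced (I : HypergraphInst d) (k r : ℕ) : HypergraphInst d where
  n := (I.keptVertices k r).length
  edges := (reduceEdges d k I.edgeLists).map (I.trace k r)
  card_le := List.forall_mem_map.2 fun e he => (I.card_trace_le k r e).trans
    (length_le_of_mem_edgeLists (mem_of_mem_reduceEdges he))

theorem isSolution_reduced_iff (I : HypergraphInst d) (k r : ℕ)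
    (T : Finset (Fin (I.keptVertices k r).length)) :
    (hittingSet d).IsSolution (I.reduced k r) T ↔ Hits (reduceEdges d k I.edgeLists)
      (T.image fun i => (hittingEmbedding d I.n k r I.edgeLists i : ℕ)) := by
  refine List.forall_mem_map.trans (forall₂_congr fun e _ => ?_)
  simp only [Finset.mem_image]
  constructor
  · rintro ⟨i, hie, hiT⟩
    exact ⟨_, mem_trace.1 hie, i, hiT, rfl⟩
  · rintro ⟨_, hie, i, hiT, rfl⟩
    exact ⟨i, mem_trace.2 hie, hiT⟩

theorem unary_reduced (I : HypergraphInst d) (k r : ℕ) :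
    (I.reduced k r).unary = (I.keptVertices k r).map fun _ => () :=
  (List.map_const' ..).symm

theorem rows_reduced (I : HypergraphInst d) (k r : ℕ) :
    (I.reduced k r).rows = (reduceEdges d k I.edgeLists).map fun e =>
      (I.keptVertices k r).map fun v => decide (v ∈ e) := by
  refine List.map_map.trans (List.map_congr_left fun e _ => ?_)
  rw [← ofFn_getElem_eq_map]
  exact congrArg List.ofFn (funext fun i => decide_eq_decide.2 mem_trace)

theorem size_enc_le (I : HypergraphInst d) :
    I.enc.size ≤ I.n * 2 + (I.edges.length * (I.n * 4 + 2) + 1) + 2 := by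
  have hunary : encSize I.unary ≤ I.n * 2 + 1 := by
    simpa [unary] using encSize_list_le (l := I.unary) (B := 1) fun _ _ => le_rfl
  have hrow (b) (hb : b ∈ I.rows) : encSize b ≤ I.n * 4 + 1 := by
    obtain ⟨e, -, rfl⟩ := List.mem_map.1 hb
    simpa [incidence] using
      encSize_list_le (l := incidence e) (B := 3) fun b _ => encSize_bool_le b
  have hrows : encSize I.rows ≤ I.edges.length * (I.n * 4 + 2) + 1 := by
    simpa [rows] using encSize_list_le hrow
  calc I.enc.size = encSize (I.unary, I.rows) := congrArg Data.size I.enc_unary_rows.symm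
    _ = encSize I.unary + encSize I.rows + 1 := encSize_pair _ _
    _ ≤ _ := by omega

end HypergraphInst

namespace PolyTimeFun

open HypergraphInst

variable {d : ℕ} {γ : Type} [TreeEncoding γ]

theorem hypergraph_unary_rows {f : γ → HypergraphInst d} (hf : PolyTimeFun f) :
    PolyTimeFun (fun c => ((f c).unary, (f c).rows)) :=
  hf.of_enc_eq fun _ => enc_unary_rows _

@[fun_prop]
theorem hypergraph_rows {f : γ → HypergraphInst d} (hf : PolyTimeFun f) :
    PolyTimeFun (fun c => (f c).rows) :=
  hf.hypergraph_unary_rows.snd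

@[fun_prop]
theorem hypergraph_edgeLists {f : γ → HypergraphInst d} (hf : PolyTimeFun f) :
    PolyTimeFun (fun c => (f c).edgeLists) := by
  unfold edgeLists; fun_prop

@[fun_prop]
theorem hypergraph_range_n {f : γ → HypergraphInst d} (hf : PolyTimeFun f) :
    PolyTimeFun (fun c => List.range (f c).n) :=
  hf.hypergraph_unary_rows.fst.list_range_length.congr fun c => by simp [unary]

@[fun_prop]
theorem hypergraph_keptVertices {f : γ → HypergraphInst d} {k r : γ → ℕ} (hf : PolyTimeFun f)
    (hk : PolyTimeFun k) (hr : PolyTimeFun r) :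
    PolyTimeFun (fun c => (f c).keptVertices (k c) (r c)) := by
  unfold keptVertices hittingVertices; fun_prop

theorem hypergraph_reduced :
    PolyTimeFun (fun x : HypergraphInst d × ℕ × ℕ => x.1.reduced x.2.1 x.2.2) := by
  refine (show PolyTimeFun (fun x : HypergraphInst d × ℕ × ℕ =>
    ((x.1.keptVertices x.2.1 x.2.2).map fun _ => (), (reduceEdges d x.2.1 x.1.edgeLists).map
      fun e => (x.1.keptVertices x.2.1 x.2.2).map fun v => decide (v ∈ e)))
    by fun_prop).of_enc_eq fun x => ?_
  rw [← unary_reduced, ← rows_reduced, enc_unary_rows]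

end PolyTimeFun

open HypergraphInst in
theorem hasDiverseKernel_hittingSet (d : ℕ) :
    HasDiverseKernel (hittingSet d) (fun k r => k ^ d + k * r) := by
  refine .of_hits (Q := hittingSet d) (edges := edgeLists) (red := reduced) ⟨0, [], by simp⟩ rfl
    (PolyTimeFun.hypergraph_edgeLists .id) PolyTimeFun.hypergraph_reduced
    (fun _ _ => length_le_of_mem_edgeLists) (fun _ => Equiv.refl _) (fun _ _ _ => Equiv.refl _)
    isSolution_iff_hits isSolution_reduced_iff
    ⟨.X * 2 + (.X * (.X * 4 + 2) + 1) + 2, fun I k r => ?_⟩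
  refine (size_enc_le (I.reduced k r)).trans ?_
  simp only [Polynomial.eval_add, Polynomial.eval_mul, Polynomial.eval_X, Polynomial.eval_one,
    Polynomial.eval_ofNat]
  have hedges : (I.reduced k r).edges.length = (reduceEdges d k I.edgeLists).length :=
    List.length_map _
  change _ ≤ ((I.reduced k r).n + _) * 2 +
    (((I.reduced k r).n + _) * (((I.reduced k r).n + _) * 4 + 2) + 1) + 2
  rw [hedges]
  gcongr <;> omega

end HittingSet

/-! ### Boolean matrices -/

section Matrix

/-- The entry of a matrix given by its rows. -/
def entry (M : List (List Bool)) (u v : ℕ) : Bool := (M.getD u []).getD v false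

/-- The matrix with rows and columns indexed by `W`. -/
def matrixOf (W : List ℕ) (p : ℕ → ℕ → Bool) : List (List Bool) := W.map fun u => W.map (p u)

namespace PolyTimeFun

variable {γ : Type} [TreeEncoding γ]

@[fun_prop]
theorem comp_entry {M : γ → List (List Bool)} {u v : γ → ℕ} (hM : PolyTimeFun M)
    (hu : PolyTimeFun u) (hv : PolyTimeFun v) :
    PolyTimeFun (fun c => entry (M c) (u c) (v c)) := by
  unfold entry; fun_prop

@[fun_prop]
theorem comp_matrixOf {W : γ → List ℕ} {p : γ → ℕ → ℕ → Bool} (hW : PolyTimeFun W)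
    (hp : PolyTimeFun (fun x : γ × ℕ × ℕ => p x.1 x.2.1 x.2.2)) :
    PolyTimeFun (fun c => matrixOf (W c) (p c)) := by
  unfold matrixOf
  have := PolyTimeFun.comp hp (f := fun x : (γ × ℕ) × ℕ => (x.1.1, x.1.2, x.2)) (by fun_prop)
  fun_prop

end PolyTimeFun

/-- The rows of a matrix. -/
def matrixRows {n : ℕ} (M : Fin n → Fin n → Bool) : List (List Bool) :=
  List.ofFn fun i => List.ofFn (M i)

theorem length_matrixRows {n : ℕ} (M : Fin n → Fin n → Bool) : (matrixRows M).length = n :=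
  List.length_ofFn

theorem entry_matrixRows {n : ℕ} {M : Fin n → Fin n → Bool} {u v : ℕ} :
    entry (matrixRows M) u v = true ↔
      ∃ (hu : u < n) (hv : v < n), M ⟨u, hu⟩ ⟨v, hv⟩ = true := by
  unfold entry matrixRows
  by_cases hu : u < n
  · by_cases hv : v < n <;> simp [hu, hv]
  · simp [hu]

theorem matrixRows_getElem (W : List ℕ) (p : ℕ → ℕ → Bool) :
    matrixRows (fun i j : Fin W.length => p W[i] W[j]) = matrixOf W p := by
  unfold matrixRows matrixOf
  rw [← ofFn_getElem_eq_map]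
  exact congrArg List.ofFn (funext fun i => ofFn_getElem_eq_map W _)

theorem encMatrix_size_le {n : ℕ} (M : Fin n → Fin n → Bool) :
    (encMatrix M).size ≤ n * (n * 4 + 2) + 1 := by
  have hrow (b) (hb : b ∈ matrixRows M) : encSize b ≤ n * 4 + 1 := by
    obtain ⟨i, rfl⟩ := (List.mem_ofFn' _ _).1 hb
    simpa using encSize_list_le (l := List.ofFn (M i)) (B := 3) fun b _ => encSize_bool_le b
  calc (encMatrix M).size = encSize (matrixRows M) := rfl
    _ ≤ (matrixRows M).length * (n * 4 + 1 + 1) + 1 := encSize_list_le hrow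
    _ = n * (n * 4 + 2) + 1 := by rw [length_matrixRows]

end Matrix

/-! ### Vertex Cover -/

section VertexCover

namespace GraphInst

noncomputable instance : TreeEncoding GraphInst := ⟨GraphInst.enc⟩

open Classical in
/-- The rows of the adjacency matrix. -/
noncomputable def rows (I : GraphInst) : List (List Bool) :=
  matrixRows fun u v => decide (I.G.Adj u v)

theorem entry_rows {I : GraphInst} {u v : ℕ} :
    entry I.rows u v = true ↔ ∃ (hu : u < I.n) (hv : v < I.n), I.G.Adj ⟨u, hu⟩ ⟨v, hv⟩ := by
  simp [rows, entry_matrixRows]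

/-- The edges, in both orientations, as lists of vertices. -/
noncomputable def edgeLists (I : GraphInst) : List (List ℕ) :=
  (List.range I.n).flatMap fun u =>
    ((List.range I.n).filter fun v => entry I.rows u v).map fun v => [u, v]

theorem mem_edgeLists {I : GraphInst} {e : List ℕ} :
    e ∈ I.edgeLists ↔ ∃ u v, I.G.Adj u v ∧ [(u : ℕ), (v : ℕ)] = e := by
  simp only [edgeLists, List.mem_flatMap, List.mem_map, List.mem_filter, List.mem_range]
  constructor
  · rintro ⟨u, -, v, ⟨-, h⟩, rfl⟩
    obtain ⟨hu, hv, h⟩ := entry_rows.1 h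
    exact ⟨_, _, h, rfl⟩
  · rintro ⟨u, v, h, rfl⟩
    exact ⟨u, u.2, v, ⟨v.2, entry_rows.2 ⟨u.2, v.2, h⟩⟩, rfl⟩

theorem length_le_of_mem_edgeLists {I : GraphInst} {e : List ℕ} (h : e ∈ I.edgeLists) :
    e.length ≤ 2 := by
  obtain ⟨u, v, -, rfl⟩ := mem_edgeLists.1 h
  exact le_rfl

theorem isSolution_iff_hits (I : GraphInst) (S : Finset (Fin I.n)) :
    vertexCover.IsSolution I S ↔ Hits I.edgeLists (S.image fun v : Fin I.n => (v : ℕ)) := by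
  simp only [vertexCover, Hits, mem_edgeLists, forall_exists_index, and_imp]
  constructor
  · rintro h _ u v huv rfl
    simpa [Fin.val_inj] using h u v huv
  · intro h u v huv
    simpa [Fin.val_inj] using h _ u v huv rfl

/-- The vertices of the kernel. -/
noncomputable abbrev keptVertices (I : GraphInst) (k r : ℕ) : List ℕ :=
  hittingVertices 2 I.n k r I.edgeLists

/-- Adjacency along kept edges. -/
noncomputable def keptAdj (I : GraphInst) (k u v : ℕ) : Bool :=
  !decide (u = v) && (reduceEdges 2 k I.edgeLists).any fun e => decide (u ∈ e) && decide (v ∈ e)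

theorem keptAdj_iff {I : GraphInst} {k u v : ℕ} :
    I.keptAdj k u v = true ↔ u ≠ v ∧ ∃ e ∈ reduceEdges 2 k I.edgeLists, u ∈ e ∧ v ∈ e := by
  simp [keptAdj]

/-- The kernel. -/
noncomputable def reduced (I : GraphInst) (k r : ℕ) : GraphInst where
  n := (I.keptVertices k r).length
  G :=
    { Adj := fun i j => I.keptAdj k (I.keptVertices k r)[i] (I.keptVertices k r)[j] = true
      symm := ⟨fun i j h => by
        obtain ⟨hne, e, he, hi, hj⟩ := keptAdj_iff.1 h
        exact keptAdj_iff.2 ⟨hne.symm, e, he, hj, hi⟩⟩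
      loopless := ⟨fun i h => (keptAdj_iff.1 h).1 rfl⟩ }

theorem rows_reduced (I : GraphInst) (k r : ℕ) :
    (I.reduced k r).rows = matrixOf (I.keptVertices k r) (I.keptAdj k) := by
  rw [← matrixRows_getElem]
  refine congrArg matrixRows (funext₂ fun i j => Bool.eq_iff_iff.2 ?_)
  exact @decide_eq_true_iff _ (Classical.propDecidable _)

theorem reduced_adj_iff {I : GraphInst} {k r : ℕ} {i j : Fin (I.keptVertices k r).length} :
    (I.reduced k r).G.Adj i j ↔ i ≠ j ∧ ∃ e ∈ reduceEdges 2 k I.edgeLists,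
      (hittingEmbedding 2 I.n k r I.edgeLists i : ℕ) ∈ e ∧
      (hittingEmbedding 2 I.n k r I.edgeLists j : ℕ) ∈ e :=
  keptAdj_iff.trans (and_congr_left' ((Fin.val_injective.comp
    (hittingEmbedding 2 I.n k r I.edgeLists).injective).ne_iff (x := i) (y := j)))

theorem isSolution_reduced_iff (I : GraphInst) (k r : ℕ)
    (T : Finset (Fin (I.keptVertices k r).length)) :
    vertexCover.IsSolution (I.reduced k r) T ↔ Hits (reduceEdges 2 k I.edgeLists)
      (T.image fun i => (hittingEmbedding 2 I.n k r I.edgeLists i : ℕ)) := by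
  let ι := hittingEmbedding 2 I.n k r I.edgeLists
  constructor
  · intro h e he
    obtain ⟨u, v, huv, rfl⟩ := mem_edgeLists.1 (mem_of_mem_reduceEdges he)
    obtain ⟨i, rfl⟩ := exists_hittingEmbedding_eq (r := r) he (v := u) (by simp)
    obtain ⟨j, rfl⟩ := exists_hittingEmbedding_eq (r := r) he (v := v) (by simp)
    obtain hi | hj := h i j (reduced_adj_iff.2 ⟨fun hij => huv.ne (congrArg ι hij), _, he,
      by simp, by simp⟩)
    · exact ⟨_, by simp, Finset.mem_image_of_mem _ hi⟩
    · exact ⟨ι j, by simp [ι], Finset.mem_image_of_mem _ hj⟩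
  · intro h i j hij
    obtain ⟨hne, e, he, hi, hj⟩ := reduced_adj_iff.1 hij
    obtain ⟨w, hwe, hwT⟩ := h e he
    obtain ⟨s, hsT, rfl⟩ := Finset.mem_image.1 hwT
    obtain ⟨u, v, -, rfl⟩ := mem_edgeLists.1 (mem_of_mem_reduceEdges he)
    simp only [List.mem_cons, List.not_mem_nil, or_false, Fin.val_inj] at hi hj hwe
    have hs : ι s = ι i ∨ ι s = ι j := by
      have : ι i ≠ ι j := ι.injective.ne hne
      grind
    exact hs.imp (fun hs => by rwa [← ι.injective hs]) fun hs => by rwa [← ι.injective hs]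

end GraphInst

namespace PolyTimeFun

open GraphInst

variable {γ : Type} [TreeEncoding γ]

@[fun_prop]
theorem graph_rows {f : γ → GraphInst} (hf : PolyTimeFun f) : PolyTimeFun (fun c => (f c).rows) :=
  hf.of_enc_eq fun _ => rfl

@[fun_prop]
theorem graph_range_n {f : γ → GraphInst} (hf : PolyTimeFun f) :
    PolyTimeFun (fun c => List.range (f c).n) :=
  hf.graph_rows.list_range_length.congr fun _ => congrArg List.range (length_matrixRows _)

@[fun_prop]
theorem graph_edgeLists {f : γ → GraphInst} (hf : PolyTimeFun f) :
    PolyTimeFun (fun c => (f c).edgeLists) := by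
  unfold edgeLists; fun_prop

@[fun_prop]
theorem graph_keptVertices {f : γ → GraphInst} {k r : γ → ℕ} (hf : PolyTimeFun f)
    (hk : PolyTimeFun k) (hr : PolyTimeFun r) :
    PolyTimeFun (fun c => (f c).keptVertices (k c) (r c)) := by
  unfold keptVertices hittingVertices; fun_prop

@[fun_prop]
theorem graph_keptAdj {f : γ → GraphInst} {k u v : γ → ℕ} (hf : PolyTimeFun f)
    (hk : PolyTimeFun k) (hu : PolyTimeFun u) (hv : PolyTimeFun v) :
    PolyTimeFun (fun c => (f c).keptAdj (k c) (u c) (v c)) := by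
  unfold keptAdj; fun_prop

theorem graph_reduced : PolyTimeFun (fun x : GraphInst × ℕ × ℕ => x.1.reduced x.2.1 x.2.2) := by
  refine (show PolyTimeFun (fun x : GraphInst × ℕ × ℕ =>
    matrixOf (x.1.keptVertices x.2.1 x.2.2) (x.1.keptAdj x.2.1)) by fun_prop).of_enc_eq
      fun x => ?_
  rw [← rows_reduced]
  rfl

end PolyTimeFun

open GraphInst in
theorem hasDiverseKernel_vertexCover :
    HasDiverseKernel vertexCover (fun k r => k * (k + r)) := by
  have hbound : (fun k r : ℕ => k * (k + r)) = fun k r => k ^ 2 + k * r := by ext; ring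
  rw [hbound]
  refine .of_hits (Q := vertexCover) (edges := edgeLists) (red := reduced) ⟨0, ⊥⟩ rfl
    (PolyTimeFun.graph_edgeLists .id) PolyTimeFun.graph_reduced
    (fun _ _ => length_le_of_mem_edgeLists) (fun _ => Equiv.refl _) (fun _ _ _ => Equiv.refl _)
    isSolution_iff_hits isSolution_reduced_iff
    ⟨.X * (.X * 4 + 2) + 1, fun I k r => (encMatrix_size_le _).trans ?_⟩
  simp only [Polynomial.eval_add, Polynomial.eval_mul, Polynomial.eval_X, Polynomial.eval_one,
    Polynomial.eval_ofNat]
  change (I.reduced k r).n * ((I.reduced k r).n * 4 + 2) + 1 ≤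
    ((I.reduced k r).n + _) * (((I.reduced k r).n + _) * 4 + 2) + 1
  gcongr <;> omega

end VertexCover

/-! ### Rational points on lines -/

section PointsOnLines

/-- A formal difference of natural numbers that stands for `x - y` times both denominators. -/
def scaledDiff (x y : ℚ) : ℕ × ℕ :=
  (x.num.toNat * y.den + (-y.num).toNat * x.den, (-x.num).toNat * y.den + y.num.toNat * x.den)

/-- The product of two formal differences of natural numbers. -/
def mulDiff (x y : ℕ × ℕ) : ℕ × ℕ := (x.1 * y.1 + x.2 * y.2, x.1 * y.2 + x.2 * y.1)

/-- Does `s` lie on the line through `p` and `q`? Differences of coordinates enter through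
`scaledDiff`; the denominators multiplied in balance the two sides. -/
def liesOn (p q s : ℚ × ℚ) : Bool :=
  decide ((mulDiff (scaledDiff q.1 p.1) (scaledDiff s.2 p.2)).1 * (q.2.den * s.1.den) +
      (mulDiff (scaledDiff q.2 p.2) (scaledDiff s.1 p.1)).2 * (q.1.den * s.2.den) =
    (mulDiff (scaledDiff q.2 p.2) (scaledDiff s.1 p.1)).1 * (q.1.den * s.2.den) +
      (mulDiff (scaledDiff q.1 p.1) (scaledDiff s.2 p.2)).2 * (q.2.den * s.1.den))

@[fun_prop]
theorem PolyTimeFun.comp_liesOn {γ : Type} [TreeEncoding γ] {p q s : γ → ℚ × ℚ}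
    (hp : PolyTimeFun p) (hq : PolyTimeFun q) (hs : PolyTimeFun s) :
    PolyTimeFun (fun c => liesOn (p c) (q c) (s c)) := by
  unfold liesOn mulDiff scaledDiff; fun_prop

theorem cast_scaledDiff (x y : ℚ) :
    ((scaledDiff x y).1 : ℚ) - (scaledDiff x y).2 = (x - y) * (x.den * y.den) := by
  have htoNat (z : ℤ) : (z.toNat : ℚ) - (-z).toNat = z := by
    exact_mod_cast (show (z.toNat : ℤ) - (-z).toNat = z by omega)
  have hx := (htoNat x.num).trans (Rat.mul_den_eq_num x).symm
  have hy := (htoNat y.num).trans (Rat.mul_den_eq_num y).symm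
  simp only [scaledDiff]
  push_cast
  linear_combination (y.den : ℚ) * hx - (x.den : ℚ) * hy

theorem cast_mulDiff (x y : ℕ × ℕ) :
    ((mulDiff x y).1 : ℚ) - (mulDiff x y).2 = ((x.1 : ℚ) - x.2) * ((y.1 : ℚ) - y.2) := by
  simp only [mulDiff]
  push_cast
  ring

theorem liesOn_iff (p q s : ℚ × ℚ) :
    liesOn p q s = true ↔ (q.1 - p.1) * (s.2 - p.2) = (q.2 - p.2) * (s.1 - p.1) := by
  set D : ℚ := q.1.den * q.2.den * s.1.den * s.2.den * p.1.den * p.2.den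
  have hD : D ≠ 0 := by positivity
  have hx := cast_mulDiff (scaledDiff q.1 p.1) (scaledDiff s.2 p.2)
  have hy := cast_mulDiff (scaledDiff q.2 p.2) (scaledDiff s.1 p.1)
  simp only [cast_scaledDiff] at hx hy
  rw [liesOn, decide_eq_true_eq, ← Nat.cast_inj (R := ℚ)]
  push_cast
  constructor <;> intro h
  · refine mul_right_cancel₀ hD ?_
    linear_combination h - q.2.den * s.1.den * hx + q.1.den * s.2.den * hy
  · linear_combination D * h + q.2.den * s.1.den * hx - q.1.den * s.2.den * hy

theorem exists_mul_eq_and_mul_eq_iff {K : Type*} [Field K] {a b c d : K} (h : a ≠ 0 ∨ b ≠ 0) :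
    (∃ t, t * a = c ∧ t * b = d) ↔ a * d = b * c := by
  constructor
  · rintro ⟨t, rfl, rfl⟩
    ring
  · intro h'
    obtain ha | hb := h
    · exact ⟨c / a, by field_simp, by field_simp; linear_combination -h'⟩
    · exact ⟨d / b, by field_simp; linear_combination h', by field_simp⟩

theorem ratPoint_injective : Function.Injective ratPoint := by
  intro p q h
  have h0 : ratPoint p 0 = ratPoint q 0 := by rw [h]
  have h1 : ratPoint p 1 = ratPoint q 1 := by rw [h]
  simp only [ratPoint, PiLp.toLp_apply, Matrix.cons_val_zero, Matrix.cons_val_one] at h0 h1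
  exact Prod.ext (by exact_mod_cast h0) (by exact_mod_cast h1)

theorem lineMap_ratPoint_eq_iff {p q s : ℚ × ℚ} {t : ℝ} :
    AffineMap.lineMap (ratPoint p) (ratPoint q) t = ratPoint s ↔
      t * ((q.1 : ℝ) - p.1) = s.1 - p.1 ∧ t * ((q.2 : ℝ) - p.2) = s.2 - p.2 := by
  rw [AffineMap.lineMap_apply, PiLp.ext_iff, Fin.forall_fin_two]
  simp [ratPoint, eq_sub_iff_add_eq]

theorem ratPoint_mem_line_iff {p q s : ℚ × ℚ} (h : p ≠ q) :
    ratPoint s ∈ line[ℝ, ratPoint p, ratPoint q] ↔ liesOn p q s = true := by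
  have hne : (q.1 : ℝ) - p.1 ≠ 0 ∨ (q.2 : ℝ) - p.2 ≠ 0 := by
    by_contra! h'
    exact h (Prod.ext (by exact_mod_cast (sub_eq_zero.1 h'.1).symm)
      (by exact_mod_cast (sub_eq_zero.1 h'.2).symm))
  simp only [mem_affineSpan_pair_iff_exists_lineMap_eq, lineMap_ratPoint_eq_iff,
    exists_mul_eq_and_mul_eq_iff hne, liesOn_iff]
  exact_mod_cast Iff.rfl

section Line

variable {K V X : Type*} [Field K] [AddCommGroup V] [Module K V] [AddTorsor V X]

/-- Lines are the affine subspaces of dimension one. -/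
def IsLine (l : AffineSubspace K X) : Prop := Module.finrank K l.direction = 1

theorem isLine_line {a b : X} (h : a ≠ b) : IsLine line[K, a, b] := by
  rw [IsLine, direction_affineSpan, vectorSpan_pair_rev]
  exact finrank_span_singleton (vsub_ne_zero.2 h.symm)

theorem IsLine.eq_line {l : AffineSubspace K X} (hl : IsLine l) {a b : X} (ha : a ∈ l)
    (hb : b ∈ l) (h : a ≠ b) : l = line[K, a, b] := by
  have hle : line[K, a, b] ≤ l := affineSpan_pair_le_of_mem_of_mem ha hb
  have : FiniteDimensional K l.direction := Module.finite_of_finrank_pos (hl ▸ Nat.one_pos)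
  refine (AffineSubspace.ext_of_direction_eq ?_ ⟨a, left_mem_affineSpan_pair K a b, ha⟩).symm
  exact Submodule.eq_of_le_of_finrank_eq (AffineSubspace.direction_le hle)
    ((isLine_line h).trans hl.symm)

theorem IsLine.eq_of_mem {l l' : AffineSubspace K X} (hl : IsLine l) (hl' : IsLine l') {a b : X}
    (h : a ≠ b) (ha : a ∈ l) (hb : b ∈ l) (ha' : a ∈ l') (hb' : b ∈ l') : l = l' :=
  (hl.eq_line ha hb h).trans (hl'.eq_line ha' hb' h).symm

end Line

open Classical in
/-- The points of `L` on a line. -/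
noncomputable def pointsOn (l : AffineSubspace ℝ Plane) (L : List (ℚ × ℚ)) : Finset (ℚ × ℚ) :=
  L.toFinset.filter fun p => ratPoint p ∈ l

theorem mem_pointsOn {l : AffineSubspace ℝ Plane} {L : List (ℚ × ℚ)} {p : ℚ × ℚ} :
    p ∈ pointsOn l L ↔ p ∈ L ∧ ratPoint p ∈ l := by
  simp [pointsOn]

theorem pointsOn_mono {l : AffineSubspace ℝ Plane} {L L' : List (ℚ × ℚ)} (h : L ⊆ L') :
    pointsOn l L ⊆ pointsOn l L' := fun _ hq =>
  mem_pointsOn.2 ⟨h (mem_pointsOn.1 hq).1, (mem_pointsOn.1 hq).2⟩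

theorem card_pointsOn_line {L : List (ℚ × ℚ)} (hL : L.Nodup) {p q : ℚ × ℚ} (h : p ≠ q) :
    (pointsOn line[ℝ, ratPoint p, ratPoint q] L).card = (L.filter (liesOn p q)).length := by
  rw [← List.toFinset_card_of_nodup (hL.filter _)]
  congr 1
  ext s
  rw [mem_pointsOn, ratPoint_mem_line_iff h, List.mem_toFinset, List.mem_filter]

end PointsOnLines

/-! ### Point Line Cover -/

section PointLineCover

/-- Is `p` an element of `L` or on a line through `N` points of `L`? -/
def isRepresented (N : ℕ) (L : List (ℚ × ℚ)) (p : ℚ × ℚ) : Bool :=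
  L.any fun q => decide (q = p) || decide (N ≤ (L.filter (liesOn p q)).length)

/-- Keep only points that do not lie on a line through `N` points kept before. -/
def keepPoints (N : ℕ) (P : List (ℚ × ℚ)) : List (ℚ × ℚ) :=
  P.foldl (fun L p => bif isRepresented N L p then L else p :: L) []

namespace PolyTimeFun

variable {γ : Type} [TreeEncoding γ] {N : γ → ℕ}

@[fun_prop]
theorem comp_isRepresented {L : γ → List (ℚ × ℚ)} {p : γ → ℚ × ℚ} (hN : PolyTimeFun N)
    (hL : PolyTimeFun L) (hp : PolyTimeFun p) :
    PolyTimeFun (fun c => isRepresented (N c) (L c) (p c)) := by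
  unfold isRepresented; fun_prop

@[fun_prop]
theorem comp_keepPoints {P : γ → List (ℚ × ℚ)} (hN : PolyTimeFun N) (hP : PolyTimeFun P) :
    PolyTimeFun (fun c => keepPoints (N c) (P c)) := by
  obtain ⟨B, hB⟩ := hP.exists_encSize_le
  refine hP.foldl_of_encSize_le_add (s := fun _ => []) (P := B)
    (step := fun c L p => bif isRepresented (N c) L p then L else p :: L)
    (by fun_prop) (by fun_prop) fun c L p hp => ?_
  have := (encSize_lt_of_mem hp).trans_le (hB c)
  cases isRepresented (N c) L p <;> simp only [cond_true, cond_false, encSize_cons] <;> omega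

end PolyTimeFun

/-- No line contains more than `N` points of `L`, and `L` has no repetitions. -/
structure Spread (N : ℕ) (L : List (ℚ × ℚ)) : Prop where
  nodup : L.Nodup
  card_pointsOn_le : ∀ l, IsLine l → (pointsOn l L).card ≤ N

/-- The meaning of `isRepresented`: solutions with less than `N` lines that cover `L` cover `p`. -/
def Represents (N : ℕ) (L : List (ℚ × ℚ)) (p : ℚ × ℚ) : Prop :=
  p ∉ L → ∃ l, IsLine l ∧ ratPoint p ∈ l ∧ N ≤ (pointsOn l L).card

variable {N k r : ℕ} {L P : List (ℚ × ℚ)} {p : ℚ × ℚ}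

theorem Represents.mono {L' : List (ℚ × ℚ)} (hLL' : L ⊆ L') (h : Represents N L p) :
    Represents N L' p := fun hp =>
  have ⟨l, hl, hpl, hc⟩ := h fun hpL => hp (hLL' hpL)
  ⟨l, hl, hpl, hc.trans (Finset.card_le_card (pointsOn_mono hLL'))⟩

theorem represents_of_isRepresented (hL : L.Nodup) (h : isRepresented N L p = true) :
    Represents N L p := by
  intro hp
  obtain ⟨q, hq, h⟩ := List.any_eq_true.1 h
  have hpq : p ≠ q := fun h => hp (h ▸ hq)
  simp only [hpq.symm, decide_false, Bool.false_or, decide_eq_true_eq] at h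
  exact ⟨_, isLine_line (ratPoint_injective.ne hpq), left_mem_affineSpan_pair ℝ _ _,
    h.trans (card_pointsOn_line hL hpq).ge⟩

theorem Spread.cons (hN : 0 < N) (hL : Spread N L) (h : isRepresented N L p = false) :
    Spread N (p :: L) := by
  have hnew (q) (hq : q ∈ L) : q ≠ p ∧ (L.filter (liesOn p q)).length < N := by
    simpa using List.any_eq_false.1 h q hq
  refine ⟨List.nodup_cons.2 ⟨fun hp => (hnew p hp).1 rfl, hL.nodup⟩, fun l hl => ?_⟩
  have hsub : pointsOn l (p :: L) ⊆ insert p (pointsOn l L) := fun q hq => by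
    rw [mem_pointsOn, List.mem_cons] at hq
    rw [Finset.mem_insert, mem_pointsOn]
    tauto
  by_cases hp : ratPoint p ∈ l
  · refine (Finset.card_le_card hsub).trans ((Finset.card_insert_le _ _).trans ?_)
    obtain hempty | ⟨q, hq⟩ := (pointsOn l L).eq_empty_or_nonempty
    · rwa [hempty]
    · rw [mem_pointsOn] at hq
      obtain ⟨hqp, hlt⟩ := hnew q hq.1
      rwa [← card_pointsOn_line hL.nodup hqp.symm,
        ← hl.eq_line hp hq.2 (ratPoint_injective.ne hqp.symm)] at hlt
  · refine (Finset.card_le_card fun q hq => ?_).trans (hL.card_pointsOn_le l hl)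
    refine (Finset.mem_insert.1 (hsub hq)).resolve_left ?_
    rintro rfl
    exact hp (mem_pointsOn.1 hq).2

theorem keepPoints_append_singleton (N : ℕ) (P : List (ℚ × ℚ)) (p : ℚ × ℚ) :
    keepPoints N (P ++ [p]) =
      bif isRepresented N (keepPoints N P) p then keepPoints N P else p :: keepPoints N P :=
  List.foldl_append

theorem keepPoints_subset (N : ℕ) (P : List (ℚ × ℚ)) : keepPoints N P ⊆ P := by
  induction P using List.reverseRecOn with
  | nil => exact List.Subset.refl _
  | append_singleton P p ih =>
    rw [keepPoints_append_singleton]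
    cases isRepresented N (keepPoints N P) p
    · exact List.cons_subset.2 ⟨by simp, List.subset_append_of_subset_left _ ih⟩
    · exact List.subset_append_of_subset_left _ ih

theorem spread_keepPoints (hN : 0 < N) (P : List (ℚ × ℚ)) : Spread N (keepPoints N P) := by
  induction P using List.reverseRecOn with
  | nil => exact ⟨List.nodup_nil, fun l _ => by simp [keepPoints, pointsOn]⟩
  | append_singleton P p ih =>
    rw [keepPoints_append_singleton]
    cases h : isRepresented N (keepPoints N P) p
    · exact ih.cons hN h
    · exact ih

theorem represents_keepPoints (hN : 0 < N) (hp : p ∈ P) : Represents N (keepPoints N P) p := by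
  induction P using List.reverseRecOn with
  | nil => exact absurd hp List.not_mem_nil
  | append_singleton P q ih =>
    rw [keepPoints_append_singleton]
    obtain hp | hp := List.mem_append.1 hp
    · cases isRepresented N (keepPoints N P) q
      · exact (ih hp).mono (List.subset_cons_self _ _)
      · exact ih hp
    · obtain rfl := List.mem_singleton.1 hp
      cases h : isRepresented N (keepPoints N P) p
      · exact fun h => absurd List.mem_cons_self h
      · exact represents_of_isRepresented (spread_keepPoints hN P).nodup h

variable {S : Finset (AffineSubspace ℝ Plane)}

theorem IsLineCover.mono {P' : List (ℚ × ℚ)} (h : P' ⊆ P) (hS : IsLineCover P S) :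
    IsLineCover P' S :=
  ⟨hS.1, fun p hp => hS.2 p (h hp)⟩

theorem IsLineCover.exists_mem_of_represents (hL : IsLineCover L S) (hS : S.card < N)
    (hp : Represents N L p) : ∃ l ∈ S, ratPoint p ∈ l := by
  by_cases hpL : p ∈ L
  · exact hL.2 p hpL
  obtain ⟨l, hl, hpl, hc⟩ := hp hpL
  have hcover (q) (hq : q ∈ pointsOn l L) : ∃ l' ∈ S, ratPoint q ∈ l' :=
    hL.2 q (mem_pointsOn.1 hq).1
  choose! f hfS hf using hcover
  obtain ⟨a, ha, b, hb, hab, hfab⟩ :=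
    Finset.exists_ne_map_eq_of_card_lt_of_maps_to (hS.trans_le hc) hfS
  have hlf : l = f a := hl.eq_of_mem (hL.1 _ (hfS a ha)) (ratPoint_injective.ne hab)
    (mem_pointsOn.1 ha).2 (mem_pointsOn.1 hb).2 (hf a ha) (hfab ▸ hf b hb)
  exact ⟨l, hlf ▸ hfS a ha, hpl⟩

theorem isLineCover_keepPoints_iff (hS : S.card < N) :
    IsLineCover (keepPoints N P) S ↔ IsLineCover P S :=
  ⟨fun h => ⟨h.1, fun _ hp =>
    h.exists_mem_of_represents hS (represents_keepPoints (Nat.zero_lt_of_lt hS) hp)⟩,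
    .mono (keepPoints_subset N P)⟩

theorem Spread.length_le (hL : Spread N L) (hS : IsLineCover L S) : L.length ≤ S.card * N := by
  classical
  calc L.length = L.toFinset.card := (List.toFinset_card_of_nodup hL.nodup).symm
    _ ≤ (S.biUnion fun l => pointsOn l L).card := Finset.card_le_card fun p hp => by
      obtain ⟨l, hl, hpl⟩ := hS.2 p (List.mem_toFinset.1 hp)
      exact Finset.mem_biUnion.2 ⟨l, hl, mem_pointsOn.2 ⟨List.mem_toFinset.1 hp, hpl⟩⟩
    _ ≤ S.card * N :=
      Finset.card_biUnion_le_card_mul _ _ _ fun l hl => hL.card_pointsOn_le l (hS.1 l hl)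

/-- Point Line Cover with the notion of solution as a parameter. -/
noncomputable abbrev linesProblem
    (IsSol : PointsInst → Finset (AffineSubspace ℝ Plane) → Prop) : SubsetProblem where
  Inst := PointsInst
  enc := PointsInst.enc
  Item _ := AffineSubspace ℝ Plane
  IsSolution := IsSol
  order P := P.length
  size P := P.length

theorem hasDiverseKernel_linesProblem
    {IsSol : PointsInst → Finset (AffineSubspace ℝ Plane) → Prop} {N : ℕ → ℕ → ℕ}
    {b : ℕ → ℕ → ℕ} (hN : PolyTimeFun (fun x : ℕ × ℕ => N x.1 x.2)) (hkN : ∀ k r, k < N k r)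
    (isLineCover : ∀ P S, IsSol P S → IsLineCover P S)
    (isSol_empty : ∀ P, IsLineCover P ∅ → IsSol P ∅)
    (keepPoints_iff : ∀ P k r t,
      HasDiverseFamily (IsSol (keepPoints (N k r) P)) k r t ↔ HasDiverseFamily (IsSol P) k r t)
    (hNs : ∃ s : Polynomial ℕ, ∀ k r, k * N k r ≤ s.eval (k + r))
    (hNb : ∃ C : ℕ, ∀ k r, k ≠ 0 → k * N k r ≤ C * b k r) :
    HasDiverseKernel (linesProblem IsSol) b := by
  have : PolyTimeFun (fun x : List (ℚ × ℚ) × ℕ × ℕ => N x.2.1 x.2.2) :=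
    hN.comp (f := fun x : List (ℚ × ℚ) × ℕ × ℕ => x.2) (by fun_prop)
  refine .of_reduction (Q := linesProblem IsSol) ([] : List (ℚ × ℚ)) rfl
    (good := fun P k r => decide ((keepPoints (N k r) P).length ≤ k * N k r))
    (red := fun P k r => keepPoints (N k r) P)
    (show PolyTimeFun (fun x : List (ℚ × ℚ) × ℕ × ℕ =>
      decide ((keepPoints (N x.2.1 x.2.2) x.1).length ≤ x.2.1 * N x.2.1 x.2.2)) by fun_prop)
    (show PolyTimeFun (fun x : List (ℚ × ℚ) × ℕ × ℕ => keepPoints (N x.2.1 x.2.2) x.1) by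
      fun_prop)
    (fun P k r S _ hS hSk => decide_eq_true ?_) (fun P r h => isSol_empty P ?_)
    (fun P k r t _ _ => keepPoints_iff P k r t) ?_ ?_
  · have hcover := (isLineCover P S hS).mono (keepPoints_subset (N k r) P)
    exact ((spread_keepPoints (Nat.zero_lt_of_lt (hkN k r)) P).length_le hcover).trans
      (Nat.mul_le_mul_right _ hSk)
  · have hnil : keepPoints (N 0 r) P = [] := by simpa using of_decide_eq_true h
    rw [← isLineCover_keepPoints_iff (Finset.card_empty.trans_lt (hkN 0 r)), hnil]
    exact ⟨fun l hl => absurd hl (Finset.notMem_empty l), fun p hp => absurd hp List.not_mem_nil⟩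
  · exact hNs.imp fun s hs P k r h => (of_decide_eq_true h).trans (hs k r)
  · exact hNb.imp fun C hC P k r hk _ h => (of_decide_eq_true h).trans (hC k r hk)

theorem hasDiverseKernel_pointLineCover :
    HasDiverseKernel pointLineCover (fun k r => k * (k + r)) := by
  refine hasDiverseKernel_linesProblem (IsSol := IsLineCover) (N := fun k _ => k + 1)
    (by fun_prop) (fun k _ => Nat.lt_succ_self k) (fun _ _ h => h) (fun _ h => h)
    (fun P k r t => hasDiverseFamily_congr fun S hS =>
      isLineCover_keepPoints_iff (Nat.lt_succ_of_le hS))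
    ⟨.X * (.X + 1), fun k r => ?_⟩ ⟨2, fun k r hk => ?_⟩
  · simp only [Polynomial.eval_mul, Polynomial.eval_add, Polynomial.eval_X, Polynomial.eval_one]
    gcongr <;> omega
  · calc k * (k + 1) ≤ k * (2 * (k + r)) := Nat.mul_le_mul_left k (by omega)
      _ = 2 * (k * (k + r)) := by ring

/-- A line cover by spanned lines, the notion of solution of `spannedPointLineCover`. -/
def IsSpannedLineCover (P : List (ℚ × ℚ)) (S : Finset (AffineSubspace ℝ Plane)) : Prop :=
  (∀ l ∈ S, l ∈ spannedLines P) ∧ IsLineCover P S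

theorem spannedLines_mono {P' : List (ℚ × ℚ)} (h : P' ⊆ P) : spannedLines P' ⊆ spannedLines P := by
  rintro l ⟨p, hp, q, hq, hpq, rfl⟩
  exact ⟨p, h hp, q, h hq, hpq, rfl⟩

variable {l : AffineSubspace ℝ Plane}

theorem isLine_of_mem_spannedLines (h : l ∈ spannedLines P) : IsLine l := by
  obtain ⟨p, -, q, -, hpq, rfl⟩ := h
  exact isLine_line (ratPoint_injective.ne hpq)

theorem IsLine.mem_spannedLines (hl : IsLine l) {p q : ℚ × ℚ} (hpq : p ≠ q) (hp : p ∈ P)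
    (hq : q ∈ P) (hpl : ratPoint p ∈ l) (hql : ratPoint q ∈ l) : l ∈ spannedLines P :=
  ⟨p, hp, q, hq, hpq, hl.eq_line hpl hql (ratPoint_injective.ne hpq)⟩

theorem Represents.exists_isLine_ne (hp : Represents N L p) (hpL : p ∉ L) (hN : 1 < N)
    (hl : l ∉ spannedLines L) :
    ∃ H, IsLine H ∧ ratPoint p ∈ H ∧ N ≤ (pointsOn H L).card ∧ H ≠ l := by
  obtain ⟨H, hH, hpH, hc⟩ := hp hpL
  refine ⟨H, hH, hpH, hc, ?_⟩
  rintro rfl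
  obtain ⟨x, hx, y, hy, hxy⟩ := Finset.one_lt_card.1 (hN.trans_le hc)
  rw [mem_pointsOn] at hx hy
  exact hl (hH.mem_spannedLines hxy hx.1 hy.1 hx.2 hy.2)

theorem exists_apex (hN : 1 < N) (hL : ∀ p ∈ P, Represents N L p) (hl : l ∈ spannedLines P)
    (hl' : l ∉ spannedLines L) :
    ∃ H, IsLine H ∧ N ≤ (pointsOn H L).card ∧
      ∃ c ∈ L, ratPoint c ∉ H ∧ ∀ x ∈ L, ratPoint x ∈ l → x = c := by
  have hline := isLine_of_mem_spannedLines hl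
  obtain ⟨a, b, ha, hb, hab, haL, hal, hbl⟩ : ∃ a b, a ∈ P ∧ b ∈ P ∧ a ≠ b ∧ a ∉ L ∧
      ratPoint a ∈ l ∧ ratPoint b ∈ l := by
    obtain ⟨p, hp, q, hq, hpq, rfl⟩ := hl
    have hpl := left_mem_affineSpan_pair ℝ (ratPoint p) (ratPoint q)
    have hql := right_mem_affineSpan_pair ℝ (ratPoint p) (ratPoint q)
    by_cases hpL : p ∈ L
    · exact ⟨q, p, hq, hp, hpq.symm, fun hqL => hl' ⟨p, hpL, q, hqL, hpq, rfl⟩, hql, hpl⟩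
    · exact ⟨p, q, hp, hq, hpq, hpL, hpl, hql⟩
  obtain ⟨H, hH, haH, hHc, hHl⟩ := (hL a ha).exists_isLine_ne haL hN hl'
  refine ⟨H, hH, hHc, ?_⟩
  by_cases h : ∃ c ∈ L, ratPoint c ∈ l
  · obtain ⟨c, hcL, hcl⟩ := h
    have hac : a ≠ c := fun h => haL (h ▸ hcL)
    refine ⟨c, hcL, fun hcH => hHl ?_, fun x hxL hxl => by_contra fun hxc => ?_⟩
    · exact hH.eq_of_mem hline (ratPoint_injective.ne hac) haH hcH hal hcl
    · exact hl' (hline.mem_spannedLines hxc hxL hcL hxl hcl)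
  · push Not at h
    obtain ⟨H', hH', hbH', hHc', -⟩ := (hL b hb).exists_isLine_ne (fun hbL => h b hbL hbl) hN hl'
    obtain ⟨x, hx, y, hy, hxy⟩ := Finset.one_lt_card.1 (hN.trans_le hHc')
    rw [mem_pointsOn] at hx hy
    have hHH' : ¬ (ratPoint x ∈ H ∧ ratPoint y ∈ H) := fun ⟨hxH, hyH⟩ => by
      obtain rfl := hH.eq_of_mem hH' (ratPoint_injective.ne hxy) hxH hyH hx.2 hy.2
      exact hHl (hH.eq_of_mem hline (ratPoint_injective.ne hab) haH hbH' hal hbl)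
    obtain hxH | hyH := not_and_or.1 hHH'
    · exact ⟨x, hx.1, hxH, fun z hz hzl => absurd hzl (h z hz)⟩
    · exact ⟨y, hy.1, hyH, fun z hz hzl => absurd hzl (h z hz)⟩

theorem injOn_line_of_notMem {H : AffineSubspace ℝ Plane} (hH : IsLine H) {c : ℚ × ℚ}
    (hc : ratPoint c ∉ H) :
    Set.InjOn (fun x => line[ℝ, ratPoint c, ratPoint x]) {x | ratPoint x ∈ H} := by
  intro x hx y hy hxy
  by_contra hne
  have hcx : ratPoint c ≠ ratPoint x := fun h => hc (h ▸ hx)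
  have hyl : ratPoint y ∈ line[ℝ, ratPoint c, ratPoint x] := by
    simp only [hxy, right_mem_affineSpan_pair]
  rw [hH.eq_of_mem (isLine_line hcx) (ratPoint_injective.ne hne) hx hy
    (right_mem_affineSpan_pair ℝ _ _) hyl] at hc
  exact hc (left_mem_affineSpan_pair ℝ _ _)

/-- The candidates are the lines through the only point of `L` on `l`, or through an arbitrary one
if there is none, and the points of `L` on a rich line. -/
theorem exists_many_spannedLines (hN : 1 < N) (hL : ∀ p ∈ P, Represents N L p)
    (hl : l ∈ spannedLines P) (hl' : l ∉ spannedLines L) :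
    ∃ C : Finset (AffineSubspace ℝ Plane), N ≤ C.card ∧ ∀ l' ∈ C, l' ∈ spannedLines L ∧
      ∀ p ∈ L, ratPoint p ∈ l → ratPoint p ∈ l' := by
  classical
  obtain ⟨H, hH, hHc, c, hcL, hcH, hc⟩ := exists_apex hN hL hl hl'
  refine ⟨(pointsOn H L).image fun x => line[ℝ, ratPoint c, ratPoint x], ?_, ?_⟩
  · rwa [Finset.card_image_of_injOn ((injOn_line_of_notMem hH hcH).mono
      fun x hx => (mem_pointsOn.1 hx).2)]
  · simp only [Finset.forall_mem_image, mem_pointsOn]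
    refine fun x hx => ⟨⟨c, hcL, x, hx.1, fun h => hcH (h ▸ hx.2), rfl⟩, fun p hp hpl => ?_⟩
    exact hc p hp hpl ▸ left_mem_affineSpan_pair ℝ _ _

open Classical in
theorem exists_injOn_spannedLines (hN : 1 < N) (hLP : L ⊆ P) (hL : ∀ p ∈ P, Represents N L p)
    {U : Finset (AffineSubspace ℝ Plane)} (hU : U.card ≤ N) :
    ∃ τ : AffineSubspace ℝ Plane → AffineSubspace ℝ Plane, Set.InjOn τ U ∧
      ∀ S ⊆ U, IsSpannedLineCover P S → IsSpannedLineCover L (S.image τ) := by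
  have hcandidates (l) (hl : ¬ (l ∈ spannedLines P → l ∈ spannedLines L)) :=
    exists_many_spannedLines hN hL (Classical.not_imp.1 hl).1 (Classical.not_imp.1 hl).2
  choose! C hC hCl using hcandidates
  obtain ⟨τ, hτ, hkeep, hlost⟩ := exists_injOn_extension (f := id) (C := C)
    Function.injective_id.injOn fun l _ hl => hU.trans (hC l hl)
  refine ⟨τ, hτ, fun S hSU ⟨hSP, hS⟩ => ?_⟩
  have hτS (l) (hl : l ∈ S) : τ l ∈ spannedLines L ∧
      ∀ p ∈ L, ratPoint p ∈ l → ratPoint p ∈ τ l := by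
    by_cases hk : l ∈ spannedLines P → l ∈ spannedLines L
    · rw [hkeep l hk]
      exact ⟨hk (hSP l hl), fun _ _ h => h⟩
    · exact hCl l hk _ (hlost l (hSU hl) hk)
  have himage : ∀ l ∈ S.image τ, l ∈ spannedLines L :=
    Finset.forall_mem_image.2 fun l hl => (hτS l hl).1
  refine ⟨himage, fun l hl => isLine_of_mem_spannedLines (himage l hl), fun p hp => ?_⟩
  obtain ⟨l, hl, hpl⟩ := hS.2 p (hLP hp)
  exact ⟨τ l, Finset.mem_image_of_mem τ hl, (hτS l hl).2 p hp hpl⟩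

theorem hasDiverseFamily_spanned_keepPoints_iff {t : ℕ} (hkN : k < N) (hkrN : k * r ≤ N)
    (hN : 1 < N) : HasDiverseFamily (IsSpannedLineCover (keepPoints N P)) k r t ↔
      HasDiverseFamily (IsSpannedLineCover P) k r t := by
  classical
  have hsub := keepPoints_subset N P
  refine ⟨.transfer fun U _ => ⟨id, Function.injective_id.injOn, fun S _ hS hSk => ?_⟩,
    .transfer fun U hU => ?_⟩
  · rw [Finset.image_id]
    exact ⟨fun l hl => spannedLines_mono hsub (hS.1 l hl),
      (isLineCover_keepPoints_iff (hSk.trans_lt hkN)).1 hS.2⟩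
  · obtain ⟨τ, hτ, hτS⟩ := exists_injOn_spannedLines hN hsub
      (fun p => represents_keepPoints (Nat.zero_lt_of_lt hN)) (hU.trans hkrN)
    exact ⟨τ, hτ, fun S hSU hS _ => hτS S hSU hS⟩

theorem hasDiverseKernel_spannedPointLineCover :
    HasDiverseKernel spannedPointLineCover (fun k r => k ^ 2 * (k + r)) := by
  refine hasDiverseKernel_linesProblem (IsSol := IsSpannedLineCover)
    (N := fun k r => k * r + k + 2) (by fun_prop) (fun _ _ => by omega) (fun _ _ h => h.2)
    (fun _ h => ⟨fun l hl => absurd hl (Finset.notMem_empty l), h⟩)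
    (fun P k r t => hasDiverseFamily_spanned_keepPoints_iff (by omega) (by omega) (by omega))
    ⟨.X * (.X * .X + .X + 2), fun k r => ?_⟩ ⟨3, fun k r hk => ?_⟩
  · simp only [Polynomial.eval_mul, Polynomial.eval_add, Polynomial.eval_X, Polynomial.eval_ofNat]
    gcongr <;> omega
  · have hkk : k ≤ k * k := Nat.le_mul_self k
    have hle : k * r + k + 2 ≤ 3 * (k * (k + r)) := by
      rw [mul_add]
      omega
    calc k * (k * r + k + 2) ≤ k * (3 * (k * (k + r))) := Nat.mul_le_mul_left k hle
      _ = 3 * (k ^ 2 * (k + r)) := by ring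

end PointLineCover

/-! ### Feedback arc sets of tournaments given by matrices -/

section Tournament

/-- The third vertices of the directed triangles through the arc `(u, v)`. -/
def apexes (M : List (List Bool)) (u v : ℕ) : List ℕ :=
  (List.range M.length).filter fun w => entry M v w && entry M w u

/-- Is `(u, v)` an arc in more than `k` directed triangles? Such an arc belongs to all feedback arc
sets with at most `k` elements. -/
def isForced (M : List (List Bool)) (k u v : ℕ) : Bool :=
  entry M u v && decide (k < (apexes M u v).length)

/-- The arcs of the tournament in which all forced arcs are reversed. -/
def flipped (M : List (List Bool)) (k u v : ℕ) : Bool :=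
  (entry M u v && !isForced M k u v) || isForced M k v u

/-- Some apexes, sufficiently many to force a forced arc. -/
def firstApexes (M : List (List Bool)) (k u v : ℕ) : List ℕ := (apexes M u v).take (k + 1)

/-- Is `x` a core vertex: on a forced arc, among the first apexes of a forced arc, or on a triangle
of the flipped tournament? -/
def isCore (M : List (List Bool)) (k x : ℕ) : Bool :=
  (List.range M.length).any fun a => isForced M k x a || isForced M k a x ||
    (List.range M.length).any fun b => (isForced M k a b && decide (x ∈ firstApexes M k a b)) ||
      (flipped M k x a && flipped M k a b && flipped M k b x)

namespace PolyTimeFun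

variable {γ : Type} [TreeEncoding γ] {M : γ → List (List Bool)} {k u v : γ → ℕ}

@[fun_prop]
theorem comp_apexes (hM : PolyTimeFun M) (hu : PolyTimeFun u) (hv : PolyTimeFun v) :
    PolyTimeFun (fun c => apexes (M c) (u c) (v c)) := by
  unfold apexes; fun_prop

@[fun_prop]
theorem comp_isForced (hM : PolyTimeFun M) (hk : PolyTimeFun k) (hu : PolyTimeFun u)
    (hv : PolyTimeFun v) : PolyTimeFun (fun c => isForced (M c) (k c) (u c) (v c)) := by
  unfold isForced; fun_prop

@[fun_prop]
theorem comp_flipped (hM : PolyTimeFun M) (hk : PolyTimeFun k) (hu : PolyTimeFun u)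
    (hv : PolyTimeFun v) : PolyTimeFun (fun c => flipped (M c) (k c) (u c) (v c)) := by
  unfold flipped; fun_prop

@[fun_prop]
theorem comp_isCore (hM : PolyTimeFun M) (hk : PolyTimeFun k) (hu : PolyTimeFun u) :
    PolyTimeFun (fun c => isCore (M c) (k c) (u c)) := by
  unfold isCore firstApexes; fun_prop

end PolyTimeFun

/-- The matrix is the adjacency matrix of a tournament. -/
structure IsTournament (M : List (List Bool)) : Prop where
  lt : ∀ {u v}, entry M u v = true → u < M.length ∧ v < M.length
  asymm : ∀ {u v}, entry M u v = true → ¬ entry M v u = true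
  total : ∀ {u v}, u < M.length → v < M.length → u ≠ v → entry M u v = true ∨ entry M v u = true

/-- The arcs inside `W` that are not in `S`. -/
def Remaining (M : List (List Bool)) (W : Set ℕ) (S : Finset (ℕ × ℕ)) (a b : ℕ) : Prop :=
  (a ∈ W ∧ b ∈ W) ∧ entry M a b = true ∧ (a, b) ∉ S

/-- Removing `S` from the subtournament on `W` leaves no directed cycle. -/
def IsFeedbackArcSet (M : List (List Bool)) (W : Set ℕ) (S : Finset (ℕ × ℕ)) : Prop :=
  ∀ v, ¬ Relation.TransGen (Remaining M W S) v v

theorem exists_triangle_of_transGen {V : Type*} {R : V → V → Prop}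
    (hasymm : ∀ {a b}, R a b → ¬ R b a)
    (htotal : ∀ {a b c d}, R a b → R c d → a ≠ d → R a d ∨ R d a) {y : V}
    (h : Relation.TransGen R y y) : ∃ a b, R y a ∧ R a b ∧ R b y := by
  by_contra! hno
  have hout (z) (hz : Relation.TransGen R y z) : R y z := by
    induction hz with
    | single h => exact h
    | @tail b z _ hbz ih =>
      have hyz : y ≠ z := by
        rintro rfl
        exact hasymm ih hbz
      exact (htotal ih hbz hyz).resolve_right (hno b z ih hbz)
  exact hasymm (hout y h) (hout y h)

theorem transGen_of_forall_cycle {V : Type*} {R R' : V → V → Prop} {W : Set V}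
    (hcycle : ∀ y, Relation.TransGen R y y → y ∈ W)
    (hRR' : ∀ {a b}, a ∈ W → b ∈ W → R a b → R' a b) {v : V} (h : Relation.TransGen R v v) :
    Relation.TransGen R' v v := by
  have hpath (z) (hvz : Relation.TransGen R v z) :
      Relation.ReflTransGen R z v → Relation.TransGen R' v z := by
    induction hvz with
    | single hvz =>
      exact fun hzv => .single (hRR' (hcycle _ h) (hcycle _ (.trans_right hzv (.single hvz))) hvz)
    | @tail b z hvb hbz ih =>
      intro hzv
      refine (ih (.head hbz hzv)).tail (hRR' (hcycle b ?_) (hcycle z ?_) hbz)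
      · exact .trans_right (.head hbz hzv) hvb
      · exact .trans_right hzv (hvb.tail hbz)
  exact hpath v h .refl

theorem IsFeedbackArcSet.mono {M : List (List Bool)} {W W' : Set ℕ} {S S' : Finset (ℕ × ℕ)}
    (h : IsFeedbackArcSet M W S) (hSS' : ∀ a b, Remaining M W' S' a b → Remaining M W S a b) :
    IsFeedbackArcSet M W' S' := fun v hv => h v (Relation.TransGen.mono hSS' _ _ hv)

variable {M : List (List Bool)} {k u v x : ℕ} {S : Finset (ℕ × ℕ)} {W : Set ℕ}

theorem isForced_iff : isForced M k u v = true ↔ entry M u v = true ∧ k < (apexes M u v).length :=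
  by simp [isForced]

theorem flipped_iff : flipped M k u v = true ↔
    (entry M u v = true ∧ ¬ isForced M k u v = true) ∨ isForced M k v u = true := by
  simp [flipped]

theorem nodup_apexes (M : List (List Bool)) (u v : ℕ) : (apexes M u v).Nodup :=
  List.nodup_range.filter _

theorem card_firstApexes (h : isForced M k u v = true) :
    (firstApexes M k u v).toFinset.card = k + 1 := by
  rw [firstApexes,
    List.toFinset_card_of_nodup ((nodup_apexes M u v).sublist (List.take_sublist _ _)),
    List.length_take_of_le (isForced_iff.1 h).2]

theorem card_toFinset_firstApexes_le : (firstApexes M k u v).toFinset.card ≤ k + 1 :=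
  (List.toFinset_card_le _).trans (List.length_take_le _ _)

namespace IsTournament

variable (hM : IsTournament M)
include hM

theorem mem_apexes : x ∈ apexes M u v ↔ entry M v x = true ∧ entry M x u = true := by
  simp only [apexes, List.mem_filter, List.mem_range, Bool.and_eq_true, and_iff_right_iff_imp]
  exact fun h => (hM.lt h.2).1

theorem lt_of_isForced (h : isForced M k u v = true) : u < M.length ∧ v < M.length :=
  hM.lt (isForced_iff.1 h).1

theorem lt_of_flipped (h : flipped M k u v = true) : u < M.length ∧ v < M.length :=
  (flipped_iff.1 h).elim (fun h => hM.lt h.1) fun h => (hM.lt_of_isForced h).symm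

theorem asymm_flipped (h : flipped M k u v = true) : ¬ flipped M k v u = true := by
  have huv := fun h : isForced M k u v = true => (isForced_iff.1 h).1
  have hvu := fun h : isForced M k v u = true => (isForced_iff.1 h).1
  have := hM.asymm (u := u) (v := v)
  rw [flipped_iff] at h ⊢
  tauto

theorem total_flipped (hu : u < M.length) (hv : v < M.length) (h : u ≠ v) :
    flipped M k u v = true ∨ flipped M k v u = true := by
  rw [flipped_iff, flipped_iff]
  have := hM.total hu hv h
  tauto

theorem isCore_iff : isCore M k x = true ↔
    (∃ a, isForced M k x a = true ∨ isForced M k a x = true) ∨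
    (∃ a b, isForced M k a b = true ∧ x ∈ firstApexes M k a b) ∨
    ∃ a b, flipped M k x a = true ∧ flipped M k a b = true ∧ flipped M k b x = true := by
  simp only [isCore, List.any_eq_true, Bool.or_eq_true, Bool.and_eq_true, List.mem_range,
    decide_eq_true_eq]
  constructor
  · rintro ⟨a, -, h | ⟨b, -, h | ⟨⟨hxa, hab⟩, hbx⟩⟩⟩
    · exact .inl ⟨a, h⟩
    · exact .inr (.inl ⟨a, b, h⟩)
    · exact .inr (.inr ⟨a, b, hxa, hab, hbx⟩)
  · rintro (⟨a, h⟩ | ⟨a, b, h⟩ | ⟨a, b, hxa, hab, hbx⟩)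
    · exact ⟨a, h.elim (fun h => (hM.lt_of_isForced h).2) fun h => (hM.lt_of_isForced h).1, .inl h⟩
    · exact ⟨a, (hM.lt_of_isForced h.1).1, .inr ⟨b, (hM.lt_of_isForced h.1).2, .inl h⟩⟩
    · exact ⟨a, (hM.lt_of_flipped hxa).2,
        .inr ⟨b, (hM.lt_of_flipped hab).2, .inr ⟨⟨hxa, hab⟩, hbx⟩⟩⟩

theorem lt_of_isCore (h : isCore M k x = true) : x < M.length := by
  obtain ⟨a, h | h⟩ | ⟨a, b, -, h⟩ | ⟨a, b, h, -⟩ := hM.isCore_iff.1 h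
  · exact (hM.lt_of_isForced h).1
  · exact (hM.lt_of_isForced h).2
  · exact (hM.lt (hM.mem_apexes.1 (List.mem_of_mem_take h)).1).2
  · exact (hM.lt_of_flipped h).1

theorem isCore_of_transGen_flipped
    (h : Relation.TransGen (fun a b => flipped M k a b = true) x x) : isCore M k x = true :=
  hM.isCore_iff.2 <| .inr <| .inr <| exists_triangle_of_transGen hM.asymm_flipped
    (fun hab hcd => hM.total_flipped (hM.lt_of_flipped hab).1 (hM.lt_of_flipped hcd).2) h

/-- An arc of `S` lies on the paths through at most one apex. -/
theorem exists_mem_forall_notMem {T : Finset ℕ} (hT : ∀ w ∈ T, w ∈ apexes M u v)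
    (hST : S.card < T.card) : ∃ w ∈ T, (v, w) ∉ S ∧ (w, u) ∉ S := by
  by_contra! hno
  have hne (w) (hw : w ∈ T) : w ≠ v := by
    rintro rfl
    have hloop := (hM.mem_apexes.1 (hT w hw)).1
    exact hM.asymm hloop hloop
  refine hST.not_ge (Finset.card_le_card_of_injOn
    (fun w => if (v, w) ∈ S then (v, w) else (w, u)) (fun w hw => ?_) fun w hw w' hw' h => ?_)
  · dsimp only
    split_ifs with h
    · exact h
    · exact hno w hw h
  · have := hne w hw
    have := hne w' hw'
    dsimp only at h
    split_ifs at h <;> simp_all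

theorem mem_of_isForced (hW : ∀ v, isCore M k v = true → v ∈ W) (hS : S.card ≤ k)
    (hfas : IsFeedbackArcSet M W S) (h : isForced M k u v = true) : (u, v) ∈ S := by
  by_contra huv
  have hcore := fun {v} h => hW v (hM.isCore_iff.2 h)
  obtain ⟨w, hw, hvw, hwu⟩ := hM.exists_mem_forall_notMem (u := u) (v := v)
    (fun w hw => List.mem_of_mem_take (List.mem_toFinset.1 hw))
    ((Nat.lt_succ_of_le hS).trans_eq (card_firstApexes h).symm)
  rw [List.mem_toFinset] at hw
  obtain ⟨hvw', hwu'⟩ := hM.mem_apexes.1 (List.mem_of_mem_take hw)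
  have hu : u ∈ W := hcore (.inl ⟨v, .inl h⟩)
  have hv : v ∈ W := hcore (.inl ⟨u, .inr h⟩)
  have hw : w ∈ W := hcore (.inr (.inl ⟨u, v, h, hw⟩))
  exact hfas u (((Relation.TransGen.single ⟨⟨hu, hv⟩, (isForced_iff.1 h).1, huv⟩).tail
    ⟨⟨hv, hw⟩, hvw', hvw⟩).tail ⟨⟨hw, hu⟩, hwu', hwu⟩)

/-- Since `S` contains all forced arcs, cycles that avoid `S` are cycles of the flipped tournament,
all of whose vertices are core vertices. -/
theorem isFeedbackArcSet_of_core (hW : ∀ v, isCore M k v = true → v ∈ W) (hS : S.card ≤ k)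
    (hfas : IsFeedbackArcSet M W S) (V : Set ℕ) : IsFeedbackArcSet M V S := by
  have hflip (a b) (h : Remaining M V S a b) : flipped M k a b = true :=
    flipped_iff.2 (.inl ⟨h.2.1, fun hf => h.2.2 (hM.mem_of_isForced hW hS hfas hf)⟩)
  exact fun v hv => hfas v <| transGen_of_forall_cycle
    (fun y hy => hW y (hM.isCore_of_transGen_flipped (Relation.TransGen.mono hflip _ _ hy)))
    (fun ha hb h => ⟨⟨ha, hb⟩, h.2⟩) hv

theorem mem_or_transGen_of_flipped (hS : S.card ≤ k) (h : flipped M k u v = true) :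
    (u, v) ∈ S ∧ (apexes M u v).length ≤ k ∨
      Relation.TransGen (Remaining M Set.univ S) u v := by
  obtain ⟨huv, hf⟩ | hf := flipped_iff.1 h
  · by_cases huvS : (u, v) ∈ S
    · exact .inl ⟨huvS, not_lt.1 fun hlt => hf (isForced_iff.2 ⟨huv, hlt⟩)⟩
    · exact .inr (.single ⟨⟨trivial, trivial⟩, huv, huvS⟩)
  · obtain ⟨w, hw, hvw, hwu⟩ := hM.exists_mem_forall_notMem (u := v) (v := u)
      (fun w hw => List.mem_of_mem_take (List.mem_toFinset.1 hw))
      ((Nat.lt_succ_of_le hS).trans_eq (card_firstApexes hf).symm)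
    obtain ⟨huw, hwv⟩ := hM.mem_apexes.1 (List.mem_of_mem_take (List.mem_toFinset.1 hw))
    exact .inr ((Relation.TransGen.single ⟨⟨trivial, trivial⟩, huw, hvw⟩).tail
      ⟨⟨trivial, trivial⟩, hwv, hwu⟩)

end IsTournament

/-- The end vertices and the first apexes of the arcs in `S`. -/
def nearArcs (M : List (List Bool)) (k : ℕ) (S : Finset (ℕ × ℕ)) : Finset ℕ :=
  S.image Prod.fst ∪ S.image Prod.snd ∪ S.biUnion fun e => (firstApexes M k e.1 e.2).toFinset

theorem mem_nearArcs : x ∈ nearArcs M k S ↔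
    ∃ a b, (a, b) ∈ S ∧ (x = a ∨ x = b ∨ x ∈ firstApexes M k a b) := by
  simp only [nearArcs, Finset.mem_union, Finset.mem_image, Finset.mem_biUnion, Prod.exists,
    List.mem_toFinset]
  grind

theorem card_nearArcs_le (hS : S.card ≤ k) : (nearArcs M k S).card ≤ k * k + 3 * k := calc
  _ ≤ (S.image Prod.fst).card + (S.image Prod.snd).card + (S.biUnion _).card :=
    (Finset.card_union_le _ _).trans (Nat.add_le_add_right (Finset.card_union_le _ _) _)
  _ ≤ S.card + S.card + S.card * (k + 1) := Nat.add_le_add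
    (Nat.add_le_add Finset.card_image_le Finset.card_image_le)
    (Finset.card_biUnion_le_card_mul _ _ _ fun _ _ => card_toFinset_firstApexes_le)
  _ ≤ k + k + k * (k + 1) := by gcongr
  _ = k * k + 3 * k := by ring

namespace IsTournament

variable (hM : IsTournament M)
include hM

/-- A triangle of the flipped tournament, with forced arcs bypassed, has an arc in `S`. -/
theorem mem_nearArcs_of_isCore (hS : S.card ≤ k) (hfas : IsFeedbackArcSet M Set.univ S)
    (h : isCore M k x = true) : x ∈ nearArcs M k S := by
  have hforced {a b} (h : isForced M k a b = true) : (a, b) ∈ S :=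
    hM.mem_of_isForced (fun _ _ => trivial) hS hfas h
  rw [mem_nearArcs]
  obtain ⟨a, h | h⟩ | ⟨a, b, h, hx⟩ | ⟨a, b, hxa, hab, hbx⟩ := hM.isCore_iff.1 h
  · exact ⟨x, a, hforced h, .inl rfl⟩
  · exact ⟨a, x, hforced h, .inr (.inl rfl)⟩
  · exact ⟨a, b, hforced h, .inr (.inr hx)⟩
  · obtain ⟨hS', -⟩ | hxa' := hM.mem_or_transGen_of_flipped hS hxa
    · exact ⟨x, a, hS', .inl rfl⟩
    obtain ⟨hS', -⟩ | hbx' := hM.mem_or_transGen_of_flipped hS hbx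
    · exact ⟨b, x, hS', .inr (.inl rfl)⟩
    obtain ⟨hS', hlen⟩ | hab' := hM.mem_or_transGen_of_flipped hS hab
    · obtain ⟨hxa, -⟩ | hax := flipped_iff.1 hxa
      · obtain ⟨hbx, -⟩ | hxb := flipped_iff.1 hbx
        · refine ⟨a, b, hS', .inr (.inr ?_)⟩
          rw [firstApexes, List.take_of_length_le (Nat.le_succ_of_le hlen), hM.mem_apexes]
          exact ⟨hbx, hxa⟩
        · exact ⟨x, b, hforced hxb, .inl rfl⟩
      · exact ⟨a, x, hforced hax, .inr (.inl rfl)⟩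
    · exact absurd ((hxa'.trans hab').trans hbx') (hfas x)

theorem length_filter_isCore_le (hS : S.card ≤ k) (hfas : IsFeedbackArcSet M Set.univ S) (n : ℕ) :
    ((List.range n).filter (isCore M k)).length ≤ k * k + 3 * k :=
  (length_filter_le_card List.nodup_range fun _ _ hx =>
    hM.mem_nearArcs_of_isCore hS hfas hx).trans (card_nearArcs_le hS)

end IsTournament

end Tournament

/-! ### Feedback Arc Set in Tournaments -/

section FeedbackArcSet

theorem forall_not_transGen_onFun_iff {α β : Type*} {R : β → β → Prop} {f : α → β}
    (hR : ∀ {u v}, R u v → u ∈ Set.range f ∧ v ∈ Set.range f) :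
    (∀ a, ¬ Relation.TransGen (Function.onFun R f) a a) ↔ ∀ v, ¬ Relation.TransGen R v v := by
  refine ⟨fun h v hv => ?_, fun h a ha => h (f a) (ha.lift f fun _ _ => id)⟩
  have hlift {a w} (hw : Relation.TransGen R (f a) w) :
      ∀ b, f b = w → Relation.TransGen (Function.onFun R f) a b := by
    induction hw with
    | single haw =>
      rintro b rfl
      exact .single haw
    | tail _ hwu ih =>
      rintro b rfl
      obtain ⟨c, rfl⟩ := (hR hwu).1
      exact (ih c rfl).tail hwu
  obtain ⟨u, hvu, -⟩ := Relation.TransGen.head'_iff.1 hv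
  obtain ⟨a, rfl⟩ := (hR hvu).1
  exact h a (hlift hv a rfl)

namespace TournamentInst

noncomputable instance : TreeEncoding TournamentInst := ⟨TournamentInst.enc⟩

open Classical in
/-- The rows of the adjacency matrix. -/
noncomputable def rows (I : TournamentInst) : List (List Bool) :=
  matrixRows fun u v => decide (I.D.Adj u v)

open Classical in
/-- The set of arcs. -/
noncomputable def arcs (I : TournamentInst) : Finset (Fin I.n × Fin I.n) :=
  Finset.univ.filter fun e => I.D.Adj e.1 e.2

/-- The subtournament on the image of `ι`. -/
def restrict (I : TournamentInst) {m : ℕ} (ι : Fin m ↪ Fin I.n) : TournamentInst where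
  n := m
  D := ⟨fun i j => I.D.Adj (ι i) (ι j)⟩
  irrefl i := I.irrefl (ι i)
  asymm i j := I.asymm (ι i) (ι j)
  total i j hij := I.total (ι i) (ι j) (ι.injective.ne hij)

/-- The arc of the matrix `rows` that a pair of vertices of a subtournament stands for. -/
def arcLabel {m n : ℕ} (ι : Fin m ↪ Fin n) : Fin m × Fin m ↪ ℕ × ℕ :=
  (ι.trans Fin.valEmbedding).prodMap (ι.trans Fin.valEmbedding)

variable {I : TournamentInst} {k r m : ℕ}

theorem length_rows (I : TournamentInst) : I.rows.length = I.n := length_matrixRows _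

theorem entry_rows {u v : ℕ} :
    entry I.rows u v = true ↔ ∃ (hu : u < I.n) (hv : v < I.n), I.D.Adj ⟨u, hu⟩ ⟨v, hv⟩ := by
  simp [rows, entry_matrixRows]

theorem entry_rows_fin {u v : Fin I.n} : entry I.rows u v = true ↔ I.D.Adj u v :=
  entry_rows.trans ⟨fun ⟨_, _, h⟩ => h, fun h => ⟨u.2, v.2, h⟩⟩

theorem isTournament_rows (I : TournamentInst) : IsTournament I.rows where
  lt h := by
    obtain ⟨hu, hv, -⟩ := entry_rows.1 h
    rw [length_rows]
    exact ⟨hu, hv⟩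
  asymm h h' := by
    obtain ⟨hu, hv, h⟩ := entry_rows.1 h
    obtain ⟨_, _, h'⟩ := entry_rows.1 h'
    exact I.asymm _ _ h h'
  total {u v} hu hv h := by
    rw [length_rows] at hu hv
    rw [entry_rows, entry_rows]
    exact (I.total ⟨u, hu⟩ ⟨v, hv⟩ fun h' => h (congrArg Fin.val h')).imp
      (fun h => ⟨hu, hv, h⟩) fun h => ⟨hv, hu, h⟩

theorem mem_arcs {e : Fin I.n × Fin I.n} : e ∈ I.arcs ↔ I.D.Adj e.1 e.2 := by simp [arcs]

theorem n_le_card_arcs_add_one (I : TournamentInst) : I.n ≤ I.arcs.card + 1 := by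
  obtain hn | hn := Nat.eq_zero_or_pos I.n
  · exact hn.trans_le (Nat.zero_le _)
  let z : Fin I.n := ⟨0, hn⟩
  have hsurj : Set.SurjOn (fun e : Fin I.n × Fin I.n => if e.1 = z then e.2 else e.1) I.arcs
      ({z}ᶜ : Finset (Fin I.n)) := by
    intro j hj
    have hjz : j ≠ z := by simpa using hj
    obtain h | h := I.total z j hjz.symm
    · exact ⟨(z, j), mem_arcs.2 h, if_pos rfl⟩
    · exact ⟨(j, z), mem_arcs.2 h, if_neg hjz⟩
  have := Finset.card_le_card_of_surjOn _ hsurj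
  rw [Finset.card_compl, Finset.card_singleton, Fintype.card_fin] at this
  omega

theorem isSolution_restrict_iff (ι : Fin m ↪ Fin I.n) (T : Finset (Fin m × Fin m)) :
    feedbackArcSet.IsSolution (I.restrict ι) T ↔ (∀ e ∈ T, I.D.Adj (ι e.1) (ι e.2)) ∧
      IsFeedbackArcSet I.rows (Set.range fun i => (ι i : ℕ)) (T.map (arcLabel ι)) := by
  refine and_congr_right' (.trans ?_ (forall_not_transGen_onFun_iff fun h => h.1))
  have hrel : (fun a b => I.D.Adj (ι a) (ι b) ∧ (a, b) ∉ T) = Function.onFun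
      (Remaining I.rows (Set.range fun i => (ι i : ℕ)) (T.map (arcLabel ι)))
      fun i => (ι i : ℕ) := by
    ext a b
    exact .symm <| .trans (and_iff_right ⟨⟨a, rfl⟩, ⟨b, rfl⟩⟩) <|
      and_congr entry_rows_fin (Finset.mem_map' (arcLabel ι) (a := (a, b))).not
  exact hrel ▸ Iff.rfl

theorem isSolution_iff (S : Finset (Fin I.n × Fin I.n)) :
    feedbackArcSet.IsSolution I S ↔ (∀ e ∈ S, I.D.Adj e.1 e.2) ∧
      IsFeedbackArcSet I.rows (Set.range ((↑) : Fin I.n → ℕ)) (S.map (arcLabel (.refl _))) :=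
  isSolution_restrict_iff (.refl _) S

theorem length_filter_isCore_le {S : Finset (Fin I.n × Fin I.n)}
    (hS : feedbackArcSet.IsSolution I S) (hSk : S.card ≤ k) :
    ((List.range I.n).filter (isCore I.rows k)).length ≤ k * k + 3 * k := by
  have hM := I.isTournament_rows
  have hS' := (Finset.card_map (arcLabel (.refl _))).trans_le hSk
  refine hM.length_filter_isCore_le hS' (hM.isFeedbackArcSet_of_core (fun v hv => ?_) hS'
    ((isSolution_iff S).1 hS).2 _) _
  exact ⟨⟨v, (hM.lt_of_isCore hv).trans_eq I.length_rows⟩, rfl⟩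

theorem isSolution_empty (h : ((List.range I.n).filter (isCore I.rows 0)).length ≤ 0) :
    feedbackArcSet.IsSolution I ∅ := by
  have hM := I.isTournament_rows
  have hcore (v) (hv : isCore I.rows 0 v = true) : v ∈ (∅ : Set ℕ) := by
    rw [Nat.le_zero, List.length_eq_zero_iff, List.filter_eq_nil_iff] at h
    exact h v (List.mem_range.2 ((hM.lt_of_isCore hv).trans_eq I.length_rows)) hv
  refine (isSolution_iff ∅).2 ⟨by simp, ?_⟩
  refine hM.isFeedbackArcSet_of_core hcore (by simp) (fun v hv => ?_) _
  obtain ⟨u, h, -⟩ := Relation.TransGen.head'_iff.1 hv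
  exact h.1.1

/-- The vertices of the kernel. A tournament on `k * r + 1` vertices has at least
`k * r` arcs. -/
noncomputable abbrev keptVertices (I : TournamentInst) (k r : ℕ) : List ℕ :=
  keepVertices (List.range I.n) (isCore I.rows k) (k * r + 1)

/-- The vertex of the original instance that a vertex of the kernel stands for. -/
noncomputable abbrev vertexEmbedding (I : TournamentInst) (k r : ℕ) :
    Fin (I.keptVertices k r).length ↪ Fin I.n :=
  keptEmbedding I.n (isCore I.rows k) (k * r + 1)

/-- The kernel. -/
noncomputable def reduced (I : TournamentInst) (k r : ℕ) : TournamentInst :=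
  I.restrict (I.vertexEmbedding k r)

theorem length_keptVertices_le
    (h : ((List.range I.n).filter (isCore I.rows k)).length ≤ k * k + 3 * k) :
    (I.keptVertices k r).length ≤ k * k + 3 * k + (k * r + 1) :=
  length_keepVertices_le.trans (Nat.add_le_add_right h _)

theorem rows_reduced (I : TournamentInst) (k r : ℕ) :
    (I.reduced k r).rows = matrixOf (I.keptVertices k r) (entry I.rows) := by
  rw [← matrixRows_getElem]
  refine congrArg matrixRows (funext₂ fun i j => Bool.eq_iff_iff.2 ?_)
  exact (@decide_eq_true_iff _ (Classical.propDecidable _)).trans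
    (entry_rows_fin (u := I.vertexEmbedding k r i) (v := I.vertexEmbedding k r j)).symm

theorem isSolution_map_of_isSolution_reduced
    {T : Finset (Fin (I.keptVertices k r).length × Fin (I.keptVertices k r).length)}
    (hT : feedbackArcSet.IsSolution (I.reduced k r) T) (hTk : T.card ≤ k) :
    feedbackArcSet.IsSolution I
      (T.map ((I.vertexEmbedding k r).prodMap (I.vertexEmbedding k r))) := by
  have hM := I.isTournament_rows
  obtain ⟨harcs, hfas⟩ := (isSolution_restrict_iff _ T).1 hT
  have hmap : (T.map ((I.vertexEmbedding k r).prodMap (I.vertexEmbedding k r))).map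
      (arcLabel (.refl _)) = T.map (arcLabel (I.vertexEmbedding k r)) := Finset.map_map _ _ _
  refine (isSolution_iff _).2 ⟨Finset.forall_mem_map.2 harcs, hmap.symm ▸
    hM.isFeedbackArcSet_of_core (fun v hv => ?_) ((Finset.card_map _).trans_le hTk) hfas _⟩
  have hvn : v < I.n := (hM.lt_of_isCore hv).trans_eq I.length_rows
  obtain ⟨i, hi⟩ := exists_keptEmbedding_eq (m := k * r + 1) (v := ⟨v, hvn⟩)
    (mem_keepVertices_of (List.mem_range.2 hvn) hv)
  exact ⟨i, congrArg Fin.val hi⟩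

theorem isSolution_reduced_of_isSolution {S : Finset (Fin I.n × Fin I.n)}
    {T : Finset (Fin (I.keptVertices k r).length × Fin (I.keptVertices k r).length)}
    (hS : feedbackArcSet.IsSolution I S)
    (hST : ∀ e, (I.vertexEmbedding k r).prodMap (I.vertexEmbedding k r) e ∈ S → e ∈ T)
    (hT : ∀ e ∈ T, (I.vertexEmbedding k r).prodMap (I.vertexEmbedding k r) e ∈ S ∨
      e ∈ (I.reduced k r).arcs) :
    feedbackArcSet.IsSolution (I.reduced k r) T := by
  obtain ⟨harcs, hfas⟩ := (isSolution_iff S).1 hS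
  refine (isSolution_restrict_iff _ T).2 ⟨fun e he => (hT e he).elim (harcs _) mem_arcs.1,
    hfas.mono ?_⟩
  rintro _ _ ⟨⟨⟨i, rfl⟩, ⟨j, rfl⟩⟩, harc, hnot⟩
  refine ⟨⟨⟨_, rfl⟩, ⟨_, rfl⟩⟩, harc, fun hmem => hnot ?_⟩
  exact (Finset.mem_map' (arcLabel (I.vertexEmbedding k r)) (a := (i, j))).2 <| hST _ <|
    (Finset.mem_map' (arcLabel (.refl (Fin I.n)))
      (a := (I.vertexEmbedding k r i, I.vertexEmbedding k r j))).1 hmem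

theorem hasDiverseFamily_reduced_iff (I : TournamentInst) {t : ℕ} (hk : k ≠ 0) (hr : r ≠ 0) :
    HasDiverseFamily (feedbackArcSet.IsSolution (I.reduced k r)) k r t ↔
      HasDiverseFamily (feedbackArcSet.IsSolution I) k r t := by
  let ι := I.vertexEmbedding k r
  refine hasDiverseFamily_iff_of_embedding (ι.prodMap ι) (I.reduced k r).arcs (fun hι => ?_) hk hr
    (fun T hTk hT => isSolution_map_of_isSolution_reduced hT hTk)
    fun S T _ => isSolution_reduced_of_isSolution
  refine Nat.le_of_succ_le_succ <| le_trans ?_ (I.reduced k r).n_le_card_arcs_add_one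
  exact le_length_of_keptEmbedding_not_surjective fun hsurj => hι (hsurj.prodMap hsurj)

end TournamentInst

namespace PolyTimeFun

open TournamentInst

variable {γ : Type} [TreeEncoding γ]

@[fun_prop]
theorem tournament_rows {f : γ → TournamentInst} (hf : PolyTimeFun f) :
    PolyTimeFun (fun c => (f c).rows) :=
  hf.of_enc_eq fun _ => rfl

@[fun_prop]
theorem tournament_range_n {f : γ → TournamentInst} (hf : PolyTimeFun f) :
    PolyTimeFun (fun c => List.range (f c).n) :=
  hf.tournament_rows.list_range_length.congr fun _ => congrArg List.range (length_rows _)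

theorem tournament_reduced :
    PolyTimeFun (fun x : TournamentInst × ℕ × ℕ => x.1.reduced x.2.1 x.2.2) := by
  refine (show PolyTimeFun (fun x : TournamentInst × ℕ × ℕ =>
    matrixOf (x.1.keptVertices x.2.1 x.2.2) (entry x.1.rows)) by
      unfold keptVertices; fun_prop).of_enc_eq fun x => ?_
  rw [← rows_reduced]
  rfl

end PolyTimeFun

open TournamentInst in
theorem hasDiverseKernel_feedbackArcSet :
    HasDiverseKernel feedbackArcSet (fun k r => k * (k + r)) := by
  have good_iff {I : TournamentInst} {k : ℕ} :=
    decide_eq_true_iff (p := ((List.range I.n).filter (isCore I.rows k)).length ≤ k * k + 3 * k)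
  refine .of_reduction (Q := feedbackArcSet)
    ⟨0, ⟨fun _ _ => False⟩, fun u => u.elim0, fun u => u.elim0, fun u => u.elim0⟩ rfl
    (good := fun I k _ =>
      decide (((List.range I.n).filter (isCore I.rows k)).length ≤ k * k + 3 * k))
    (red := reduced) (by fun_prop) PolyTimeFun.tournament_reduced
    (fun I k r S _ hS hSk => good_iff.2 (length_filter_isCore_le hS hSk))
    (fun I _ h => isSolution_empty (good_iff.1 h))
    (fun I k r t => I.hasDiverseFamily_reduced_iff) ?_
    ⟨5, fun I k r hk _ h => (length_keptVertices_le (good_iff.1 h)).trans ?_⟩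
  · let s : Polynomial ℕ := .X * .X + 3 * .X + (.X * .X + 1)
    refine ⟨s * (s * 4 + 2) + 1, fun I k r h => (encMatrix_size_le _).trans ?_⟩
    have hn : (I.reduced k r).n ≤ s.eval (k + r) := by
      refine (length_keptVertices_le (good_iff.1 h)).trans ?_
      simp only [s, Polynomial.eval_add, Polynomial.eval_mul, Polynomial.eval_X,
        Polynomial.eval_one, Polynomial.eval_ofNat]
      gcongr <;> omega
    simp only [Polynomial.eval_add, Polynomial.eval_mul, Polynomial.eval_one,
      Polynomial.eval_ofNat]
    gcongr
  · have : 1 ≤ k := Nat.one_le_iff_ne_zero.2 hk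
    nlinarith

end FeedbackArcSet

theorem corollary5p4 :
    HasDiverseKernel vertexCover (fun k r => k * (k + r)) ∧
    (∀ d : ℕ, HasDiverseKernel (hittingSet d) (fun k r => k ^ d + k * r)) ∧
    (HasDiverseKernel pointLineCover (fun k r => k * (k + r)) ∧
      HasDiverseKernel spannedPointLineCover (fun k r => k ^ 2 * (k + r))) ∧
    HasDiverseKernel feedbackArcSet (fun k r => k * (k + r)) :=
  ⟨hasDiverseKernel_vertexCover, hasDiverseKernel_hittingSet,
    ⟨hasDiverseKernel_pointLineCover, hasDiverseKernel_spannedPointLineCover⟩,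
    hasDiverseKernel_feedbackArcSet⟩
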